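/- **Setting.** Let $K\ge 1$ and let $\{\nu_m\}$ be either the Bernoulli family (means $m\in\mathcal M=(0,1)$) or the Poisson family (means $m\in\mathcal M=(0,\infty)$); $d(a,b)$ is the Kullback–Leibler divergence between the members of the family with means $a$ and $b$ (also for $a$ on the boundary of $\mathcal M$), and $d_B$ is $d$ for the Bernoulli family. Let $\gamma\in\mathcal M$. For $\mu\in\mathcal M^K$, under $\mathbb P_\mu$ the measurements $X_k(t)$ ($1\le k\le K$, $t\ge1$) are independent with $X_k(t)\sim\nu_{\mu_k}$. Slice $k$ is *available* if $\mu_k<\gamma$. Let $\mu_\star=\min_k\mu_k$, let $k_\star$ be a slice with $\mu_{k_\star}=\mu_\star$ and, if $\mu_\star<\gamma$, let $k^\star$ be an available slice of maximal load and $\mu^\star=\mu_{k^\star}$. The set $\mathcal C(\mu)\subset\{0,\dots,K\}$ of correct answers is $\{0\}$ if $\mu_\star\ge\gamma$; otherwise it consists of all available slices (criterion 1, any-available-slice), of the available slices of maximal load (criterion 2, packing-slice), or of the slices of minimal load (criterion 3, least-loaded-slice). Call $\mu\in\mathcal M^K$ *identifiable* for a criterion if $\mu_\star\ne\gamma$ and,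 in case $\mu_\star<\gamma$: for criterion 2, $k^\star$ is unique and no $\mu_k$ equals $\gamma$; for criterion 3, $k_\star$ is unique. **Characteristic times and proportions.** For $j\ne k$ put $g_{j,k}(x)=d(\mu_k,m_x)+x\,d(\mu_j,m_x)$ with $m_x=\frac{\mu_k+x\mu_j}{1+x}$, $x\ge0$, let $x_{j,k}=g_{j,k}^{-1}$, and let $x_{k,k}\equiv1$. For a set $S$ of slices let $F_k(y;S)=\sum_{j\in S}\frac{d(\mu_k,m)}{d(\mu_j,m)}$ with $m=\frac{\mu_k+x_{j,k}(y)\mu_j}{1+x_{j,k}(y)}$, let $y_k(S)$ be the solution in $0<y<\min_{j\in S}d(\mu_k,\mu_j)$ of $F_k(y;S)=1$ ($y_k(\emptyset)=\infty$), and let $z_k(S)=\min(d(\mu_k,\gamma),y_k(S))$. Write $z^\star=z_{k^\star}(\{j:\mu_j<\mu^\star\})$ and $z_\star=z_{k_\star}(\{j:\mu_j>\mu_\star\})$. - If $\mu_\star>\gamma$, then for all $i$: $T_i(\mu)=\sum_k d(\mu_k,\gamma)^{-1}$ and $w^\star_k(\mu)=d(\mu_k,\gamma)^{-1}/T_i(\mu)$.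 - If $\mu_\star<\gamma$: - $T_1(\mu)=d(\mu_\star,\gamma)^{-1}$, $w^\star_k(\mu)=\mathbf 1(k=k_\star)$; - $T_2(\mu)=\sum_{k:\mu_k>\gamma}d(\mu_k,\gamma)^{-1}+\frac1{z^\star}\sum_{k:\mu_k<\gamma}x_{k,k^\star}(z^\star)$, $w^\star_k(\mu)=\frac1{T_2(\mu)}\Big(\frac{x_{k,k^\star}(z^\star)\mathbf 1(\mu_k<\gamma)}{z^\star}+\frac{\mathbf 1(\mu_k>\gamma)}{d(\mu_k,\gamma)}\Big)$; - $T_3(\mu)=\frac1{z_\star}\sum_k x_{k,k_\star}(z_\star)$, $w^\star_k(\mu)=\frac{x_{k,k_\star}(z_\star)}{z_\star T_3(\mu)}$. At the remaining $\mu$, where these expressions may be undefined, $w^\star(\mu)$ is extended by arbitrary fixed values. Finally let $\mathcal C^\star(\mu)\subset\mathcal C(\mu)$ be the set of maximizers over $a\in\mathcal C(\mu)$ of $\sup_{w}\inf_{\lambda\in\mathcal M^K:\,a\notin\mathcal C(\lambda)}\sum_k w_kd(\mu_k,\lambda_k)$, where $w$ ranges over the probability vectors. **Track-and-Stop** for a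 criterion, with confidence $\delta\in(0,1)$ and constant $C$. In round $t=1,2,\dots$ let $n_k(t-1)$ and $\hat\mu_k(t-1)$ be the number and the mean of the previous measurements of slice $k$ (mean $0$ if there are none), let $k_E(t)=\min\mathcal C^\star(\hat\mu(t-1))$ and $Q(t)=\inf_{\lambda\in\mathcal M^K:\,k_E(t)\notin\mathcal C(\lambda)}\sum_kn_k(t-1)\,d(\hat\mu_k(t-1),\lambda_k)$. If $Q(t)>f_\delta(t)=\log(Ct^2/\delta)$, stop, with $\tau=t-1$ measurements made, and return $\hat k=k_E(t)$. Otherwise measure in slot $t$ a slice $k_t$ with the smallest $n_k(t-1)$ if some $n_k(t-1)<\sqrt t$, and else a slice maximizing $t\,w^\star_k(\hat\mu(t-1))-n_k(t-1)$; ties are broken by an arbitrary fixed rule depending on the past observations. **Theorem.** Let $C\ge1$ satisfy $C\ge e\sum_{t=1}^\infty\left(\frac eK\right)^K\frac{(\log(Ct^2)\log t)^K}{t^2}$, and run Track-and-Stop for criterion $i\in\{1,2,3\}$. 1. For every $\delta\in(0,1)$ the algorithm is $\delta$-PC: for every identifiable $\mu$, $\mathbb P_\mu[\tau<\infty]=1$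 and $\mathbb P_\mu[\hat k\notin\mathcal C(\mu)]\le\delta$. Moreover, for every $\mu\in\mathcal M^K$, $\mathbb P_\mu[\tau<\infty,\ \hat k\notin\mathcal C(\mu)]\le\delta$. 2. For every identifiable $\mu$ such that $k_\star$ is unique, $$\limsup_{\delta\to0}\frac{\mathbb E_\mu[\tau]}{d_B(\delta,1-\delta)}\le 2\,T_i(\mu).$$ -/

import Mathlib

open MeasureTheory ProbabilityTheory InformationTheory Filter Topology
open scoped ENNReal NNReal

noncomputable section

namespace SliceTaS

/-! ### Traffic model -/

/-- The two packet arrival models: Bernoulli and Poisson numbers of packets per slot. -/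
inductive Family
  | bernoulli
  | poisson

namespace Family

/-- The (open) set of means of the one-parameter exponential family. -/
def means : Family → Set ℝ
  | bernoulli => Set.Ioo 0 1
  | poisson => Set.Ioi 0

/-- The law on `ℕ` of the family with mean `m`. It is the Bernoulli law with parameter `m` for
`0 ≤ m ≤ 1`, respectively the Poisson law with parameter `m` for `0 ≤ m`; other values of `m`
are clamped to these ranges (they are never reached by the mean of a sample). -/
def law : Family → ℝ → Measure ℕ
  | bernoulli, m => bernoulliMeasure 1 0 (Set.projIcc 0 1 zero_le_one m)
  | poisson, m => poissonMeasure m.toNNReal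

instance isProbabilityMeasure_law (F : Family) (m : ℝ) : IsProbabilityMeasure (F.law m) := by
  cases F <;> (unfold law; infer_instance)

/-- The Kullback-Leibler divergence between the laws with means `a` and `b`, in `[0, ∞]`. -/
def kl (F : Family) (a b : ℝ) : ℝ≥0∞ := klDiv (F.law a) (F.law b)

/-- The Kullback-Leibler divergence between the laws with means `a` and `b`, as a real number. -/
def d (F : Family) (a b : ℝ) : ℝ := (F.kl a b).toReal

end Family

/-- All measurements that could be made: coordinate `(k, t)` is the number of packets that slice
`k` handles in slot `t`. -/
abbrev Outcomes (K : ℕ) : Type := Fin K × ℕ → ℕ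

/-- The law `ℙ_μ`: the entries are independent and those of slice `k` have mean `μ k`. -/
def prob {K : ℕ} (F : Family) (μ : Fin K → ℝ) : Measure (Outcomes K) :=
  Measure.infinitePi fun p : Fin K × ℕ => F.law (μ p.1)

/-! ### Admission criteria. Decisions are elements of `Fin (K + 1)`: `0` rejects the flow and
`k.succ` admits it on slice `k`. -/

inductive Criterion
  | anyAvailable
  | packing
  | leastLoaded

/-- Slice `k` is a least loaded slice. -/
def IsLeastLoaded {K : ℕ} (μ : Fin K → ℝ) (k : Fin K) : Prop := ∀ j, μ k ≤ μ j

/-- Slice `k` is a most loaded slice among the available ones. -/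
def IsPacking {K : ℕ} (γ : ℝ) (μ : Fin K → ℝ) (k : Fin K) : Prop :=
  μ k < γ ∧ ∀ j, μ j < γ → μ j ≤ μ k

open Classical in
/-- The set `𝓒(μ)` of correct answers. -/
def correct {K : ℕ} (c : Criterion) (γ : ℝ) (μ : Fin K → ℝ) : Set (Fin (K + 1)) :=
  if ∃ k, μ k < γ then
    match c with
    | .anyAvailable => {a | ∃ k : Fin K, a = k.succ ∧ μ k < γ}
    | .packing => {a | ∃ k : Fin K, a = k.succ ∧ IsPacking γ μ k}
    | .leastLoaded => {a | ∃ k : Fin K, a = k.succ ∧ IsLeastLoaded μ k}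
  else {0}

/-- The instances whose correct answer can be identified: the minimal load differs from `γ`, and,
if there is an available slice, the packing slice is unique and no load equals `γ` (packing),
respectively the least loaded slice is unique (least loaded). -/
def Identifiable {K : ℕ} (c : Criterion) (γ : ℝ) (μ : Fin K → ℝ) : Prop :=
  (⨅ k, μ k) ≠ γ ∧
    match c with
    | .anyAvailable => True
    | .packing => (∃ k, μ k < γ) → (∀ k, μ k ≠ γ) ∧ ∃! k, IsPacking γ μ k
    | .leastLoaded => (∃ k, μ k < γ) → ∃! k, IsLeastLoaded μ k

/-! ### Joint measurement and decision algorithms -/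

/-- The measurements made so far, most recent first: which slice was measured, and the number of
packets observed. -/
abbrev History (K : ℕ) : Type := List (Fin K × ℕ)

/-- A measurement and decision algorithm: the slice to measure next, the stopping condition, and the
decision returned when stopping, as functions of the measurements made so far. -/
structure Algorithm (K : ℕ) where
  sample : History K → Fin K
  halts : History K → Prop
  decision : History K → Fin (K + 1)

namespace Algorithm

variable {K : ℕ}

/-- The first `t` measurements. The `t`-th one is made in slot `t`. -/
def hist (A : Algorithm K) (x : Outcomes K) : ℕ → History K
  | 0 => []
  | t + 1 =>
    (A.sample (A.hist x t), x (A.sample (A.hist x t), t + 1)) :: A.hist x t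

/-- The number `τ` of measurements made before stopping (`⊤` if the algorithm never stops). -/
def tau (A : Algorithm K) (x : Outcomes K) : ℕ∞ :=
  ⨅ (t : ℕ) (_ : A.halts (A.hist x t)), (t : ℕ∞)

/-- The algorithm stops and returns an answer that is not correct for `μ`. -/
def errorEvent (A : Algorithm K) (c : Criterion) (γ : ℝ) (μ : Fin K → ℝ) : Set (Outcomes K) :=
  {x | A.tau x ≠ ⊤ ∧ A.decision (A.hist x (A.tau x).toNat) ∉ correct c γ μ}

/-- `δ`-probable correctness, over a class `𝓜` of instances. -/
def IsDeltaPC (A : Algorithm K) (F : Family) (c : Criterion) (γ δ : ℝ)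
    (𝓜 : Set (Fin K → ℝ)) : Prop :=
  ∀ μ ∈ 𝓜, (∀ᵐ x ∂prob F μ, A.tau x ≠ ⊤) ∧
    prob F μ (A.errorEvent c γ μ) ≤ ENNReal.ofReal δ

/-- The expected measurement cost `𝔼_μ[τ]`. -/
def expectedCost (A : Algorithm K) (F : Family) (μ : Fin K → ℝ) : ℝ≥0∞ :=
  ∫⁻ x, (A.tau x : ℝ≥0∞) ∂prob F μ

end Algorithm

/-! ### Characteristic times and optimal proportions -/

section Oracle

variable {K : ℕ} (F : Family) (γ : ℝ) (μ : Fin K → ℝ)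

/-- The infimum of `∑ k, v_k d(μ_k, λ_k)` over the instances `λ` for which `a` is not correct. -/
def altInf (c : Criterion) (v : Fin K → ℝ≥0∞) (a : Fin (K + 1)) : ℝ≥0∞ :=
  ⨅ (l : Fin K → ℝ) (_ : (∀ k, l k ∈ F.means) ∧ a ∉ correct c γ l),
    ∑ k, v k * F.kl (μ k) (l k)

/-- The maximal value over proportions `w` of the infimum above. -/
def answerValue (c : Criterion) (a : Fin (K + 1)) : ℝ≥0∞ :=
  ⨆ w ∈ stdSimplex ℝ (Fin K), altInf F γ μ c (fun k => ENNReal.ofReal (w k)) a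

/-- The set `𝓒^⋆(μ)` of the correct answers that are easiest to identify. -/
def easiest (c : Criterion) : Set (Fin (K + 1)) :=
  {a | a ∈ correct c γ μ ∧
    ∀ b ∈ correct c γ μ, answerValue F γ μ c b ≤ answerValue F γ μ c a}

/-- The information deviation function `g_{j,k}`. -/
def g (j k : Fin K) (x : ℝ) : ℝ :=
  F.d (μ k) ((μ k + x * μ j) / (1 + x)) + x * F.d (μ j) ((μ k + x * μ j) / (1 + x))

/-- The inverse `x_{j,k}` of `g_{j,k}` on `[0, ∞)`, with the convention `x_{k,k} = 1`. -/
def xInv (j k : Fin K) (y : ℝ) : ℝ :=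
  if j = k then 1 else Function.invFunOn (g F μ j k) (Set.Ici 0) y

/-- The equilibrium function `F_k(y; S)`. -/
def equilibrium (k : Fin K) (S : Finset (Fin K)) (y : ℝ) : ℝ :=
  ∑ j ∈ S,
    F.d (μ k) ((μ k + xInv F μ j k y * μ j) / (1 + xInv F μ j k y)) /
      F.d (μ j) ((μ k + xInv F μ j k y * μ j) / (1 + xInv F μ j k y))

/-- The solution `y` of `F_k(y; S) = 1`, in the range where all `x_{j,k}(y)`, `j ∈ S`, are
defined. For identifiable instances and `S ≠ ∅` this set is a singleton. -/
def ySol (k : Fin K) (S : Finset (Fin K)) : ℝ :=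
  sInf {y | 0 < y ∧ (∀ j ∈ S, y < F.d (μ k) (μ j)) ∧ equilibrium F μ k S y = 1}

open Classical in
/-- `min (d(μ_k, γ), y)` with `y` the solution of `F_k(y; S) = 1`; if `S` is empty, there is no
such equation and the value is `d(μ_k, γ)`. -/
def zVal (k : Fin K) (S : Finset (Fin K)) : ℝ :=
  if S = ∅ then F.d (μ k) γ else min (F.d (μ k) γ) (ySol F μ k S)

variable [NeZero K]

/-- A least loaded slice. -/
def kLow : Fin K := Classical.epsilon (IsLeastLoaded μ)

/-- A most loaded available slice (if there is an available slice). -/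
def kPack : Fin K := Classical.epsilon (IsPacking γ μ)

open Classical in
/-- The value `z` of the packing problem. -/
def zPack : ℝ := zVal F γ μ (kPack γ μ) {j | μ j < μ (kPack γ μ)}

open Classical in
/-- The value `z` of the least loaded problem. -/
def zLow : ℝ := zVal F γ μ (kLow μ) {j | μ (kLow μ) < μ j}

open Classical in
/-- The characteristic time `T(μ)` of the criterion: `T₀` if no slice is available, and `T₁`, `T₂`,
`T₃` for the three criteria otherwise. -/
def charTime (c : Criterion) : ℝ :=
  if ∃ k, μ k < γ then
    match c with
    | .anyAvailable => (F.d (μ (kLow μ)) γ)⁻¹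
    | .packing =>
        (∑ k with γ < μ k, (F.d (μ k) γ)⁻¹) +
          (zPack F γ μ)⁻¹ * ∑ k with μ k < γ, xInv F μ k (kPack γ μ) (zPack F γ μ)
    | .leastLoaded => (zLow F γ μ)⁻¹ * ∑ k, xInv F μ k (kLow μ) (zLow F γ μ)
  else ∑ k, (F.d (μ k) γ)⁻¹

open Classical in
/-- The optimal proportions `w^⋆(μ)`. -/
def wStar (c : Criterion) (k : Fin K) : ℝ :=
  if ∃ j, μ j < γ then
    match c with
    | .anyAvailable => if k = kLow μ then 1 else 0
    | .packing =>
        (charTime F γ μ .packing)⁻¹ *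
          ((if μ k < γ then xInv F μ k (kPack γ μ) (zPack F γ μ) / zPack F γ μ else 0) +
            (if γ < μ k then (F.d (μ k) γ)⁻¹ else 0))
    | .leastLoaded =>
        xInv F μ k (kLow μ) (zLow F γ μ) / (zLow F γ μ * charTime F γ μ .leastLoaded)
  else (F.d (μ k) γ)⁻¹ / charTime F γ μ c


end Oracle

/-! ### Track-and-Stop -/

section TrackAndStop

variable {K : ℕ}

/-- The number `n_k` of measurements of slice `k`. -/
def count (h : History K) (k : Fin K) : ℕ := (h.filter fun p => p.1 = k).length

/-- The empirical mean of slice `k`, which is `0` before its first measurement. -/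
def muHat (h : History K) (k : Fin K) : ℝ :=
  (((h.filter fun p => p.1 = k).map fun p => p.2).sum : ℝ) / count h k

/-- The current round `t`, after `t - 1` measurements. -/
def roundNo (h : History K) : ℕ := h.length + 1

/-- The current candidate answer `k_E`. -/
def candidate (F : Family) (c : Criterion) (γ : ℝ) (h : History K) : Fin (K + 1) :=
  sInf (easiest F γ (muHat h) c)

/-- The statistic `Q`. -/
def statQ (F : Family) (c : Criterion) (γ : ℝ) (h : History K) : ℝ≥0∞ :=
  altInf F γ (muHat h) c (fun k => (count h k : ℝ≥0∞)) (candidate F c γ h)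

/-- The exploration threshold `f_δ(t) = log (C t² / δ)`. -/
def threshold (C δ : ℝ) (t : ℕ) : ℝ := Real.log (C * (t : ℝ) ^ 2 / δ)

/-- A sampling rule is one of Track-and-Stop if it measures a least measured slice whenever some
slice was measured fewer than `√t` times, and otherwise tracks the proportions `w^⋆` at the
empirical means. Ties are broken arbitrarily. -/
def IsTrackingRule [NeZero K] (F : Family) (c : Criterion) (γ : ℝ)
    (ρ : History K → Fin K) : Prop :=
  ∀ h : History K,
    ((∃ k, (count h k : ℝ) < √(roundNo h : ℝ)) → ∀ j, count h (ρ h) ≤ count h j) ∧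
    ((¬ ∃ k, (count h k : ℝ) < √(roundNo h : ℝ)) →
      ∀ j, (roundNo h : ℝ) * wStar F γ (muHat h) c j - count h j ≤
        (roundNo h : ℝ) * wStar F γ (muHat h) c (ρ h) - count h (ρ h))

/-- Track-and-Stop with sampling rule `ρ`. -/
def trackAndStop (F : Family) (c : Criterion) (γ C δ : ℝ) (ρ : History K → Fin K) :
    Algorithm K where
  sample := ρ
  halts h := ENNReal.ofReal (threshold C δ (roundNo h)) < statQ F c γ h
  decision h := candidate F c γ h

end TrackAndStop

end SliceTaS

end

open MeasureTheory ProbabilityTheory InformationTheory Filter Topology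
open scoped ENNReal NNReal

noncomputable section

namespace SliceTaS

/-! Errors. If Track-and-Stop stops with an answer that is wrong for `μ`, then the candidate is
already refuted by an alternative that moves at most two slices, all others staying as close to the
sample means as desired. Hence (`exists_deviation_of_wrong`) the statistic `Q` is at most the
deviation of one sample mean from its true value, or the joint deviation of two slices whose sample
means are ordered against the true ones. One slice of such a pair depends on `μ` only, so the union
bound runs over `K` slices and `K - 1` pairs. Each event is handled by a maximal inequality,
`prob_exists_hist_mem_le`: whenever the true likelihood of the observations is dominated by a
product of sequential sub-likelihoods, one per slice, the event has at most the initial weight, for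
any sampling rule and uniformly in time.

For one slice, tilting the mean at each fixed number of observations costs `2 δ / C`
(`prob_oneDev_le`). For a Bernoulli pair, mixing over a uniform prior costs a factor at most `t²`,
which the threshold contains (`prob_pairDev_bernoulli`). For a Poisson pair the support is
unbounded. Instead, the two sums are compared given their total: they are then binomial, and `Q`,
minimized over a common mean, is the binomial deviation. The Chernoff bound over all splits of `s`
observations leaves `δ / (C (s + 1))`, whose sum diverges logarithmically. Large `s` are treated by
peeling, and for small `δ` a refinement of the Chernoff bound, better by a power of `log (C / δ)`,
beats the remaining logarithm; the total is `204 δ / C` (`prob_pairDev_poisson`). The series that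
bounds `C` from below is large enough to pay for all these events (`const_ge_of_threshold_series`).

Termination. Forced exploration measures every slice about `√t` times, so the sample means lie near
`μ` except with a probability of order `exp (-r √t)`. There `Q` is at least a multiple of the
smallest count, and `√t` beats the logarithmic threshold (`ae_tau_ne_top`). No continuity of the
proportions is required for criterion 1 here.

Cost. If the least loaded slice is also unique, the unnormalized optimal proportions are continuous
at `μ`, because the inverse information functions and the equilibrium level are (`tendsto_xInv`,
`tendsto_ySol`), and they guarantee information almost `1` against every alternative of instances
near `μ` (`exists_isWeight`). Tracking makes the counts follow `t w^⋆`, so `Q` grows at rate nearly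
`1 / T`. The factor `2` in the claim leaves room for crude constants: stopping after `3/2 T log (1 /
δ)` rounds up to summable probabilities (`exists_prob_not_halts_le`) is enough. -/

variable {K : ℕ}

/-! ### The exponential families and their divergence -/

namespace Family

/-- The closure of the set of means. -/
def closedMeans : Family → Set ℝ
  | bernoulli => Set.Icc 0 1
  | poisson => Set.Ici 0

/-- The natural parameter of the member of the family with mean `m`. -/
def natParam : Family → ℝ → ℝ
  | bernoulli, m => Real.log m - Real.log (1 - m)
  | poisson, m => Real.log m

/-- The log-partition function, in the mean parametrization. -/
def logPart : Family → ℝ → ℝ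
  | bernoulli, m => -Real.log (1 - m)
  | poisson, m => m

/-- The convex conjugate of the log-partition function. -/
def conj : Family → ℝ → ℝ
  | bernoulli, m => m * Real.log m + (1 - m) * Real.log (1 - m)
  | poisson, m => m * Real.log m - m

/-- The density of the carrier measure of the exponential family. -/
def carrier : Family → ℕ → ℝ
  | bernoulli, v => if v ≤ 1 then 1 else 0
  | poisson, v => (v.factorial : ℝ)⁻¹

lemma means_subset_closedMeans (F : Family) : F.means ⊆ F.closedMeans := by
  cases F
  · exact Set.Ioo_subset_Icc_self
  · exact Set.Ioi_subset_Ici_self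

lemma carrier_nonneg (F : Family) (v : ℕ) : 0 ≤ F.carrier v := by
  cases F
  · simp only [carrier]; split_ifs <;> norm_num
  · simp only [carrier]; positivity

lemma isOpen_means (F : Family) : IsOpen F.means := by
  cases F
  · exact isOpen_Ioo
  · exact isOpen_Ioi

lemma law_bernoulli_singleton {m : ℝ} (hm : m ∈ Set.Icc (0 : ℝ) 1) (v : ℕ) :
    bernoulli.law m {v} = ENNReal.ofReal (if v = 0 then 1 - m else if v = 1 then m else 0) := by
  have h1 : (Set.projIcc (0 : ℝ) 1 zero_le_one m : ℝ) = m := by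
    rw [Set.projIcc_of_mem _ hm]
  simp only [law]
  rw [bernoulliMeasure_apply _ (measurableSet_singleton v)]
  have e1 : (unitInterval.toNNReal (Set.projIcc (0 : ℝ) 1 zero_le_one m) : ℝ≥0∞)
      = ENNReal.ofReal m := by
    rw [ENNReal.ofReal, ENNReal.coe_inj]
    apply NNReal.eq
    rw [Real.coe_toNNReal _ hm.1]
    exact h1
  have e2 : (unitInterval.toNNReal (unitInterval.symm (Set.projIcc (0 : ℝ) 1 zero_le_one m)) : ℝ≥0∞)
      = ENNReal.ofReal (1 - m) := by
    rw [ENNReal.ofReal, ENNReal.coe_inj]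
    apply NNReal.eq
    rw [Real.coe_toNNReal _ (by linarith [hm.2])]
    change 1 - (Set.projIcc (0 : ℝ) 1 zero_le_one m : ℝ) = 1 - m
    rw [h1]
  rcases v with _ | _ | v
  · rw [if_neg (by simp), if_pos (by simp), e2, if_pos rfl]
  · simp [e1]
  · simp

lemma law_poisson_singleton {m : ℝ} (hm : 0 ≤ m) (v : ℕ) :
    poisson.law m {v} = ENNReal.ofReal (Real.exp (-m) * m ^ v / v.factorial) := by
  simp only [law]
  rw [poissonMeasure_singleton, Real.coe_toNNReal _ hm]

lemma law_singleton {F : Family} {m : ℝ} (hm : m ∈ F.means) (v : ℕ) :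
    F.law m {v} =
      ENNReal.ofReal (F.carrier v * Real.exp (v * F.natParam m - F.logPart m)) := by
  cases F
  · have hm' : 0 < m ∧ m < 1 := hm
    rw [law_bernoulli_singleton ⟨hm'.1.le, hm'.2.le⟩]
    congr 1
    rcases v with _ | _ | v
    · simp [carrier, natParam, logPart, Real.exp_log (by linarith : 0 < 1 - m)]
    · simp [carrier, natParam, logPart, Real.exp_log hm'.1]
    · simp [carrier]
  · have hm' : 0 < m := hm
    rw [law_poisson_singleton hm'.le]
    congr 1
    simp only [carrier, natParam, logPart]
    rw [sub_eq_add_neg, Real.exp_add, Real.exp_nat_mul, Real.exp_log hm']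
    field_simp

lemma lintegral_law (F : Family) (m : ℝ) (f : ℕ → ℝ≥0∞) :
    ∫⁻ v, f v ∂F.law m = ∑' v, f v * F.law m {v} := lintegral_countable' f

lemma tsum_law_singleton (F : Family) (m : ℝ) : ∑' v, F.law m {v} = 1 := by
  have := F.lintegral_law m (fun _ => 1)
  simpa using this.symm

lemma hasSum_mean_poisson (r : ℝ) :
    HasSum (fun n : ℕ => Real.exp (-r) * r ^ n / n.factorial * n) r := by
  have h := (NormedSpace.expSeries_div_hasSum_exp (r : ℝ)).mul_left (Real.exp (-r) * r)
  rw [← Real.exp_eq_exp_ℝ] at h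
  have e : Real.exp (-r) * r * Real.exp r = r := by
    rw [mul_right_comm, ← Real.exp_add]; simp
  rw [e] at h
  rw [← hasSum_nat_add_iff' 1]
  simp only [Finset.range_one, Finset.sum_singleton, Nat.cast_zero, mul_zero, sub_zero]
  refine h.congr_fun ?_ |> fun h' => h'
  intro n
  rw [Nat.factorial_succ]
  push_cast
  field_simp
  ring

lemma integrable_id_law (F : Family) {m : ℝ} (hm : m ∈ F.closedMeans) :
    Integrable (fun v : ℕ => (v : ℝ)) (F.law m) := by
  cases F
  · simp only [law, bernoulliMeasure_def]
    exact Integrable.add_measure (Integrable.smul_measure (integrable_dirac (by simp)) (by simp))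
      (Integrable.smul_measure (integrable_dirac (by simp)) (by simp))
  · have hm' : 0 ≤ m := hm
    simp only [law]
    rw [integrable_poissonMeasure_iff, Real.coe_toNNReal _ hm']
    simpa using (hasSum_mean_poisson m).summable

lemma integral_id_law (F : Family) {m : ℝ} (hm : m ∈ F.closedMeans) :
    ∫ v, (v : ℝ) ∂F.law m = m := by
  cases F
  · have hm' : m ∈ Set.Icc (0 : ℝ) 1 := hm
    rw [integral_countable (integrable_id_law bernoulli hm)]
    simp only [measureReal_def, law_bernoulli_singleton hm']
    rw [tsum_eq_single 1]
    · simp [hm'.1]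
    · intro b hb
      rcases b with _ | _ | b <;> simp at hb ⊢
  · have hm' : 0 ≤ m := hm
    simp only [law]
    rw [integral_poissonMeasure, Real.coe_toNNReal _ hm']
    simpa using (hasSum_mean_poisson m).tsum_eq

end Family

/-- The Kullback-Leibler divergence of measures on `ℕ` with an explicit log-likelihood ratio. -/
lemma klDiv_eq_of_exp_ratio {P Q : Measure ℕ} [IsProbabilityMeasure P] [IsProbabilityMeasure Q]
    {l : ℕ → ℝ} (h : ∀ v, P {v} = ENNReal.ofReal (Real.exp (l v)) * Q {v})
    (hl : Integrable l P) : klDiv P Q = ENNReal.ofReal (∫ v, l v ∂P) := by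
  have hP : P = Q.withDensity (fun v => ENNReal.ofReal (Real.exp (l v))) := by
    refine Measure.ext_of_singleton fun v => ?_
    rw [withDensity_apply _ (measurableSet_singleton v), lintegral_singleton, h v]
  have hac : P ≪ Q := by rw [hP]; exact withDensity_absolutelyContinuous _ _
  have hrn : P.rnDeriv Q =ᵐ[Q] fun v => ENNReal.ofReal (Real.exp (l v)) := by
    conv_lhs => rw [hP]
    exact Measure.rnDeriv_withDensity _ (by fun_prop)
  have hllr : llr P Q =ᵐ[P] l := by
    filter_upwards [hac.ae_le hrn] with v hv
    rw [llr, hv, ENNReal.toReal_ofReal (Real.exp_nonneg _), Real.log_exp]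
  rw [klDiv_of_ac_of_integrable hac ((integrable_congr hllr).2 hl), integral_congr_ae hllr]
  simp

/-- Covers the boundary means, where the law degenerates to a point mass and the log-likelihood
ratio is not affine in the observation. -/
lemma klDiv_dirac {Q : Measure ℕ} [IsProbabilityMeasure Q] (v₀ : ℕ) {q : ℝ} (hq : 0 < q)
    (h : Q {v₀} = ENNReal.ofReal q) :
    klDiv (Measure.dirac v₀) Q = ENNReal.ofReal (-Real.log q) := by
  have hP : Measure.dirac v₀ = Q.withDensity (fun v => if v = v₀ then ENNReal.ofReal q⁻¹ else 0) := by
    refine Measure.ext_of_singleton fun v => ?_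
    rw [withDensity_apply _ (measurableSet_singleton v), lintegral_singleton]
    by_cases hv : v = v₀
    · subst hv
      rw [if_pos rfl, h, ← ENNReal.ofReal_mul (by positivity), inv_mul_cancel₀ hq.ne']
      simp
    · simp [hv, Ne.symm hv]
  have hac : Measure.dirac v₀ ≪ Q := by rw [hP]; exact withDensity_absolutelyContinuous _ _
  have hrn : (Measure.dirac v₀).rnDeriv Q =ᵐ[Q]
      fun v => if v = v₀ then ENNReal.ofReal q⁻¹ else 0 := by
    conv_lhs => rw [hP]
    exact Measure.rnDeriv_withDensity _ (by fun_prop)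
  have hllr : llr (Measure.dirac v₀) Q =ᵐ[Measure.dirac v₀] fun _ => -Real.log q := by
    have h0 : ∀ᵐ v ∂(Measure.dirac v₀), v = v₀ := by simp [ae_dirac_eq]
    filter_upwards [hac.ae_le hrn, h0] with v hv hv0
    rw [llr, hv, if_pos hv0, ENNReal.toReal_ofReal (by positivity), Real.log_inv]
  rw [klDiv_of_ac_of_integrable hac ((integrable_congr hllr).2 (integrable_const _)),
    integral_congr_ae hllr]
  simp

namespace Family

/-- Equality in the Fenchel inequality at dual parameters. The convention `log 0 = 0` makes it valid
at the boundary means too. -/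
lemma mul_natParam_sub_logPart (F : Family) (a : ℝ) :
    a * F.natParam a - F.logPart a = F.conj a := by
  cases F
  · simp only [natParam, logPart, conj]; ring
  · rfl

/-- The explicit form of the Kullback-Leibler divergence. -/
def dExp (F : Family) (a b : ℝ) : ℝ := F.conj a - a * F.natParam b + F.logPart b

/-- In the interior the log-likelihood ratio is affine in the observation, so its expectation only
involves the mean. Boundary values of `a` are needed because sample means reach them; there `0 log 0
= 0` gives the same formula. -/
lemma kl_eq {F : Family} {a b : ℝ} (ha : a ∈ F.closedMeans) (hb : b ∈ F.means) :
    F.kl a b = ENNReal.ofReal (F.dExp a b) := by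
  by_cases haM : a ∈ F.means
  · have h : ∀ v, F.law a {v} = ENNReal.ofReal (Real.exp
        (v * (F.natParam a - F.natParam b) + (F.logPart b - F.logPart a))) * F.law b {v} := by
      intro v
      rw [law_singleton haM, law_singleton hb, ← ENNReal.ofReal_mul (Real.exp_nonneg _),
        mul_left_comm, ← Real.exp_add]
      congr 3; ring
    have hi : Integrable (fun v : ℕ => (v : ℝ) * (F.natParam a - F.natParam b)
        + (F.logPart b - F.logPart a)) (F.law a) :=
      ((F.integrable_id_law ha).mul_const _).add (integrable_const _)
    rw [kl, klDiv_eq_of_exp_ratio h hi, integral_add ((F.integrable_id_law ha).mul_const _)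
      (integrable_const _), integral_mul_const, F.integral_id_law ha]
    congr 1
    rw [dExp, ← mul_natParam_sub_logPart]
    simp; ring
  · cases F
    · have ha' : 0 ≤ a ∧ a ≤ 1 := ha
      have hb' : 0 < b ∧ b < 1 := hb
      have : a = 0 ∨ a = 1 := by
        by_contra hcon
        push Not at hcon
        exact haM ⟨lt_of_le_of_ne ha'.1 (Ne.symm hcon.1), lt_of_le_of_ne ha'.2 hcon.2⟩
      rcases this with rfl | rfl
      · have e : bernoulli.law 0 = Measure.dirac 0 := by simp [law]
        rw [kl, e, klDiv_dirac (q := 1 - b) 0 (by linarith)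
          (by rw [law_bernoulli_singleton ⟨hb'.1.le, hb'.2.le⟩]; simp)]
        simp [dExp, conj, logPart]
      · have e : bernoulli.law 1 = Measure.dirac 1 := by simp [law]
        rw [kl, e, klDiv_dirac (q := b) 1 (by linarith)
          (by rw [law_bernoulli_singleton ⟨hb'.1.le, hb'.2.le⟩]; simp)]
        simp only [dExp, conj, logPart, natParam]
        congr 1; simp; ring
    · have ha' : 0 ≤ a := ha
      have hb' : 0 < b := hb
      have : a = 0 := le_antisymm (not_lt.1 haM) ha'
      subst this
      have e : poisson.law 0 = Measure.dirac 0 := by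
        refine Measure.ext_of_singleton fun v => ?_
        rw [law_poisson_singleton le_rfl]
        rcases v with _ | v <;> simp
      rw [kl, e, klDiv_dirac (q := Real.exp (-b)) 0 (by positivity)
          (by rw [law_poisson_singleton hb'.le]; simp)]
      simp [dExp, conj, logPart]

lemma natParam_strictMonoOn (F : Family) : StrictMonoOn F.natParam F.means := by
  intro a ha b hb hab
  cases F
  · have ha' : 0 < a ∧ a < 1 := ha
    have hb' : 0 < b ∧ b < 1 := hb
    have h1 := Real.log_lt_log ha'.1 hab
    have h2 := Real.log_lt_log (by linarith : 0 < 1 - b) (by linarith : 1 - b < 1 - a)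
    simp only [natParam]; linarith
  · exact Real.log_lt_log ha hab

lemma dExp_self (F : Family) (a : ℝ) : F.dExp a a = 0 := by
  rw [dExp, ← mul_natParam_sub_logPart]; ring

/-- Both families reduce to `log x ≤ x - 1`, strict for `x ≠ 1`. For Bernoulli it is applied to the
two outcomes, whose linear remainders cancel; one strict inequality is enough. -/
lemma dExp_pos_of_mem {F : Family} {a b : ℝ} (ha : a ∈ F.means) (hb : b ∈ F.means) (hab : a ≠ b) :
    0 < F.dExp a b := by
  have key : ∀ u v : ℝ, 0 < u → 0 < v → u * Real.log u - u * Real.log v ≥ u - v := by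
    intro u v hu hv
    have := Real.log_le_sub_one_of_pos (div_pos hv hu)
    rw [Real.log_div hv.ne' hu.ne'] at this
    have h2 : u * (v / u - 1) = v - u := by field_simp
    nlinarith
  have key' : ∀ u v : ℝ, 0 < u → 0 < v → u ≠ v → u * Real.log u - u * Real.log v > u - v := by
    intro u v hu hv huv
    have hne : v / u ≠ 1 := by rw [Ne, div_eq_one_iff_eq hu.ne']; exact huv.symm
    have := Real.log_lt_sub_one_of_pos (div_pos hv hu) hne
    rw [Real.log_div hv.ne' hu.ne'] at this
    have h2 : u * (v / u - 1) = v - u := by field_simp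
    nlinarith
  cases F
  · have ha' : 0 < a ∧ a < 1 := ha
    have hb' : 0 < b ∧ b < 1 := hb
    have h1 := key' a b ha'.1 hb'.1 hab
    have h2 := key (1 - a) (1 - b) (by linarith) (by linarith)
    simp only [dExp, conj, natParam, logPart]; nlinarith
  · have h1 := key' a b ha hb hab
    simp only [dExp, conj, natParam, logPart]; linarith

lemma dExp_nonneg_of_mem {F : Family} {a b : ℝ} (ha : a ∈ F.means) (hb : b ∈ F.means) :
    0 ≤ F.dExp a b := by
  rcases eq_or_ne a b with rfl | h
  · exact (dExp_self _ _).ge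
  · exact (dExp_pos_of_mem ha hb h).le

lemma continuous_conj (F : Family) : Continuous F.conj := by
  cases F
  · have h := Real.continuous_mul_log
    have : Continuous fun m : ℝ => m * Real.log m + (1 - m) * Real.log (1 - m) :=
      h.add (h.comp (continuous_const.sub continuous_id))
    exact this
  · exact Real.continuous_mul_log.sub continuous_id

lemma continuousAt_natParam {F : Family} {m : ℝ} (hm : m ∈ F.means) :
    ContinuousAt F.natParam m := by
  cases F
  · have hm' : 0 < m ∧ m < 1 := hm
    exact (Real.continuousAt_log hm'.1.ne').sub
      ((continuousAt_const.sub continuousAt_id).log (by simp; linarith))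
  · exact Real.continuousAt_log (ne_of_gt hm)

lemma continuousAt_logPart {F : Family} {m : ℝ} (hm : m ∈ F.means) :
    ContinuousAt F.logPart m := by
  cases F
  · have hm' : 0 < m ∧ m < 1 := hm
    exact ((continuousAt_const.sub continuousAt_id).log (by simp; linarith)).neg
  · exact continuousAt_id

lemma tendsto_dExp {F : Family} {α : Type*} {l : Filter α} {f g : α → ℝ} {a b : ℝ}
    (hf : Tendsto f l (𝓝 a)) (hg : Tendsto g l (𝓝 b)) (hb : b ∈ F.means) :
    Tendsto (fun x => F.dExp (f x) (g x)) l (𝓝 (F.dExp a b)) := by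
  unfold dExp
  exact ((((F.continuous_conj.tendsto a).comp hf).sub
    (hf.mul ((continuousAt_natParam hb).tendsto.comp hg))).add
    ((continuousAt_logPart hb).tendsto.comp hg))

lemma closedMeans_subset_closure (F : Family) : F.closedMeans ⊆ closure F.means := by
  cases F
  · simp [means, closedMeans, closure_Ioo (zero_ne_one (α := ℝ))]
  · simp [means, closedMeans]

/-- Continuity in the first argument carries the inequality from the interior to the boundary means.
-/
lemma dExp_nonneg {F : Family} {a b : ℝ} (ha : a ∈ F.closedMeans) (hb : b ∈ F.means) :
    0 ≤ F.dExp a b := by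
  have h : closure F.means ⊆ {a | 0 ≤ F.dExp a b} := by
    refine closure_minimal (fun a ha => dExp_nonneg_of_mem ha hb) (isClosed_le continuous_const ?_)
    unfold dExp
    exact ((F.continuous_conj).sub (continuous_id.mul continuous_const)).add continuous_const
  exact h (F.closedMeans_subset_closure ha)

lemma d_eq {F : Family} {a b : ℝ} (ha : a ∈ F.closedMeans) (hb : b ∈ F.means) :
    F.d a b = F.dExp a b := by
  rw [d, kl_eq ha hb, ENNReal.toReal_ofReal (dExp_nonneg ha hb)]

/-- The Pythagorean identity of the exponential family. -/
lemma dExp_pythagoras (F : Family) (a b c : ℝ) :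
    F.dExp a c = F.dExp a b + F.dExp b c + (b - a) * (F.natParam c - F.natParam b) := by
  have := dExp_self F b
  unfold dExp at *
  linarith

lemma natParam_le {F : Family} {b c : ℝ} (hb : b ∈ F.means) (hc : c ∈ F.means) (h : b ≤ c) :
    F.natParam b ≤ F.natParam c := F.natParam_strictMonoOn.monotoneOn hb hc h

/-- For ordered means the cross term of the Pythagorean identity is nonnegative, since the natural
parameter increases with the mean. The monotonicity of the divergence in either argument follows
from this lemma and its mirror image. -/
lemma dExp_add_le_of_le_of_le {F : Family} {a b c : ℝ} (hb : b ∈ F.means) (hc : c ∈ F.means)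
    (hab : a ≤ b) (hbc : b ≤ c) : F.dExp a b + F.dExp b c ≤ F.dExp a c := by
  rw [dExp_pythagoras F a b c]
  nlinarith [natParam_le hb hc hbc]

lemma dExp_add_le_of_ge_of_ge {F : Family} {a b c : ℝ} (hb : b ∈ F.means) (hc : c ∈ F.means)
    (hab : b ≤ a) (hbc : c ≤ b) : F.dExp a b + F.dExp b c ≤ F.dExp a c := by
  rw [dExp_pythagoras F a b c]
  nlinarith [natParam_le hc hb hbc]

lemma dExp_mono_right {F : Family} {a b c : ℝ} (hb : b ∈ F.means) (hc : c ∈ F.means)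
    (h : a ≤ b ∧ b ≤ c ∨ b ≤ a ∧ c ≤ b) : F.dExp a b ≤ F.dExp a c := by
  have := dExp_nonneg_of_mem hb hc
  rcases h with h | h
  · linarith [dExp_add_le_of_le_of_le hb hc h.1 h.2]
  · linarith [dExp_add_le_of_ge_of_ge hb hc h.1 h.2]

lemma dExp_lt_right {F : Family} {a b c : ℝ} (hb : b ∈ F.means) (hc : c ∈ F.means)
    (h : a ≤ b ∧ b < c ∨ b ≤ a ∧ c < b) : F.dExp a b < F.dExp a c := by
  rcases h with h | h
  · linarith [dExp_add_le_of_le_of_le hb hc h.1 h.2.le, dExp_pos_of_mem hb hc h.2.ne]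
  · linarith [dExp_add_le_of_ge_of_ge hb hc h.1 h.2.le, dExp_pos_of_mem hb hc h.2.ne']

lemma kl_mono_right {F : Family} {a b c : ℝ} (ha : a ∈ F.closedMeans) (hb : b ∈ F.means)
    (hc : c ∈ F.means) (h : a ≤ b ∧ b ≤ c ∨ b ≤ a ∧ c ≤ b) : F.kl a b ≤ F.kl a c := by
  rw [kl_eq ha hb, kl_eq ha hc]
  exact ENNReal.ofReal_le_ofReal (dExp_mono_right hb hc h)

/-- Moving the first argument towards the second one decreases the divergence. -/
lemma dExp_lt_left {F : Family} {a b c : ℝ} (ha : a ∈ F.means) (hb : b ∈ F.means)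
    (hc : c ∈ F.means) (h : a < b ∧ b ≤ c ∨ b < a ∧ c ≤ b) : F.dExp b c < F.dExp a c := by
  rcases h with h | h
  · linarith [dExp_add_le_of_le_of_le (a := a) hb hc h.1.le h.2, dExp_pos_of_mem ha hb h.1.ne]
  · linarith [dExp_add_le_of_ge_of_ge (a := a) hb hc h.1.le h.2, dExp_pos_of_mem ha hb h.1.ne']

lemma means_ordConnected (F : Family) : F.means.OrdConnected := by
  cases F
  · exact Set.ordConnected_Ioo
  · exact Set.ordConnected_Ioi

end Family

/-! ### Histories and sequential likelihoods -/

/-- The observations of slice `k`, most recent first. -/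
def obs (k : Fin K) (h : History K) : List ℕ := (h.filter fun p => p.1 = k).map Prod.snd

@[simp] lemma obs_nil (k : Fin K) : obs k [] = [] := rfl

@[simp] lemma obs_cons_self (k : Fin K) (v : ℕ) (h : History K) :
    obs k ((k, v) :: h) = v :: obs k h := by simp [obs]

lemma obs_cons_of_ne {k j : Fin K} (hjk : j ≠ k) (v : ℕ) (h : History K) :
    obs k ((j, v) :: h) = obs k h := by simp [obs, hjk]

lemma length_obs (k : Fin K) (h : History K) : (obs k h).length = count h k := by
  simp [obs, count]

lemma count_cons_self (k : Fin K) (v : ℕ) (h : History K) :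
    count ((k, v) :: h) k = count h k + 1 := by simp [count]

lemma count_cons_of_ne {k j : Fin K} (hjk : j ≠ k) (v : ℕ) (h : History K) :
    count ((j, v) :: h) k = count h k := by simp [count, hjk]

lemma muHat_eq (k : Fin K) (h : History K) :
    muHat h k = ((obs k h).sum : ℕ) / ((obs k h).length : ℕ) := by
  rw [length_obs, muHat, obs]
  congr 1
  rw [Nat.cast_list_sum, List.map_map]
  rfl

lemma sum_count (h : History K) : ∑ k, count h k = h.length := by
  induction h with
  | nil => simp [count]
  | cons p h ih =>
    obtain ⟨j, v⟩ := p
    have : ∀ k, count ((j, v) :: h) k = count h k + if k = j then 1 else 0 := by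
      intro k
      by_cases hk : k = j
      · subst hk; simp [count_cons_self]
      · simp [hk, count_cons_of_ne (Ne.symm hk)]
    simp [this, Finset.sum_add_distrib, ih]

/-- The likelihood of a list of observations of a slice of mean `m`. -/
def seqLik (F : Family) (m : ℝ) (l : List ℕ) : ℝ≥0∞ := (l.map fun v => F.law m {v}).prod

@[simp] lemma seqLik_nil (F : Family) (m : ℝ) : seqLik F m [] = 1 := rfl

@[simp] lemma seqLik_cons (F : Family) (m : ℝ) (v : ℕ) (l : List ℕ) :
    seqLik F m (v :: l) = F.law m {v} * seqLik F m l := by simp [seqLik]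

/-- A sequential (sub-)likelihood: the total weight of the one-step extensions of a list is at most
the weight of the list. -/
def IsSubLik (W : List ℕ → ℝ≥0∞) : Prop := ∀ l, ∑' v, W (v :: l) ≤ W l

lemma isSubLik_seqLik (F : Family) (m : ℝ) : IsSubLik (seqLik F m) := by
  intro l
  simp only [seqLik_cons]
  rw [ENNReal.tsum_mul_right, F.tsum_law_singleton, one_mul]

lemma IsSubLik.add {V W : List ℕ → ℝ≥0∞} (hV : IsSubLik V) (hW : IsSubLik W) :
    IsSubLik (fun l => V l + W l) := by
  intro l
  rw [ENNReal.tsum_add]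
  exact add_le_add (hV l) (hW l)

lemma isSubLik_zero : IsSubLik (fun _ => 0) := by intro l; simp

lemma IsSubLik.sum {ι : Type*} (s : Finset ι) {W : ι → List ℕ → ℝ≥0∞}
    (hW : ∀ i ∈ s, IsSubLik (W i)) : IsSubLik (fun l => ∑ i ∈ s, W i l) := by
  classical
  induction s using Finset.induction_on with
  | empty => simpa using isSubLik_zero
  | insert a s ha ih =>
    simp only [Finset.sum_insert ha]
    exact (hW a (by simp)).add (ih fun i hi => hW i (by simp [hi]))

lemma IsSubLik.const_mul {W : List ℕ → ℝ≥0∞} (hW : IsSubLik W) (c : ℝ≥0∞) :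
    IsSubLik (fun l => c * W l) := by
  intro l
  rw [ENNReal.tsum_mul_left]
  exact mul_le_mul_right (hW l) c

namespace Algorithm

variable (A : Algorithm K)

lemma length_hist (x : Outcomes K) (t : ℕ) : (A.hist x t).length = t := by
  induction t with
  | zero => rfl
  | succ t ih => simp [hist, ih]

end Algorithm

/-! ### The law of the history and a maximal inequality -/

/-- The coordinates that are observed along a history. -/
def slots : History K → Finset (Fin K × ℕ)
  | [] => ∅
  | p :: h => insert (p.1, h.length + 1) (slots h)

/-- The values observed along a history. -/
def slotVal : History K → Outcomes K
  | [] => 0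
  | p :: h => Function.update (slotVal h) (p.1, h.length + 1) p.2

lemma snd_le_of_mem_slots {h : History K} {q : Fin K × ℕ} (hq : q ∈ slots h) :
    q.2 ≤ h.length := by
  induction h with
  | nil => simp [slots] at hq
  | cons p h ih =>
    simp only [slots, Finset.mem_insert] at hq
    rcases hq with rfl | hq
    · simp
    · have := ih hq; simp; lia

/-- A history determines which coordinate was read in each slot and its value. Only an inclusion
holds, since a list that the sampling rule cannot produce gives the empty event; upper bounds need
no more. -/
lemma hist_eq_subset (A : Algorithm K) (h : History K) :
    {x | A.hist x h.length = h} ⊆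
      Set.pi (slots h) (fun q => {slotVal h q}) := by
  induction h with
  | nil => intro x _; simp [slots]
  | cons p h ih =>
    intro x hx
    simp only [List.length_cons, Algorithm.hist, Set.mem_ofPred_eq, List.cons.injEq] at hx
    obtain ⟨h1, h2⟩ := hx
    have hx' := ih h2
    intro q hq
    simp only [slots, Finset.coe_insert, Set.mem_insert_iff, Finset.mem_coe] at hq
    rw [h2] at h1
    by_cases hqp : q = (p.1, h.length + 1)
    · subst hqp
      simp only [slotVal, Function.update_self, Set.mem_singleton_iff]
      rw [← h1]
    · have := hx' q (by simpa [hqp] using hq)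
      simpa [slotVal, Function.update_of_ne hqp] using this

lemma prod_seqLik_cons (F : Family) (μ : Fin K → ℝ) (p : Fin K × ℕ) (h : History K) :
    ∏ k, seqLik F (μ k) (obs k (p :: h)) = F.law (μ p.1) {p.2} * ∏ k, seqLik F (μ k) (obs k h) := by
  classical
  obtain ⟨j, v⟩ := p
  rw [← Finset.mul_prod_erase _ _ (Finset.mem_univ j),
    ← Finset.mul_prod_erase _ (fun k => seqLik F (μ k) (obs k h)) (Finset.mem_univ j),
    obs_cons_self, seqLik_cons, mul_assoc]
  congr 2
  refine Finset.prod_congr rfl fun k hk => ?_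
  rw [obs_cons_of_ne (Finset.ne_of_mem_erase hk).symm]

/-- Every measurement uses a new slot number, so the coordinates read are distinct and independence
turns the cylinder into a product of likelihoods. -/
lemma prob_pi_slots (F : Family) (μ : Fin K → ℝ) (h : History K) :
    prob F μ (Set.pi (slots h) (fun q => {slotVal h q})) =
      ∏ k, seqLik F (μ k) (obs k h) := by
  rw [prob, Measure.infinitePi_pi _ (fun _ _ => measurableSet_singleton _)]
  induction h with
  | nil => simp [slots]
  | cons p h ih =>
    have hp : (p.1, h.length + 1) ∉ slots h := fun hm => by
      have := snd_le_of_mem_slots hm; simp at this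
    rw [prod_seqLik_cons, slots, Finset.prod_insert hp, ← ih]
    congr 1
    · simp [slotVal]
    · refine Finset.prod_congr rfl fun q hq => ?_
      have hne : q ≠ (p.1, h.length + 1) := by rintro rfl; exact hp hq
      rw [slotVal, Function.update_of_ne hne]

lemma prob_hist_eq_le (F : Family) (μ : Fin K → ℝ) (A : Algorithm K) (h : History K) :
    prob F μ {x | A.hist x h.length = h} ≤ ∏ k, seqLik F (μ k) (obs k h) :=
  (measure_mono (hist_eq_subset A h)).trans (prob_pi_slots F μ h).le

/-- A form of Ville's inequality: if on a set of histories the likelihood is dominated by a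
product of sequential sub-likelihoods, then that set is visited with probability at most the initial
weight. -/
theorem prob_exists_hist_mem_le (F : Family) (μ : Fin K → ℝ) (A : Algorithm K)
    (S : Set (History K)) (I : Finset (Fin K)) (W : Fin K → List ℕ → ℝ≥0∞)
    (hW : ∀ k ∈ I, IsSubLik (W k))
    (hS : ∀ h ∈ S, ∏ k ∈ I, seqLik F (μ k) (obs k h) ≤ ∏ k ∈ I, W k (obs k h)) :
    prob F μ {x | ∃ t, A.hist x t ∈ S} ≤ ∏ k ∈ I, W k [] := by
  classical
  -- Slices outside `I` keep their own likelihood, which is itself a sequential likelihood of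
  -- initial weight `1`.
  set V : Fin K → List ℕ → ℝ≥0∞ := fun k => if k ∈ I then W k else seqLik F (μ k) with hV
  have hVsub : ∀ k, IsSubLik (V k) := by
    intro k
    by_cases hk : k ∈ I
    · simpa [hV, hk] using hW k hk
    · simpa [hV, hk] using isSubLik_seqLik F (μ k)
  have hsplit : ∀ f : Fin K → ℝ≥0∞, ∏ k, f k = (∏ k ∈ I, f k) * ∏ k ∈ Iᶜ, f k :=
    fun f => (Finset.prod_mul_prod_compl I f).symm
  have hSV : ∀ h ∈ S, ∏ k, seqLik F (μ k) (obs k h) ≤ ∏ k, V k (obs k h) := by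
    intro h hh
    rw [hsplit, hsplit (fun k => V k (obs k h))]
    have e1 : ∏ k ∈ I, V k (obs k h) = ∏ k ∈ I, W k (obs k h) :=
      Finset.prod_congr rfl fun k hk => by simp [hV, hk]
    have e2 : ∏ k ∈ Iᶜ, V k (obs k h) = ∏ k ∈ Iᶜ, seqLik F (μ k) (obs k h) :=
      Finset.prod_congr rfl fun k hk => by
        have : k ∉ I := by simpa using hk
        simp [hV, this]
    rw [e1, e2]
    exact mul_le_mul_left (hS h hh) _
  -- The product is a supermartingale weight for whichever slice is measured next, because only one
  -- factor changes. This is why the sampling rule plays no role.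
  have hext : ∀ (h : History K) (j : Fin K),
      ∑' v, ∏ k, V k (obs k ((j, v) :: h)) ≤ ∏ k, V k (obs k h) := by
    intro h j
    have : ∀ v, ∏ k, V k (obs k ((j, v) :: h)) =
        V j (v :: obs j h) * ∏ k ∈ Finset.univ.erase j, V k (obs k h) := by
      intro v
      rw [← Finset.mul_prod_erase _ _ (Finset.mem_univ j), obs_cons_self]
      congr 1
      exact Finset.prod_congr rfl fun k hk => by
        rw [obs_cons_of_ne (Finset.ne_of_mem_erase hk).symm]
    simp only [this]
    rw [ENNReal.tsum_mul_right, ← Finset.mul_prod_erase _ _ (Finset.mem_univ j)]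
    exact mul_le_mul_left (hVsub j _) _
  -- Induction on the horizon, from any starting history: inside `S` the likelihood is dominated
  -- directly, outside `S` one conditions on the next observation and sums the weights of the
  -- extensions.
  have key : ∀ (n : ℕ) (h : History K),
      prob F μ {x | A.hist x h.length = h ∧
        ∃ t ≤ n, A.hist x (h.length + t) ∈ S} ≤ ∏ k, V k (obs k h) := by
    intro n
    induction n with
    | zero =>
      intro h
      by_cases hh : h ∈ S
      · exact (measure_mono fun x hx => hx.1).trans
          ((prob_hist_eq_le F μ A h).trans (hSV h hh))
      · have : {x | A.hist x h.length = h ∧ ∃ t ≤ 0, A.hist x (h.length + t) ∈ S} = ∅ := by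
          ext x
          simp only [Set.mem_ofPred_eq, Set.mem_empty_iff_false, iff_false]
          rintro ⟨h1, t, ht, h2⟩
          obtain rfl : t = 0 := by lia
          rw [add_zero, h1] at h2
          exact hh h2
        rw [this]; simp
    | succ n ih =>
      intro h
      by_cases hh : h ∈ S
      · exact (measure_mono fun x hx => hx.1).trans
          ((prob_hist_eq_le F μ A h).trans (hSV h hh))
      · refine le_trans (measure_mono ?_) ((measure_iUnion_le
          (fun v : ℕ => {x | A.hist x ((A.sample h, v) :: h).length = (A.sample h, v) :: h ∧
            ∃ t ≤ n, A.hist x (((A.sample h, v) :: h).length + t) ∈ S})).trans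
          ((ENNReal.tsum_le_tsum fun v => ih _).trans (hext h (A.sample h))))
        rintro x ⟨h1, t, ht, h2⟩
        rcases t with _ | t
        · rw [add_zero, h1] at h2; exact absurd h2 hh
        · refine Set.mem_iUnion.2 ⟨x (A.sample h, h.length + 1), ?_, t, by lia, ?_⟩
          · simp [Algorithm.hist, h1]
          · rw [List.length_cons]
            convert h2 using 2
            lia
  have hmono : Monotone fun n : ℕ => {x | A.hist x ([] : History K).length = [] ∧
        ∃ t ≤ n, A.hist x (([] : History K).length + t) ∈ S} := by
    intro a b hab x hx
    obtain ⟨h1, t, ht, h2⟩ := hx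
    exact ⟨h1, t, ht.trans hab, h2⟩
  have hU : {x | ∃ t, A.hist x t ∈ S} = ⋃ n : ℕ, {x | A.hist x ([] : History K).length = [] ∧
        ∃ t ≤ n, A.hist x (([] : History K).length + t) ∈ S} := by
    ext x
    simp only [Set.mem_ofPred_eq, Set.mem_iUnion, List.length_nil, zero_add]
    exact ⟨fun ⟨t, ht⟩ => ⟨t, rfl, t, le_rfl, ht⟩, fun ⟨_, _, t, _, ht⟩ => ⟨t, ht⟩⟩
  rw [hU, hmono.measure_iUnion]
  refine iSup_le fun n => (key n []).trans ?_
  rw [hsplit]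
  have e1 : ∏ k ∈ I, V k (obs k []) = ∏ k ∈ I, W k [] :=
    Finset.prod_congr rfl fun k hk => by simp [hV, hk]
  have e2 : ∏ k ∈ Iᶜ, V k (obs k []) = 1 :=
    Finset.prod_eq_one fun k hk => by
      have : k ∉ I := by simpa using hk
      simp [hV, this]
  rw [e1, e2, mul_one]

lemma measurableSet_hist_mem (A : Algorithm K) (t : ℕ) (S : Set (History K)) :
    MeasurableSet {x | A.hist x t ∈ S} := by
  have key : ∀ (t : ℕ) (h : History K), MeasurableSet {x | A.hist x t = h} := by
    intro t
    induction t with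
    | zero => intro h; simp [Algorithm.hist]
    | succ t ih =>
      intro h
      rcases h with _ | ⟨⟨j, v⟩, h⟩
      · simp [Algorithm.hist]
      · have : {x | A.hist x (t + 1) = (j, v) :: h} =
            {x | A.hist x t = h} ∩ ({x | A.sample h = j} ∩ {x | x (A.sample h, t + 1) = v}) := by
          ext x
          simp only [Algorithm.hist, Set.mem_ofPred_eq, List.cons.injEq, Prod.mk.injEq,
            Set.mem_inter_iff]
          constructor
          · rintro ⟨⟨h1, h2⟩, h3⟩
            rw [h3] at h1 h2
            exact ⟨h3, h1, h2⟩
          · rintro ⟨h3, h1, h2⟩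
            rw [h3]; exact ⟨⟨h1, h2⟩, rfl⟩
        rw [this]
        exact (ih h).inter ((MeasurableSet.const _).inter
          (measurableSet_eq_fun (measurable_pi_apply _) measurable_const))
  have : {x | A.hist x t ∈ S} = ⋃ h ∈ S, {x | A.hist x t = h} := by ext; simp
  rw [this]
  exact MeasurableSet.biUnion (Set.to_countable _) fun h _ => key t h

instance isProbabilityMeasure_prob (F : Family) (μ : Fin K → ℝ) :
    IsProbabilityMeasure (prob F μ) := by unfold prob; infer_instance

/-- The likelihood ratio of two members of the family on a list of observations. -/
lemma seqLik_eq_exp_mul {F : Family} {m z : ℝ} (hm : m ∈ F.means) (hz : z ∈ F.means)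
    (l : List ℕ) :
    seqLik F m l = ENNReal.ofReal (Real.exp (((l.sum : ℕ) : ℝ) * (F.natParam m - F.natParam z)
      - l.length * (F.logPart m - F.logPart z))) * seqLik F z l := by
  induction l with
  | nil => simp
  | cons v l ih =>
    rw [seqLik_cons, seqLik_cons, ih, Family.law_singleton hm, Family.law_singleton hz]
    have hc := F.carrier_nonneg v
    rw [← mul_assoc, ← mul_assoc, ← ENNReal.ofReal_mul (by positivity),
      ← ENNReal.ofReal_mul (by positivity)]
    congr 2
    rw [mul_left_comm, mul_assoc, ← Real.exp_add, ← Real.exp_add]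
    congr 2
    simp only [List.sum_cons, List.length_cons]
    push_cast
    ring

/-- Tilting the mean of a slice: the likelihood is small compared with that of a mean `z` beyond which
the sample mean lies. -/
lemma seqLik_le_of_tilt {F : Family} {m z : ℝ} (hm : m ∈ F.means) (hz : z ∈ F.means)
    {l : List ℕ} (h : m ≤ z ∧ (l.length : ℝ) * z ≤ (l.sum : ℕ) ∨
      z ≤ m ∧ ((l.sum : ℕ) : ℝ) ≤ l.length * z) :
    seqLik F m l ≤ ENNReal.ofReal (Real.exp (-(l.length * F.dExp z m))) * seqLik F z l := by
  rw [seqLik_eq_exp_mul hm hz]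
  refine mul_le_mul_left (ENNReal.ofReal_le_ofReal (Real.exp_le_exp.2 ?_)) _
  rw [Family.dExp, ← Family.mul_natParam_sub_logPart]
  rcases h with ⟨h1, h2⟩ | ⟨h1, h2⟩
  · nlinarith [Family.natParam_le hm hz h1]
  · nlinarith [Family.natParam_le hz hm h1]

/-! ### Correct answers and the candidate -/

section Correct

variable {c : Criterion} {γ : ℝ} {μ : Fin K → ℝ}

lemma correct_eq_zero (h : ¬ ∃ k, μ k < γ) : correct c γ μ = {0} := by
  simp only [correct, if_neg h]

lemma zero_mem_correct_iff : (0 : Fin (K + 1)) ∈ correct c γ μ ↔ ¬ ∃ k, μ k < γ := by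
  constructor
  · intro h hex
    simp only [correct, if_pos hex] at h
    cases c <;> (obtain ⟨k, hk, _⟩ := h; exact absurd hk.symm (Fin.succ_ne_zero k))
  · intro h; rw [correct_eq_zero h]; rfl

lemma succ_mem_correct_anyAvailable {k : Fin K} :
    k.succ ∈ correct .anyAvailable γ μ ↔ μ k < γ := by
  by_cases hex : ∃ k, μ k < γ
  · simp only [correct, if_pos hex]
    constructor
    · rintro ⟨j, hj, h⟩
      rwa [Fin.succ_injective _ hj]
    · exact fun h => ⟨k, rfl, h⟩
  · rw [correct_eq_zero hex]
    simp only [Set.mem_singleton_iff, Fin.succ_ne_zero, false_iff]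
    exact fun h => hex ⟨k, h⟩

lemma succ_mem_correct_packing {k : Fin K} :
    k.succ ∈ correct .packing γ μ ↔ IsPacking γ μ k := by
  by_cases hex : ∃ k, μ k < γ
  · simp only [correct, if_pos hex]
    constructor
    · rintro ⟨j, hj, h⟩
      rwa [Fin.succ_injective _ hj]
    · exact fun h => ⟨k, rfl, h⟩
  · rw [correct_eq_zero hex]
    simp only [Set.mem_singleton_iff, Fin.succ_ne_zero, false_iff]
    exact fun h => hex ⟨k, h.1⟩

lemma succ_mem_correct_leastLoaded {k : Fin K} :
    k.succ ∈ correct .leastLoaded γ μ ↔ μ k < γ ∧ IsLeastLoaded μ k := by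
  by_cases hex : ∃ k, μ k < γ
  · simp only [correct, if_pos hex]
    constructor
    · rintro ⟨j, hj, h⟩
      rw [Fin.succ_injective _ hj]
      obtain ⟨i, hi⟩ := hex
      exact ⟨(h i).trans_lt hi, h⟩
    · exact fun h => ⟨k, rfl, h.2⟩
  · rw [correct_eq_zero hex]
    simp only [Set.mem_singleton_iff, Fin.succ_ne_zero, false_iff]
    exact fun h => hex ⟨k, h.1⟩

lemma lt_of_succ_mem_correct {k : Fin K} (h : k.succ ∈ correct c γ μ) : μ k < γ := by
  cases c
  · exact succ_mem_correct_anyAvailable.1 h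
  · exact (succ_mem_correct_packing.1 h).1
  · exact (succ_mem_correct_leastLoaded.1 h).1

lemma exists_isLeastLoaded [NeZero K] (μ : Fin K → ℝ) : ∃ k, IsLeastLoaded μ k :=
  Finite.exists_min μ

lemma exists_isPacking (h : ∃ k, μ k < γ) : ∃ k, IsPacking γ μ k := by
  classical
  obtain ⟨k, hk, hmax⟩ := Finset.exists_max_image (Finset.univ.filter fun k => μ k < γ) μ
    (by obtain ⟨k, hk⟩ := h; exact ⟨k, by simpa using hk⟩)
  exact ⟨k, by simpa using hk, fun j hj => hmax j (by simpa using hj)⟩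

lemma kLow_spec [NeZero K] (μ : Fin K → ℝ) : IsLeastLoaded μ (kLow μ) :=
  Classical.epsilon_spec (exists_isLeastLoaded μ)

lemma kPack_spec [NeZero K] (h : ∃ k, μ k < γ) : IsPacking γ μ (kPack γ μ) :=
  Classical.epsilon_spec (exists_isPacking h)

lemma correct_nonempty [NeZero K] (c : Criterion) (γ : ℝ) (μ : Fin K → ℝ) :
    (correct c γ μ).Nonempty := by
  by_cases h : ∃ k, μ k < γ
  · cases c
    · obtain ⟨k, hk⟩ := h
      exact ⟨_, succ_mem_correct_anyAvailable.2 hk⟩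
    · exact ⟨_, succ_mem_correct_packing.2 (kPack_spec h)⟩
    · obtain ⟨k, hk⟩ := h
      exact ⟨_, succ_mem_correct_leastLoaded.2 ⟨((kLow_spec μ) k).trans_lt hk, kLow_spec μ⟩⟩
  · exact ⟨0, zero_mem_correct_iff.2 h⟩

lemma candidate_mem_easiest [NeZero K] (F : Family) (c : Criterion) (γ : ℝ) (h : History K) :
    candidate F c γ h ∈ easiest F γ (muHat h) c := by
  have hne : (easiest F γ (muHat h) c).Nonempty := by
    obtain ⟨a, ha, hmax⟩ := Set.exists_max_image (correct c γ (muHat h))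
      (answerValue F γ (muHat h) c) (Set.toFinite _) (correct_nonempty c γ _)
    exact ⟨a, ha, hmax⟩
  exact csInf_mem hne

lemma candidate_mem_correct [NeZero K] (F : Family) (c : Criterion) (γ : ℝ) (h : History K) :
    candidate F c γ h ∈ correct c γ (muHat h) := (candidate_mem_easiest F c γ h).1

end Correct

/-! ### Cheap alternatives and the consequences of a wrong candidate -/

/-- A sample mean on the boundary is not admissible in an alternative. It is replaced by a nearby
interior mean, chosen so that the divergence to it is exactly the small budget `e`. -/
lemma Family.exists_near {F : Family} {a : ℝ} (ha : a ∈ F.closedMeans) {ε : ℝ≥0∞} (hε : ε ≠ 0)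
    {η : ℝ} (hη : 0 < η) : ∃ b ∈ F.means, F.kl a b ≤ ε ∧ |b - a| < η := by
  obtain ⟨e, he0, heε, heη⟩ : ∃ e : ℝ, 0 < e ∧ ENNReal.ofReal e ≤ ε ∧ e < η := by
    rcases eq_or_ne ε ⊤ with rfl | ht
    · exact ⟨η / 2, by linarith, le_top, by linarith⟩
    · refine ⟨min ε.toReal (η / 2), lt_min (ENNReal.toReal_pos hε ht) (by linarith), ?_,
        (min_le_right _ _).trans_lt (by linarith)⟩
      exact (ENNReal.ofReal_le_ofReal (min_le_left _ _)).trans (ENNReal.ofReal_toReal ht).le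
  by_cases haM : a ∈ F.means
  · refine ⟨a, haM, ?_, by simpa using hη⟩
    rw [kl_eq ha haM, dExp_self]; simp
  have h1 : Real.exp (-e) < 1 := (by simpa using he0)
  have h2 : -e + 1 < Real.exp (-e) := Real.add_one_lt_exp (by linarith)
  have h0 := Real.exp_pos (-e)
  cases F
  · have ha' : 0 ≤ a ∧ a ≤ 1 := ha
    have : a = 0 ∨ a = 1 := by
      by_contra hcon
      push Not at hcon
      exact haM ⟨lt_of_le_of_ne ha'.1 (Ne.symm hcon.1), lt_of_le_of_ne ha'.2 hcon.2⟩
    rcases this with rfl | rfl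
    · have hb : 1 - Real.exp (-e) ∈ bernoulli.means := ⟨by linarith, by linarith⟩
      refine ⟨_, hb, ?_, by rw [abs_lt]; constructor <;> linarith⟩
      rw [kl_eq ha hb]
      convert heε using 2
      simp [dExp, conj, logPart]
    · have hb : Real.exp (-e) ∈ bernoulli.means := ⟨by linarith, by linarith⟩
      refine ⟨_, hb, ?_, by rw [abs_lt]; constructor <;> linarith⟩
      rw [kl_eq ha hb]
      convert heε using 2
      simp [dExp, conj, logPart, natParam]
  · have : a = 0 := le_antisymm (not_lt.1 haM) ha
    subst this
    refine ⟨e, he0, ?_, by rw [sub_zero, abs_of_pos he0]; exact heη⟩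
    rw [kl_eq ha he0]
    convert heε using 2
    simp [dExp, conj, logPart]

/-- The infimum over the alternatives is at most the cost of an alternative that is prescribed on
the slices of `J` and close to the given loads elsewhere. -/
lemma altInf_le_sum {F : Family} {γ : ℝ} {μ : Fin K → ℝ} {c : Criterion} (n : Fin K → ℕ)
    {a : Fin (K + 1)} (hμ : ∀ k, μ k ∈ F.closedMeans) (J : Finset (Fin K)) {l : Fin K → ℝ}
    (hl : ∀ k ∈ J, l k ∈ F.means) {η : ℝ} (hη : 0 < η)
    (h : ∀ l' : Fin K → ℝ, (∀ k ∈ J, l' k = l k) → (∀ k ∉ J, |l' k - μ k| < η) →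
      a ∉ correct c γ l') :
    altInf F γ μ c (fun k => (n k : ℝ≥0∞)) a ≤ ∑ k ∈ J, (n k : ℝ≥0∞) * F.kl (μ k) (l k) := by
  classical
  refine ENNReal.le_of_forall_pos_le_add fun ε hε _ => ?_
  -- The budget is divided by `n k + 1` to absorb the weight of the slice and by `K + 1` to absorb
  -- the number of slices.
  have hex : ∀ k, ∃ b ∈ F.means, F.kl (μ k) b ≤ (ε : ℝ≥0∞) / ((K + 1) * (n k + 1) : ℕ) ∧
      |b - μ k| < η := fun k => Family.exists_near (hμ k)
        (by simp [ENNReal.div_eq_zero_iff, hε.ne']; exact_mod_cast ENNReal.natCast_ne_top ((K+1)*(n k+1))) hη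
  choose b hbM hbk hbη using hex
  set l' : Fin K → ℝ := fun k => if k ∈ J then l k else b k with hl'
  have h1 : (∀ k, l' k ∈ F.means) ∧ a ∉ correct c γ l' := by
    refine ⟨fun k => ?_, h l' (fun k hk => by simp [hl', hk]) fun k hk => ?_⟩
    · by_cases hk : k ∈ J
      · simpa [hl', hk] using hl k hk
      · simpa [hl', hk] using hbM k
    · simpa [hl', hk] using hbη k
  refine (iInf₂_le l' h1).trans ?_
  rw [← Finset.sum_add_sum_compl J]
  refine add_le_add (Finset.sum_le_sum fun k hk => by simp [hl', hk]) ?_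
  have h2 : ∀ k ∈ Jᶜ, (n k : ℝ≥0∞) * F.kl (μ k) (l' k) ≤ (ε : ℝ≥0∞) / (K + 1 : ℕ) := by
    intro k hk
    have hk' : k ∉ J := by simpa using hk
    simp only [hl', hk', if_false]
    calc (n k : ℝ≥0∞) * F.kl (μ k) (b k)
        ≤ (n k + 1 : ℕ) * ((ε : ℝ≥0∞) / ((K + 1) * (n k + 1) : ℕ)) := by
          gcongr
          · simp
          · exact hbk k
      _ = (ε : ℝ≥0∞) / (K + 1 : ℕ) := by
          push_cast
          rw [mul_comm ((K : ℝ≥0∞) + 1), ← mul_div_assoc]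
          exact ENNReal.mul_div_mul_left _ _ (by simp) (by exact_mod_cast ENNReal.natCast_ne_top (n k + 1))
  calc ∑ k ∈ Jᶜ, (n k : ℝ≥0∞) * F.kl (μ k) (l' k) ≤ ∑ k ∈ Jᶜ, (ε : ℝ≥0∞) / (K + 1 : ℕ) :=
        Finset.sum_le_sum h2
    _ ≤ (K + 1 : ℕ) * ((ε : ℝ≥0∞) / (K + 1 : ℕ)) := by
        rw [Finset.sum_const, nsmul_eq_mul]
        gcongr
        exact (Finset.card_le_univ _).trans (by simp)
    _ = ε := ENNReal.mul_div_cancel (by simp) (by exact_mod_cast ENNReal.natCast_ne_top (K + 1))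

lemma tendsto_kl_right {F : Family} {a m : ℝ} (ha : a ∈ F.closedMeans) (hm : m ∈ F.means) :
    Tendsto (fun e : ℝ => F.kl a (m + e)) (𝓝[>] 0) (𝓝 (F.kl a m)) := by
  have h1 : Tendsto (fun e : ℝ => m + e) (𝓝[>] 0) (𝓝 m) := by
    have : Tendsto (fun e : ℝ => m + e) (𝓝 0) (𝓝 (m + 0)) := tendsto_const_nhds.add tendsto_id
    rw [add_zero] at this
    exact this.mono_left nhdsWithin_le_nhds
  have h2 := (ENNReal.continuous_ofReal.tendsto _).comp
    (Family.tendsto_dExp (F := F) (tendsto_const_nhds (x := a)) h1 hm)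
  rw [Family.kl_eq ha hm]
  refine h2.congr' ?_
  filter_upwards [h1.eventually (F.isOpen_means.mem_nhds hm)] with e he
  simp [Family.kl_eq ha he]

/-- A wrong candidate forces a deviation of the sample mean of one slice, or an inversion of the
sample means of two slices, one of which is a fixed one. -/
lemma exists_deviation_of_wrong [NeZero K] {F : Family} {c : Criterion} {γ : ℝ}
    {μ : Fin K → ℝ} (hμ : ∀ k, μ k ∈ F.means) :
    ∃ j₀ : Fin K, ∀ h : History K, (∀ k, muHat h k ∈ F.closedMeans) →
      candidate F c γ h ∉ correct c γ μ →
      (∃ k, statQ F c γ h ≤ count h k * F.kl (muHat h k) (μ k)) ∨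
      ∃ i j, i ≠ j ∧ (i = j₀ ∨ j = j₀) ∧ μ i < μ j ∧ muHat h j ≤ muHat h i ∧
        statQ F c γ h ≤ count h i * F.kl (muHat h i) (μ i) + count h j * F.kl (muHat h j) (μ j) ∧
        ∃ g, muHat h i < g ∧ ∀ m ∈ F.means, m < g →
          statQ F c γ h ≤ count h i * F.kl (muHat h i) m + count h j * F.kl (muHat h j) m := by
  classical
  have hpair : ∀ (h : History K), (∀ k, muHat h k ∈ F.closedMeans) → ∀ i j : Fin K, i ≠ j →
      ∀ li lj : ℝ, li ∈ F.means → lj ∈ F.means →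
      (∀ l' : Fin K → ℝ, l' i = li → l' j = lj → candidate F c γ h ∉ correct c γ l') →
      statQ F c γ h ≤ count h i * F.kl (muHat h i) li + count h j * F.kl (muHat h j) lj := by
    intro h hh i j hij li lj hi hj H
    have := altInf_le_sum (F := F) (c := c) (γ := γ) (count h) (a := candidate F c γ h) hh {i, j}
      (l := fun k => if k = i then li else lj) (by
        intro k hk; split_ifs <;> assumption) one_pos (by
        intro l' hl' _
        refine H l' ?_ ?_
        · simpa using hl' i (by simp)
        · simpa [hij.symm] using hl' j (by simp))
    rw [Finset.sum_pair hij] at this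
    simpa [statQ, hij.symm] using this
  -- A tie at a common mean `m` need not refute the candidate, so the second slice is placed at `m +
  -- e` and `e` tends to `0`.
  have hlim : ∀ (h : History K), (∀ k, muHat h k ∈ F.closedMeans) → ∀ (i j : Fin K) (m : ℝ),
      m ∈ F.means → ∀ Q : ℝ≥0∞, (∀ᶠ e in 𝓝[>] (0 : ℝ), Q ≤ count h i * F.kl (muHat h i) m +
        count h j * F.kl (muHat h j) (m + e)) →
      Q ≤ count h i * F.kl (muHat h i) m + count h j * F.kl (muHat h j) m := by
    intro h hh i j m hm Q hQ
    refine ge_of_tendsto (b := Q) (f := fun e : ℝ => (count h i : ℝ≥0∞) * F.kl (muHat h i) m +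
        count h j * F.kl (muHat h j) (m + e)) ?_ hQ
    exact tendsto_const_nhds.add (ENNReal.Tendsto.const_mul (tendsto_kl_right (hh j) hm)
      (Or.inr (ENNReal.natCast_ne_top _)))
  have hmeans : ∀ m ∈ F.means, ∀ᶠ e in 𝓝[>] (0 : ℝ), m + e ∈ F.means := by
    intro m hm
    have : Tendsto (fun e : ℝ => m + e) (𝓝 0) (𝓝 (m + 0)) := tendsto_const_nhds.add tendsto_id
    rw [add_zero] at this
    exact (this.mono_left nhdsWithin_le_nhds).eventually (F.isOpen_means.mem_nhds hm)
  -- The fixed slice is the packing slice, respectively a least loaded slice, of the true `μ`. For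
  -- criterion 1 a wrong candidate always yields a deviation of a single slice, and the choice is
  -- arbitrary.
  refine ⟨match c with | .packing => kPack γ μ | _ => kLow μ, fun h hh hwrong => ?_⟩
  have hcand := candidate_mem_correct F c γ h
  rcases Fin.eq_zero_or_eq_succ (candidate F c γ h) with h0 | ⟨k, hk⟩
  · left
    rw [h0, zero_mem_correct_iff] at hwrong
    push Not at hwrong
    obtain ⟨k, hk⟩ := hwrong
    refine ⟨k, ?_⟩
    have := altInf_le_sum (F := F) (c := c) (γ := γ) (count h) (a := candidate F c γ h) hh {k}
      (l := μ) (fun k _ => hμ k) one_pos (by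
        intro l' hl' _
        rw [h0, zero_mem_correct_iff]
        push Not
        exact ⟨k, by rw [hl' k (by simp)]; exact hk⟩)
    simpa [statQ] using this
  · rw [hk] at hcand hwrong
    have hkγ := lt_of_succ_mem_correct hcand
    by_cases hμk : γ ≤ μ k
    · left
      refine ⟨k, ?_⟩
      have := altInf_le_sum (F := F) (c := c) (γ := γ) (count h) (a := candidate F c γ h) hh {k}
        (l := μ) (fun k _ => hμ k) one_pos (by
          intro l' hl' _
          rw [hk]
          intro hc
          have := lt_of_succ_mem_correct hc
          rw [hl' k (by simp)] at this
          exact absurd this (not_lt.2 hμk))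
      simpa [statQ] using this
    · push Not at hμk
      cases c
      · exact absurd (succ_mem_correct_anyAvailable.2 hμk) hwrong
      · have hp := kPack_spec ⟨k, hμk⟩
        set j := kPack γ μ with hj
        rw [succ_mem_correct_packing] at hwrong hcand
        have hkj : μ k < μ j := by
          by_contra hcon
          exact hwrong ⟨hμk, fun i hi => (hp.2 i hi).trans (not_lt.1 hcon)⟩
        have hne : k ≠ j := fun e => by rw [e] at hkj; exact lt_irrefl _ hkj
        by_cases hjγ : muHat h j < γ
        · right
          refine ⟨k, j, hne, Or.inr rfl, hkj, hcand.2 j hjγ, ?_, ?_⟩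
          · refine hpair h hh k j hne _ _ (hμ k) (hμ j) fun l' h1 h2 => ?_
            rw [hk, succ_mem_correct_packing]
            intro hc
            have := hc.2 j (by rw [h2]; exact hp.1)
            rw [h1, h2] at this
            linarith
          -- The common mean must stay below `γ`, so that slice `j` remains available while it
          -- overtakes `k`.
          · refine ⟨γ, hkγ, fun m hm hm2 => ?_⟩
            refine hlim h hh k j m hm _ ?_
            have hlt : ∀ᶠ e in 𝓝[>] (0 : ℝ), e < γ - m :=
              nhdsWithin_le_nhds (Iio_mem_nhds (by linarith))
            filter_upwards [hmeans m hm, hlt, self_mem_nhdsWithin] with e he1 he2 he3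
            refine hpair h hh k j hne _ _ hm he1 fun l' h1 h2 => ?_
            rw [hk, succ_mem_correct_packing]
            intro hc
            have := hc.2 j (by rw [h2]; linarith)
            rw [h1, h2] at this
            have : (0 : ℝ) < e := he3
            linarith
        · left
          push Not at hjγ
          refine ⟨j, ?_⟩
          -- Slice `j` looks unavailable although it is available. Moving it alone to a value below
          -- `γ` but above the load of `k` refutes `k`; as this value is at least `μ j`, it costs no
          -- more than moving `j` to `μ j`.
          set b := max (μ j) ((muHat h k + γ) / 2) with hb
          have hb1 : μ j ≤ b := le_max_left _ _
          have hb2 : b < γ := max_lt hp.1 (by linarith)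
          have hb3 : muHat h k < b := lt_of_lt_of_le (by linarith) (le_max_right _ _)
          have hbM : b ∈ F.means := by
            cases F
            · have h1 : 0 < μ j ∧ μ j < 1 := hμ j
              have h2 : 0 ≤ muHat h j ∧ muHat h j ≤ 1 := hh j
              exact ⟨by linarith, by linarith⟩
            · have h1 : 0 < μ j := hμ j
              exact lt_of_lt_of_le h1 hb1
          have := altInf_le_sum (F := F) (c := .packing) (γ := γ) (count h)
            (a := candidate F .packing γ h) hh {j}
            (l := fun _ => b) (fun _ _ => hbM) (η := b - muHat h k) (by linarith) (by
              intro l' hl' hl''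
              rw [hk, succ_mem_correct_packing]
              intro hc
              have h1 : l' j = b := hl' j (by simp)
              have h2 := hc.2 j (by rw [h1]; exact hb2)
              have h3 := abs_lt.1 (hl'' k (by simpa using hne))
              rw [h1] at h2
              linarith [h3.2])
          refine (show statQ F .packing γ h ≤ _ from this).trans ?_
          rw [Finset.sum_singleton]
          exact mul_le_mul_right (Family.kl_mono_right (hh j) hbM (hμ j)
            (Or.inr ⟨by linarith, hb1⟩)) _
      · have hp := kLow_spec μ
        set i := kLow μ with hi
        rw [succ_mem_correct_leastLoaded] at hwrong hcand
        have hik : μ i < μ k := by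
          by_contra hcon
          exact hwrong ⟨hμk, fun i' => (not_lt.1 hcon).trans (hp i')⟩
        have hne : i ≠ k := fun e => by rw [e] at hik; exact lt_irrefl _ hik
        right
        refine ⟨i, k, hne, Or.inl rfl, hik, hcand.2 i, ?_, ?_⟩
        · refine hpair h hh i k hne _ _ (hμ i) (hμ k) fun l' h1 h2 => ?_
          rw [hk, succ_mem_correct_leastLoaded]
          intro hc
          have := hc.2 i
          rw [h1, h2] at this
          linarith
        -- For the least loaded criterion the common mean is not restricted by `γ`: once `i` lies
        -- strictly below `k`, the slice `k` is refuted.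
        · refine ⟨muHat h i + 1, by linarith, fun m hm _ => ?_⟩
          refine hlim h hh i k m hm _ ?_
          filter_upwards [hmeans m hm, self_mem_nhdsWithin] with e he1 he3
          refine hpair h hh i k hne _ _ hm he1 fun l' h1 h2 => ?_
          rw [hk, succ_mem_correct_leastLoaded]
          intro hc
          have := hc.2 i
          rw [h1, h2] at this
          have : (0 : ℝ) < e := he3
          linarith

/-! ### Decomposition of the error event -/

/-- The sample means almost surely stay in the closure of the set of means. -/
lemma prob_exists_muHat_notMem [NeZero K] {F : Family} {μ : Fin K → ℝ} (hμ : ∀ k, μ k ∈ F.means)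
    (A : Algorithm K) :
    prob F μ {x | ∃ t, A.hist x t ∈ {h | ¬ ∀ k, muHat h k ∈ F.closedMeans}} = 0 := by
  have hpos : 0 < K := Nat.pos_of_ne_zero (NeZero.ne K)
  have := prob_exists_hist_mem_le F μ A {h | ¬ ∀ k, muHat h k ∈ F.closedMeans} Finset.univ
    (fun _ _ => 0) (fun _ _ => isSubLik_zero) (by
      intro h hh
      simp only [Set.mem_ofPred_eq, not_forall] at hh
      obtain ⟨k, hk⟩ := hh
      refine (Finset.prod_eq_zero (Finset.mem_univ k) ?_).le.trans (by simp)
      by_contra hne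
      apply hk
      rw [muHat_eq]
      cases F
      · have hm : 0 < μ k ∧ μ k < 1 := hμ k
        have hle : (obs k h).sum ≤ (obs k h).length := by
          generalize obs k h = l at hne
          induction l with
          | nil => simp
          | cons v l ih =>
            rw [seqLik_cons] at hne
            have h1 := left_ne_zero_of_mul hne
            have h2 := ih (right_ne_zero_of_mul hne)
            have hv : v ≤ 1 := by
              by_contra hv
              apply h1
              rw [Family.law_bernoulli_singleton ⟨hm.1.le, hm.2.le⟩, if_neg (by lia),
                if_neg (by lia)]
              simp
            simp only [List.sum_cons, List.length_cons]
            lia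
        exact ⟨by positivity, div_le_one_of_le₀ (by exact_mod_cast hle) (by positivity)⟩
      · change (0 : ℝ) ≤ _
        positivity)
  refine le_antisymm (this.trans ?_) zero_le
  simp [hpos.ne']

lemma Algorithm.halts_of_tau_ne_top (A : Algorithm K) {x : Outcomes K} (h : A.tau x ≠ ⊤) :
    A.halts (A.hist x (A.tau x).toNat) := by
  obtain ⟨t, ht⟩ := ciInf_mem (fun t : ℕ => ⨅ _ : A.halts (A.hist x t), (t : ℕ∞))
  have ht' : (⨅ _ : A.halts (A.hist x t), (t : ℕ∞)) = A.tau x := ht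
  by_cases hh : A.halts (A.hist x t)
  · rw [iInf_pos hh] at ht'
    rw [← ht']
    simpa using hh
  · rw [iInf_neg hh] at ht'
    exact absurd ht'.symm h

lemma Algorithm.lt_tau_subset (A : Algorithm K) (t : ℕ) :
    {x | (t : ℕ∞) < A.tau x} ⊆ {x | A.hist x t ∈ {h | ¬ A.halts h}} := by
  intro x hx hh
  have : A.tau x ≤ t := iInf₂_le t hh
  exact absurd hx (not_lt.2 this)

/-- The histories along which the sample mean of slice `k` deviates. -/
def oneDev (F : Family) (μ : Fin K → ℝ) (f : ℕ → ℝ) (k : Fin K) : Set (History K) :=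
  {h | (∀ k, muHat h k ∈ F.closedMeans) ∧
    ENNReal.ofReal (f (roundNo h)) < count h k * F.kl (muHat h k) (μ k)}

/-- The histories along which the sample means of slices `i` and `j` are inverted. -/
def pairDev (F : Family) (μ : Fin K → ℝ) (f : ℕ → ℝ) (i j : Fin K) : Set (History K) :=
  {h | (∀ k, muHat h k ∈ F.closedMeans) ∧ muHat h j ≤ muHat h i ∧
    ENNReal.ofReal (f (roundNo h)) <
      count h i * F.kl (muHat h i) (μ i) + count h j * F.kl (muHat h j) (μ j) ∧
    ∃ g, muHat h i < g ∧ ∀ m ∈ F.means, m < g → ENNReal.ofReal (f (roundNo h)) <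
      count h i * F.kl (muHat h i) m + count h j * F.kl (muHat h j) m}

/-- Union bound over the `K` deviations of single slices and the `K - 1` pairs that contain the
fixed slice. Each pair occurs in one orientation only, given by the order of the true means. -/
lemma prob_errorEvent_le [NeZero K] {F : Family} {c : Criterion} {γ C δ : ℝ} {μ : Fin K → ℝ}
    (hμ : ∀ k, μ k ∈ F.means) (ρ : History K → Fin K) {B₁ B₂ : ℝ≥0∞}
    (h₁ : ∀ k, prob F μ {x | ∃ t, (trackAndStop F c γ C δ ρ).hist x t ∈
      oneDev F μ (threshold C δ) k} ≤ B₁)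
    (h₂ : ∀ i j, i ≠ j → μ i < μ j → prob F μ {x | ∃ t, (trackAndStop F c γ C δ ρ).hist x t ∈
      pairDev F μ (threshold C δ) i j} ≤ B₂) :
    prob F μ ((trackAndStop F c γ C δ ρ).errorEvent c γ μ) ≤ K * B₁ + (K - 1 : ℕ) * B₂ := by
  classical
  set A := trackAndStop F c γ C δ ρ with hA
  obtain ⟨j₀, hj₀⟩ := exists_deviation_of_wrong (F := F) (c := c) (γ := γ) hμ
  set E₀ := {x | ∃ t, A.hist x t ∈ {h | ¬ ∀ k, muHat h k ∈ F.closedMeans}} with hE₀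
  set E₁ : Fin K → Set (Outcomes K) := fun k =>
    {x | ∃ t, A.hist x t ∈ oneDev F μ (threshold C δ) k} with hE₁
  set E₂ : Fin K → Fin K → Set (Outcomes K) := fun i j =>
    {x | ∃ t, A.hist x t ∈ pairDev F μ (threshold C δ) i j} with hE₂
  have hsub : A.errorEvent c γ μ ⊆ E₀ ∪ ((⋃ k, E₁ k) ∪ ⋃ k ∈ Finset.univ.erase j₀,
      if μ k < μ j₀ then E₂ k j₀ else if μ j₀ < μ k then E₂ j₀ k else ∅) := by
    rintro x ⟨hx1, hx2⟩
    have hhalt : ENNReal.ofReal (threshold C δ (roundNo (A.hist x (A.tau x).toNat))) <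
      statQ F c γ (A.hist x (A.tau x).toNat) := A.halts_of_tau_ne_top hx1
    have hx2 : candidate F c γ (A.hist x (A.tau x).toNat) ∉ correct c γ μ := hx2
    by_cases hg : ∀ k, muHat (A.hist x (A.tau x).toNat) k ∈ F.closedMeans
    · right
      rcases hj₀ _ hg hx2 with ⟨k, hk⟩ | ⟨i, j, hij, hj, hlt, hle, hs, g, hg', hm⟩
      · left
        exact Set.mem_iUnion.2 ⟨k, _, hg, hhalt.trans_le hk⟩
      · right
        have hmem : x ∈ E₂ i j := ⟨_, hg, hle, hhalt.trans_le hs,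
          g, hg', fun m h1 h2 => hhalt.trans_le (hm m h1 h2)⟩
        rcases hj with rfl | rfl
        · refine Set.mem_biUnion (x := j) (by simp [hij.symm]) ?_
          rw [if_neg (not_lt.2 hlt.le), if_pos hlt]
          exact hmem
        · refine Set.mem_biUnion (x := i) (by simp [hij]) ?_
          rw [if_pos hlt]
          exact hmem
    · left
      exact ⟨_, hg⟩
  refine (measure_mono hsub).trans ((measure_union_le _ _).trans ?_)
  rw [hE₀, prob_exists_muHat_notMem hμ A, zero_add]
  refine (measure_union_le _ _).trans (add_le_add ?_ ?_)
  · refine (measure_iUnion_fintype_le _ _).trans ((Finset.sum_le_sum fun k _ => h₁ k).trans ?_)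
    simp
  · refine (measure_biUnion_finset_le _ _).trans
      ((Finset.sum_le_sum (g := fun _ => B₂) fun k hk => ?_).trans ?_)
    · have hkj : k ≠ j₀ := Finset.ne_of_mem_erase hk
      split_ifs with h1 h2
      · exact h₂ k j₀ hkj h1
      · exact h₂ j₀ k hkj.symm h2
      · simp
    · rw [Finset.sum_const, nsmul_eq_mul, Finset.card_erase_of_mem (Finset.mem_univ _)]
      simp

/-! ### The Bernoulli family -/

/-- Laplace's sequential likelihood, the mixture of the Bernoulli likelihoods with the uniform
prior. -/
def laplaceLik (l : List ℕ) : ℝ≥0∞ :=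
  if ∀ v ∈ l, v ≤ 1 then
    ENNReal.ofReal ((l.sum.factorial * (l.length - l.sum).factorial : ℝ) / (l.length + 1).factorial)
  else 0

lemma sum_le_length_of_forall_le_one {l : List ℕ} (h : ∀ v ∈ l, v ≤ 1) : l.sum ≤ l.length := by
  have := List.sum_le_card_nsmul l 1 h
  simpa using this

/-- With `a` ones and `b` zeros the weight is the Beta integral `a! b! / (a + b + 1)!`, and the two
one-step extensions of a binary list add up to it exactly. -/
lemma isSubLik_laplaceLik : IsSubLik laplaceLik := by
  intro l
  by_cases h : ∀ v ∈ l, v ≤ 1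
  · have hle := sum_le_length_of_forall_le_one h
    have h2 : ∀ v ∉ ({0, 1} : Finset ℕ), laplaceLik (v :: l) = 0 := by
      intro v hv
      rw [laplaceLik, if_neg]
      intro hcon
      have := hcon v (by simp)
      simp at hv
      lia
    rw [tsum_eq_sum h2, Finset.sum_pair (by norm_num)]
    have h0 : ∀ v ∈ (0 :: l), v ≤ 1 := by simpa using h
    have h1 : ∀ v ∈ (1 :: l), v ≤ 1 := by simpa using h
    rw [laplaceLik, laplaceLik, laplaceLik, if_pos h, if_pos h0, if_pos h1,
      ← ENNReal.ofReal_add (by positivity) (by positivity)]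
    refine ENNReal.ofReal_le_ofReal (le_of_eq ?_)
    obtain ⟨b, hb⟩ := Nat.exists_eq_add_of_le hle
    simp only [List.sum_cons, List.length_cons, zero_add]
    generalize l.sum = a at *
    rw [hb]
    have e1 : a + b + 1 - a = b + 1 := by lia
    have e2 : a + b - a = b := by lia
    have e3 : a + b + 1 - (1 + a) = b := by lia
    have e4 : 1 + a = a + 1 := by lia
    rw [e1, e2, e3, e4, Nat.factorial_succ b, Nat.factorial_succ a,
      Nat.factorial_succ (a + b + 1)]
    have := Nat.factorial_pos (a + b + 1)
    push_cast
    field_simp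
    ring
  · have : ∀ v, laplaceLik (v :: l) = 0 := by
      intro v
      rw [laplaceLik, if_neg]
      intro hcon
      exact h fun w hw => hcon w (by simp [hw])
    simp [this]

lemma exp_mul_log_div (a : ℕ) {n : ℝ} (hn : 0 < n) :
    Real.exp (a * Real.log (a / n)) = (a / n : ℝ) ^ a := by
  rcases Nat.eq_zero_or_pos a with rfl | ha
  · simp
  · rw [Real.exp_nat_mul, Real.exp_log (by positivity)]

lemma seqLik_bernoulli {m : ℝ} (hm : m ∈ Family.bernoulli.means) {l : List ℕ}
    (h : ∀ v ∈ l, v ≤ 1) :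
    seqLik .bernoulli m l = ENNReal.ofReal (m ^ l.sum * (1 - m) ^ (l.length - l.sum)) := by
  have hm' : 0 < m ∧ m < 1 := hm
  have hm2 : 0 < 1 - m := by linarith
  induction l with
  | nil => simp
  | cons v l ih =>
    have hl : ∀ v ∈ l, v ≤ 1 := fun w hw => h w (by simp [hw])
    have hle := sum_le_length_of_forall_le_one hl
    rw [seqLik_cons, ih hl, Family.law_bernoulli_singleton ⟨hm'.1.le, hm'.2.le⟩,
      ← ENNReal.ofReal_mul (by split_ifs <;> linarith [hm'.1])]
    congr 1
    have hv := h v (by simp)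
    interval_cases v
    · simp only [List.sum_cons, List.length_cons, zero_add]
      rw [Nat.succ_sub hle, if_pos trivial, Nat.succ_eq_add_one, pow_succ]; ring
    · simp only [List.sum_cons, List.length_cons]
      rw [show l.length + 1 - (1 + l.sum) = l.length - l.sum by lia]
      simp only [one_ne_zero, if_false, if_true]
      ring

lemma seqLik_bernoulli_eq_zero {m : ℝ} (hm : m ∈ Family.bernoulli.means) {l : List ℕ}
    (h : ¬ ∀ v ∈ l, v ≤ 1) : seqLik .bernoulli m l = 0 := by
  have hm' : 0 < m ∧ m < 1 := hm
  push Not at h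
  obtain ⟨v, hv, hv1⟩ := h
  refine List.prod_eq_zero (List.mem_map.2 ⟨v, hv, ?_⟩)
  rw [Family.law_bernoulli_singleton ⟨hm'.1.le, hm'.2.le⟩, if_neg (by lia), if_neg (by lia)]
  simp

/-- The regret bound of the uniform mixture. -/
lemma seqLik_bernoulli_le {m : ℝ} (hm : m ∈ Family.bernoulli.means) (l : List ℕ) :
    seqLik .bernoulli m l ≤ ENNReal.ofReal (Real.exp (-(l.length *
      Family.bernoulli.dExp ((l.sum : ℕ) / (l.length : ℕ)) m)) * (l.length + 1)) *
      laplaceLik l := by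
  by_cases h : ∀ v ∈ l, v ≤ 1
  swap
  · rw [seqLik_bernoulli_eq_zero hm h]; exact zero_le
  have hm' : 0 < m ∧ m < 1 := hm
  rw [seqLik_bernoulli hm h, laplaceLik, if_pos h, ← ENNReal.ofReal_mul (by positivity)]
  refine ENNReal.ofReal_le_ofReal ?_
  have hle := sum_le_length_of_forall_le_one h
  obtain ⟨b, hb⟩ := Nat.exists_eq_add_of_le hle
  generalize l.sum = a at *
  rw [hb]
  have e2 : a + b - a = b := by lia
  rw [e2]
  rcases Nat.eq_zero_or_pos (a + b) with h0 | hpos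
  · obtain ⟨rfl, rfl⟩ : a = 0 ∧ b = 0 := by lia
    simp
  have hn : (0 : ℝ) < a + b := by exact_mod_cast hpos
  have hq : (1 : ℝ) - a / (a + b) = b / (a + b) := by field_simp; ring
  have hexp : Real.exp (-(((a + b : ℕ) : ℝ) * Family.bernoulli.dExp (a / ((a + b : ℕ) : ℝ)) m)) *
      (((a : ℝ) / (a + b)) ^ a * ((b : ℝ) / (a + b)) ^ b) = m ^ a * (1 - m) ^ b := by
    rw [← exp_mul_log_div a hn, ← exp_mul_log_div b hn, ← Real.exp_add, ← Real.exp_add]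
    have : m ^ a * (1 - m) ^ b = Real.exp (a * Real.log m + b * Real.log (1 - m)) := by
      rw [Real.exp_add, Real.exp_nat_mul, Real.exp_nat_mul, Real.exp_log hm'.1,
        Real.exp_log (by linarith)]
    rw [this]
    congr 1
    simp only [Family.dExp, Family.conj, Family.natParam, Family.logPart]
    push_cast
    rw [hq]
    field_simp
    ring
  rw [← hexp, mul_assoc]
  refine mul_le_mul_of_nonneg_left ?_ (Real.exp_nonneg _)
  -- The maximal likelihood times the binomial coefficient is one term of the binomial expansion of
  -- `1`. The uniform mixture therefore loses at most the factor `a + b + 1`.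
  have hbin : ((a + b).choose a : ℝ) * (((a : ℝ) / (a + b)) ^ a * ((b : ℝ) / (a + b)) ^ b) ≤ 1 := by
    have h1 := add_pow ((a : ℝ) / (a + b)) ((b : ℝ) / (a + b)) (a + b)
    have h2 : (a : ℝ) / (a + b) + b / (a + b) = 1 := by field_simp
    rw [h2, one_pow] at h1
    rw [h1]
    refine le_trans (le_of_eq ?_) (Finset.single_le_sum (f := fun k =>
      ((a : ℝ) / (a + b)) ^ k * ((b : ℝ) / (a + b)) ^ (a + b - k) * ((a + b).choose k : ℝ))
      (fun i _ => by positivity) (Finset.mem_range.2 (by lia : a < a + b + 1)))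
    simp only [e2]; ring
  have hch : ((a + b).choose a : ℝ) * (a.factorial * b.factorial) = (a + b).factorial := by
    have := Nat.add_choose_mul_factorial_mul_factorial a b
    rw [← Nat.choose_symm_add] at this
    rw [← mul_assoc]
    exact_mod_cast this
  rw [Nat.factorial_succ]
  have hf := Nat.factorial_pos (a + b)
  have hc : (0 : ℝ) < (a + b).choose a := by exact_mod_cast Nat.choose_pos (by lia : a ≤ a + b)
  push_cast
  rw [← hch]
  have ha := Nat.factorial_pos a
  have hb' := Nat.factorial_pos b
  field_simp
  field_simp at hbin
  linarith

lemma le_dExp_of_lt_kl {F : Family} {n : ℕ} {a m x : ℝ} (ha : a ∈ F.closedMeans) (hm : m ∈ F.means)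
    (h : ENNReal.ofReal x < n * F.kl a m) : x < n * F.dExp a m := by
  rw [Family.kl_eq ha hm, ← ENNReal.ofReal_natCast, ← ENNReal.ofReal_mul (by positivity)] at h
  exact (ENNReal.ofReal_lt_ofReal_iff'.1 h).1

lemma le_dExp_of_lt_kl_add {F : Family} {n n' : ℕ} {a m a' m' x : ℝ} (ha : a ∈ F.closedMeans)
    (hm : m ∈ F.means) (ha' : a' ∈ F.closedMeans) (hm' : m' ∈ F.means)
    (h : ENNReal.ofReal x < n * F.kl a m + n' * F.kl a' m') :
    x < n * F.dExp a m + n' * F.dExp a' m' := by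
  have h1 := Family.dExp_nonneg ha hm
  have h2 := Family.dExp_nonneg ha' hm'
  rw [Family.kl_eq ha hm, Family.kl_eq ha' hm', ← ENNReal.ofReal_natCast,
    ← ENNReal.ofReal_natCast, ← ENNReal.ofReal_mul (by positivity),
    ← ENNReal.ofReal_mul (by positivity), ← ENNReal.ofReal_add (by positivity) (by positivity)] at h
  exact (ENNReal.ofReal_lt_ofReal_iff'.1 h).1

lemma count_lt_roundNo (h : History K) (k : Fin K) : count h k + 1 ≤ roundNo h := by
  have : count h k ≤ h.length := by
    rw [← sum_count h]
    exact Finset.single_le_sum (f := count h) (fun _ _ => Nat.zero_le _) (Finset.mem_univ k)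
  simp only [roundNo]; lia

lemma count_add_count_lt_roundNo (h : History K) {i j : Fin K} (hij : i ≠ j) :
    count h i + count h j + 1 ≤ roundNo h := by
  classical
  have : count h i + count h j ≤ h.length := by
    rw [← sum_count h, ← Finset.sum_pair hij (f := count h)]
    exact Finset.sum_le_sum_of_subset (Finset.subset_univ _)
  simp only [roundNo]; lia

lemma exp_neg_threshold {C δ : ℝ} (hC : 0 < C) (hδ : 0 < δ) {t : ℕ} (ht : 0 < t) :
    Real.exp (-threshold C δ t) = δ / C / (t : ℝ) ^ 2 := by
  rw [threshold, Real.exp_neg, Real.exp_log (by positivity)]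
  field_simp

/-- The two regret factors `(n_i + 1)(n_j + 1)` are at most `t²`, exactly what `exp (-threshold)`
compensates. The mixture holds uniformly in time, so no sum over rounds is paid. -/
lemma prob_pairDev_bernoulli {C δ : ℝ} (hC : 0 < C) (hδ : 0 < δ) {μ : Fin K → ℝ}
    (hμ : ∀ k, μ k ∈ Family.bernoulli.means) (A : Algorithm K) {i j : Fin K} (hij : i ≠ j) :
    prob .bernoulli μ {x | ∃ t, A.hist x t ∈ pairDev .bernoulli μ (threshold C δ) i j} ≤
      ENNReal.ofReal (δ / C) := by
  have := prob_exists_hist_mem_le .bernoulli μ A (pairDev .bernoulli μ (threshold C δ) i j) {i, j}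
    -- The constant `δ / C` must appear once in the product over the pair; it is attached to the
    -- factor of `i`.
    (fun k l => ENNReal.ofReal (if k = i then δ / C else 1) * laplaceLik l)
    (fun _ _ => isSubLik_laplaceLik.const_mul _) (by
      rintro h ⟨hg, _, hh, _⟩
      rw [Finset.prod_pair hij, Finset.prod_pair hij]
      refine (mul_le_mul' (seqLik_bernoulli_le (hμ i) (obs i h))
        (seqLik_bernoulli_le (hμ j) (obs j h))).trans ?_
      rw [mul_mul_mul_comm, mul_mul_mul_comm (ENNReal.ofReal _) _ (ENNReal.ofReal _) (laplaceLik (obs j h)),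
        ← ENNReal.ofReal_mul (by positivity), ← ENNReal.ofReal_mul (by positivity)]
      refine mul_le_mul_left (ENNReal.ofReal_le_ofReal ?_) _
      rw [if_pos rfl, if_neg hij.symm, mul_one]
      have h1 := le_dExp_of_lt_kl_add (hg i) (hμ i) (hg j) (hμ j) hh
      rw [muHat_eq, muHat_eq] at h1
      rw [length_obs, length_obs] at h1 ⊢
      have ht : 0 < roundNo h := by simp [roundNo]
      have ht' : (0 : ℝ) < roundNo h := by exact_mod_cast ht
      have hc : (count h i : ℝ) + count h j + 1 ≤ roundNo h := by
        exact_mod_cast count_add_count_lt_roundNo h hij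
      have hi0 : (0 : ℝ) ≤ count h i := by positivity
      have hj0 : (0 : ℝ) ≤ count h j := by positivity
      rw [mul_mul_mul_comm, ← Real.exp_add]
      calc _ ≤ Real.exp (-threshold C δ (roundNo h)) * (roundNo h : ℝ) ^ 2 := by
            refine mul_le_mul (Real.exp_le_exp.2 (by linarith)) ?_ (by positivity)
              (Real.exp_nonneg _)
            nlinarith
        _ = δ / C := by
            rw [exp_neg_threshold hC hδ ht]
            field_simp)
  refine this.trans ?_
  rw [Finset.prod_pair hij]
  simp [laplaceLik, hij.symm]

/-! ### Tilting and peeling -/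

/-- Intermediate value theorem between `m` and `a`. Since `v` is strictly below the divergence of
`a`, the point `z` differs from `a` and is an interior mean even if `a` lies on the boundary. -/
lemma Family.exists_dExp_eq {F : Family} {a m v : ℝ} (ha : a ∈ F.closedMeans) (hm : m ∈ F.means)
    (hv : 0 < v) (hva : v < F.dExp a m) :
    ∃ z ∈ F.means, F.dExp z m = v ∧ (m < a ∧ m < z ∧ z ≤ a ∨ a < m ∧ z < m ∧ a ≤ z) := by
  have hcont : Continuous fun z => F.dExp z m := by
    unfold dExp
    exact ((F.continuous_conj).sub (continuous_id.mul continuous_const)).add continuous_const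
  have hself := F.dExp_self m
  rcases lt_trichotomy m a with hlt | rfl | hlt
  · obtain ⟨z, hz, hzv⟩ := intermediate_value_Icc hlt.le (hcont.continuousOn (s := Set.Icc m a))
      (show v ∈ Set.Icc (F.dExp m m) (F.dExp a m) from ⟨by linarith, hva.le⟩)
    have hzm : z ≠ m := fun e => by simp only [e] at hzv; linarith
    have hza : z ≠ a := fun e => by simp only [e] at hzv; linarith
    have h1 : m < z := lt_of_le_of_ne hz.1 (Ne.symm hzm)
    have h2 : z < a := lt_of_le_of_ne hz.2 hza
    refine ⟨z, ?_, hzv, Or.inl ⟨hlt, h1, h2.le⟩⟩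
    cases F
    · have h3 : 0 < m ∧ m < 1 := hm
      have h4 : 0 ≤ a ∧ a ≤ 1 := ha
      exact ⟨by linarith, by linarith⟩
    · have h3 : 0 < m := hm
      exact h3.trans h1
  · linarith
  · obtain ⟨z, hz, hzv⟩ := intermediate_value_Icc' hlt.le (hcont.continuousOn (s := Set.Icc a m))
      (show v ∈ Set.Icc (F.dExp m m) (F.dExp a m) from ⟨by linarith, hva.le⟩)
    have hzm : z ≠ m := fun e => by simp only [e] at hzv; linarith
    have hza : z ≠ a := fun e => by simp only [e] at hzv; linarith
    have h1 : z < m := lt_of_le_of_ne hz.2 hzm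
    have h2 : a < z := lt_of_le_of_ne hz.1 (Ne.symm hza)
    refine ⟨z, ?_, hzv, Or.inr ⟨hlt, h1, h2.le⟩⟩
    cases F
    · have h3 : 0 < m ∧ m < 1 := hm
      have h4 : 0 ≤ a ∧ a ≤ 1 := ha
      exact ⟨by linarith, by linarith⟩
    · have h4 : 0 ≤ a := ha
      exact lt_of_le_of_lt h4 h2

/-- The sample mean of a list of observations. -/
def listMean (l : List ℕ) : ℝ := ((l.sum : ℕ) : ℝ) / (l.length : ℕ)

lemma length_mul_listMean (l : List ℕ) : (l.length : ℝ) * listMean l = (l.sum : ℕ) := by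
  rcases l with _ | ⟨v, l⟩
  · simp [listMean]
  · have : (0 : ℝ) < ((v :: l).length : ℕ) := by simp; positivity
    rw [listMean]; field_simp

lemma muHat_eq_listMean (h : History K) (k : Fin K) : muHat h k = listMean (obs k h) := muHat_eq k h

/-- A sequential likelihood that dominates the likelihood wherever the divergence of the
sample mean exceeds the level `v`. -/
lemma exists_tilt {F : Family} {m : ℝ} (hm : m ∈ F.means) (v : ℝ) :
    ∃ W : List ℕ → ℝ≥0∞, IsSubLik W ∧ W [] ≤ 2 ∧ ∀ l : List ℕ, listMean l ∈ F.closedMeans →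
      (v ≤ 0 ∨ v < F.dExp (listMean l) m) →
      seqLik F m l ≤ ENNReal.ofReal (Real.exp (-(l.length * v))) * W l := by
  classical
  by_cases hv : v ≤ 0
  · refine ⟨seqLik F m, isSubLik_seqLik F m, by simp, fun l _ _ => ?_⟩
    have h1 : (1 : ℝ) ≤ Real.exp (-(l.length * v)) := by
      rw [Real.one_le_exp_iff]
      have : (0 : ℝ) ≤ l.length := by positivity
      nlinarith
    calc seqLik F m l = ENNReal.ofReal 1 * seqLik F m l := by simp
      _ ≤ _ := mul_le_mul_left (ENNReal.ofReal_le_ofReal h1) _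
  push Not at hv
  -- Upward and downward deviations are tilted separately, each towards the mean `z` at divergence
  -- `v` from `m` on that side; this gives the initial weight `2`.
  have key : ∀ up : Bool, ∃ W : List ℕ → ℝ≥0∞, IsSubLik W ∧ W [] ≤ 1 ∧
      ∀ l : List ℕ, listMean l ∈ F.closedMeans → (if up then m < listMean l else listMean l < m) →
      v < F.dExp (listMean l) m →
      seqLik F m l ≤ ENNReal.ofReal (Real.exp (-(l.length * v))) * W l := by
    intro up
    -- The point `z` may fail to exist on one side (bounded divergence). Then no sample mean
    -- deviates there and the zero weight suffices.
    by_cases hex : ∃ l : List ℕ, listMean l ∈ F.closedMeans ∧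
      (if up then m < listMean l else listMean l < m) ∧ v < F.dExp (listMean l) m
    · obtain ⟨l₀, h1, h2, h3⟩ := hex
      obtain ⟨z, hz, hzv, hzc⟩ := Family.exists_dExp_eq h1 hm hv h3
      refine ⟨seqLik F z, isSubLik_seqLik F z, by simp, fun l hl hup hlv => ?_⟩
      rw [← hzv]
      obtain ⟨z', hz', hzv', hzc'⟩ := Family.exists_dExp_eq hl hm hv hlv
      apply seqLik_le_of_tilt hm hz
      rw [← length_mul_listMean]
      have hl0 : (0 : ℝ) ≤ l.length := by positivity
      cases up
      · simp only [Bool.false_eq_true, if_false] at h2 hup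
        have e1 : z < m := by rcases hzc with h | h <;> [linarith [h.1]; exact h.2.1]
        have e2 : z' < m ∧ listMean l ≤ z' := by
          rcases hzc' with h | h <;> [linarith [h.1]; exact h.2]
        -- Both points lie on the same side of `m` at the same divergence, so strict monotonicity of
        -- the divergence forbids the other order.
        have : z' ≤ z := by
          by_contra hcon
          have := Family.dExp_lt_left hz hz' hm (Or.inl ⟨not_le.1 hcon, e2.1.le⟩)
          linarith
        exact Or.inr ⟨e1.le, mul_le_mul_of_nonneg_left (e2.2.trans this) hl0⟩
      · simp only [if_true] at h2 hup
        have e1 : m < z := by rcases hzc with h | h <;> [exact h.2.1; linarith [h.1]]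
        have e2 : m < z' ∧ z' ≤ listMean l := by
          rcases hzc' with h | h <;> [exact h.2; linarith [h.1]]
        have : z ≤ z' := by
          by_contra hcon
          have := Family.dExp_lt_left hz hz' hm (Or.inr ⟨not_le.1 hcon, e2.1.le⟩)
          linarith
        exact Or.inl ⟨e1.le, mul_le_mul_of_nonneg_left (this.trans e2.2) hl0⟩
    · push Not at hex
      exact ⟨fun _ => 0, isSubLik_zero, by simp, fun l h1 h2 h3 => absurd h3 (not_lt.2 (hex l h1 h2))⟩
  obtain ⟨W₁, hW₁, hW₁', h₁⟩ := key true
  obtain ⟨W₂, hW₂, hW₂', h₂⟩ := key false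
  refine ⟨fun l => W₁ l + W₂ l, hW₁.add hW₂, (add_le_add hW₁' hW₂').trans (by norm_num), ?_⟩
  intro l hl hlv
  have hlv : v < F.dExp (listMean l) m := by
    rcases hlv with h | h
    · linarith
    · exact h
  rcases lt_trichotomy m (listMean l) with h | h | h
  · exact (h₁ l hl (by simpa using h) hlv).trans (mul_le_mul_right le_self_add _)
  · rw [← h, Family.dExp_self] at hlv
    linarith
  · exact (h₂ l hl (by simpa using h) hlv).trans (mul_le_mul_right le_add_self _)

/-- A sequential likelihood that dominates the likelihood wherever the deviation of the sample
mean of at most `s` observations exceeds `u`. -/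
lemma exists_peel {F : Family} {m : ℝ} (hm : m ∈ F.means) (u : ℝ) {η : ℝ} (hη : 0 < η) {s R : ℕ}
    (hR : (s : ℝ) < (1 + η) ^ (R + 1)) :
    ∃ W : List ℕ → ℝ≥0∞, IsSubLik W ∧ W [] ≤ 2 * (R + 1) ∧ ∀ l : List ℕ,
      listMean l ∈ F.closedMeans → 1 ≤ l.length → l.length ≤ s →
      u ≤ l.length * F.dExp (listMean l) m →
      seqLik F m l ≤ ENNReal.ofReal (Real.exp (-(u / (1 + η)))) * W l := by
  by_cases hu : u ≤ 0
  · refine ⟨seqLik F m, isSubLik_seqLik F m, ?_, fun l _ _ _ _ => ?_⟩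
    · rw [seqLik_nil]
      calc (1 : ℝ≥0∞) ≤ 2 * (0 + 1) := by norm_num
        _ ≤ _ := by gcongr; exact zero_le
    · have h1 : (1 : ℝ) ≤ Real.exp (-(u / (1 + η))) := by
        rw [Real.one_le_exp_iff, neg_nonneg]
        exact div_nonpos_of_nonpos_of_nonneg hu (by linarith)
      calc seqLik F m l = ENNReal.ofReal 1 * seqLik F m l := by simp
        _ ≤ _ := mul_le_mul_left (ENNReal.ofReal_le_ofReal h1) _
  push Not at hu
  have h1η : (0 : ℝ) < 1 + η := by linarith
  -- Lengths in `[(1 + η)^r, (1 + η)^(r + 1))` share one level of divergence, the one required at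
  -- the upper end; at the lower end this costs a factor `1 + η` in the exponent.
  choose W hW hW2 hWl using fun r : ℕ => exists_tilt hm (u / (1 + η) ^ (r + 1))
  refine ⟨fun l => ∑ r ∈ Finset.range (R + 1), W r l, IsSubLik.sum _ fun r _ => hW r, ?_, ?_⟩
  · calc ∑ r ∈ Finset.range (R + 1), W r [] ≤ ∑ r ∈ Finset.range (R + 1), 2 :=
          Finset.sum_le_sum fun r _ => hW2 r
      _ = 2 * (R + 1) := by simp [mul_comm]
  · intro l hl hl1 hls hul
    have hl1' : (1 : ℝ) ≤ l.length := by exact_mod_cast hl1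
    have hls' : (l.length : ℝ) ≤ s := by exact_mod_cast hls
    obtain ⟨r, hr1, hr2⟩ := exists_nat_pow_near hl1' (by linarith : 1 < 1 + η)
    have hrR : r < R + 1 := by
      by_contra hcon
      have := pow_le_pow_right₀ (by linarith : 1 ≤ 1 + η) (not_lt.1 hcon)
      linarith
    have hp : 0 < (1 + η) ^ (r + 1) := by positivity
    have hlt : u / (1 + η) ^ (r + 1) < F.dExp (listMean l) m := by
      rw [div_lt_iff₀ hp]
      have hd : 0 < F.dExp (listMean l) m := by
        by_contra hcon
        nlinarith
      nlinarith
    refine (hWl r l hl (Or.inr hlt)).trans (mul_le_mul' (ENNReal.ofReal_le_ofReal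
      (Real.exp_le_exp.2 (neg_le_neg ?_))) (Finset.single_le_sum (f := fun r => W r l)
        (fun _ _ => zero_le) (Finset.mem_range.2 hrR)))
    rw [pow_succ, div_le_iff₀ h1η]
    have hp' : 0 < (1 + η) ^ r := by positivity
    have : (l.length : ℝ) * (u / ((1 + η) ^ r * (1 + η))) * (1 + η) = l.length / (1 + η) ^ r * u := by
      field_simp
    rw [this]
    have : 1 ≤ (l.length : ℝ) / (1 + η) ^ r := by rw [le_div_iff₀ hp']; linarith
    nlinarith

/-- Peeling bound for the joint deviation of two slices that have at most `s` observations. -/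
lemma prob_exists_sum_dev_le {F : Family} {μ : Fin K → ℝ} (hμ : ∀ k, μ k ∈ F.means)
    (A : Algorithm K) {i j : Fin K} (hij : i ≠ j) {s R : ℕ} {x : ℝ} (hx : 0 < x)
    (hR : (s : ℝ) < (1 + 1 / x) ^ (R + 1)) :
    prob F μ {o | ∃ t, A.hist o t ∈ {h : History K | (∀ k, muHat h k ∈ F.closedMeans) ∧
      1 ≤ count h i ∧ 1 ≤ count h j ∧ count h i ≤ s ∧ count h j ≤ s ∧
      x < count h i * F.dExp (muHat h i) (μ i) + count h j * F.dExp (muHat h j) (μ j)}} ≤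
    ENNReal.ofReal (4 * Real.exp 2 * (x + 1) * (R + 1) ^ 2 * Real.exp (-x)) := by
  -- With `η = 1 / x` the exponent `(x - 1) / (1 + η)` is at least `x - 2`, so the loss is only the
  -- factor `exp 2`.
  have hη : 0 < 1 / x := by positivity
  choose W hW hW2 hWl using fun (k : Fin K) (u : ℝ) => exists_peel (hμ k) u hη hR
  -- The deviation of `i` is rounded down to an integer `u`, capped at the integer part of `x`; the
  -- deviation of `j` is then at least `x - u - 1`.
  set S : ℕ → Set (History K) := fun u => {h : History K | (∀ k, muHat h k ∈ F.closedMeans) ∧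
      1 ≤ count h i ∧ 1 ≤ count h j ∧ count h i ≤ s ∧ count h j ≤ s ∧
      (u : ℝ) ≤ count h i * F.dExp (muHat h i) (μ i) ∧
      x - u - 1 ≤ count h j * F.dExp (muHat h j) (μ j)} with hS
  have hSu : ∀ u : ℕ, prob F μ {o | ∃ t, A.hist o t ∈ S u} ≤
      ENNReal.ofReal (4 * Real.exp 2 * (R + 1) ^ 2 * Real.exp (-x)) := by
    intro u
    have := prob_exists_hist_mem_le F μ A (S u) {i, j}
      (fun k l => if k = i then ENNReal.ofReal (Real.exp (-((u : ℝ) / (1 + 1 / x)))) * W i u l else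
        ENNReal.ofReal (Real.exp (-((x - u - 1) / (1 + 1 / x)))) * W j (x - u - 1) l)
      (by
        intro k _
        by_cases hk : k = i
        · simpa only [hk, if_true] using (hW i u).const_mul _
        · simpa only [hk, if_false] using (hW j (x - u - 1)).const_mul _)
      (by
        rintro h ⟨hg, h1, h2, h3, h4, h5, h6⟩
        rw [Finset.prod_pair hij, Finset.prod_pair hij, if_pos rfl, if_neg hij.symm]
        rw [← length_obs] at h1 h2 h3 h4 h5 h6
        refine mul_le_mul' (hWl i u _ ?_ h1 h3 ?_) (hWl j _ _ ?_ h2 h4 ?_)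
        · rw [← muHat_eq_listMean]; exact hg i
        · rw [← muHat_eq_listMean]; exact h5
        · rw [← muHat_eq_listMean]; exact hg j
        · rw [← muHat_eq_listMean]; exact h6)
    refine this.trans ?_
    rw [Finset.prod_pair hij, if_pos rfl, if_neg hij.symm, mul_mul_mul_comm,
      ← ENNReal.ofReal_mul (Real.exp_nonneg _), ← Real.exp_add]
    have e1 : ((2 : ℝ≥0∞) * (R + 1)) * (2 * (R + 1)) = ENNReal.ofReal (4 * (R + 1) ^ 2) := by
      have : (4 * (R + 1) ^ 2 : ℝ) = ((2 * (R + 1) * (2 * (R + 1)) : ℕ) : ℝ) := by push_cast; ring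
      rw [this, ENNReal.ofReal_natCast]; push_cast; ring
    refine (mul_le_mul_right (mul_le_mul' (hW2 i u) (hW2 j _)) _).trans ?_
    rw [e1, ← ENNReal.ofReal_mul (Real.exp_nonneg _)]
    refine ENNReal.ofReal_le_ofReal ?_
    have e2 : -((u : ℝ) / (1 + 1 / x)) + -((x - u - 1) / (1 + 1 / x)) ≤ 2 + -x := by
      have : -((u : ℝ) / (1 + 1 / x)) + -((x - u - 1) / (1 + 1 / x)) = -(x * (x - 1) / (x + 1)) := by
        field_simp; ring
      rw [this, neg_le, div_eq_mul_inv]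
      rw [← div_eq_mul_inv, le_div_iff₀ (by linarith)]
      nlinarith
    calc Real.exp (-((u : ℝ) / (1 + 1 / x)) + -((x - u - 1) / (1 + 1 / x))) * (4 * (R + 1) ^ 2)
        ≤ Real.exp (2 + -x) * (4 * (R + 1) ^ 2) := by gcongr
      _ = _ := by rw [Real.exp_add]; ring
  have hsub : {o | ∃ t, A.hist o t ∈ {h : History K | (∀ k, muHat h k ∈ F.closedMeans) ∧
      1 ≤ count h i ∧ 1 ≤ count h j ∧ count h i ≤ s ∧ count h j ≤ s ∧
      x < count h i * F.dExp (muHat h i) (μ i) + count h j * F.dExp (muHat h j) (μ j)}} ⊆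
      ⋃ u ∈ Finset.range (⌊x⌋₊ + 1), {o | ∃ t, A.hist o t ∈ S u} := by
    rintro o ⟨t, hg, h1, h2, h3, h4, h5⟩
    set h := A.hist o t
    have hd : 0 ≤ (count h i : ℝ) * F.dExp (muHat h i) (μ i) :=
      mul_nonneg (by positivity) (Family.dExp_nonneg (hg i) (hμ i))
    have hd' : 0 ≤ (count h j : ℝ) * F.dExp (muHat h j) (μ j) :=
      mul_nonneg (by positivity) (Family.dExp_nonneg (hg j) (hμ j))
    by_cases hle : ⌊(count h i : ℝ) * F.dExp (muHat h i) (μ i)⌋₊ ≤ ⌊x⌋₊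
    · refine Set.mem_biUnion (x := ⌊(count h i : ℝ) * F.dExp (muHat h i) (μ i)⌋₊)
        (by simpa [Nat.lt_succ_iff] using hle) ⟨t, hg, h1, h2, h3, h4, Nat.floor_le hd, ?_⟩
      have := Nat.lt_floor_add_one ((count h i : ℝ) * F.dExp (muHat h i) (μ i))
      linarith
    · refine Set.mem_biUnion (x := ⌊x⌋₊) (by simp) ⟨t, hg, h1, h2, h3, h4, ?_, ?_⟩
      · have h6 : ((⌊x⌋₊ : ℕ) : ℝ) ≤ (⌊(count h i : ℝ) * F.dExp (muHat h i) (μ i)⌋₊ : ℕ) := by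
          exact_mod_cast (not_le.1 hle).le
        exact h6.trans (Nat.floor_le hd)
      · have := Nat.lt_floor_add_one x
        linarith
  refine (measure_mono hsub).trans ((measure_biUnion_finset_le _ _).trans
    ((Finset.sum_le_sum fun u _ => hSu u).trans ?_))
  rw [Finset.sum_const, Finset.card_range, nsmul_eq_mul, ← ENNReal.ofReal_natCast,
    ← ENNReal.ofReal_mul (by positivity)]
  refine ENNReal.ofReal_le_ofReal ?_
  have : ((⌊x⌋₊ + 1 : ℕ) : ℝ) ≤ x + 1 := by
    push_cast
    linarith [Nat.floor_le hx.le]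
  calc ((⌊x⌋₊ + 1 : ℕ) : ℝ) * (4 * Real.exp 2 * (R + 1) ^ 2 * Real.exp (-x))
      ≤ (x + 1) * (4 * Real.exp 2 * (R + 1) ^ 2 * Real.exp (-x)) := by gcongr
    _ = _ := by ring

lemma threshold_mono {C δ : ℝ} (hC : 0 < C) (hδ : 0 < δ) {s t : ℕ} (hs : 0 < s) (hst : s ≤ t) :
    threshold C δ s ≤ threshold C δ t := by
  have : (0 : ℝ) < s := by exact_mod_cast hs
  have h2 : (s : ℝ) ≤ t := by exact_mod_cast hst
  unfold threshold
  apply Real.log_le_log (by positivity)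
  gcongr

lemma threshold_pos {C δ : ℝ} (hC : 1 ≤ C) (hδ : δ ∈ Set.Ioo (0 : ℝ) 1) {t : ℕ} (ht : 0 < t) :
    0 < threshold C δ t := by
  have h1 : (1 : ℝ) ≤ t := by exact_mod_cast ht
  apply Real.log_pos
  rw [lt_div_iff₀ hδ.1]
  nlinarith [hδ.2]

/-- Comparison with the telescoping terms `1 / (n + 1) - 1 / (n + 2)`. -/
lemma tsum_one_div_succ_sq_le : ∑' n : ℕ, ENNReal.ofReal (1 / ((n : ℝ) + 2) ^ 2) ≤ 1 := by
  have h : ∀ N : ℕ, ∑ n ∈ Finset.range N, 1 / ((n : ℝ) + 2) ^ 2 ≤ 1 - 1 / ((N : ℝ) + 1) := by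
    intro N
    induction N with
    | zero => simp
    | succ N ih =>
      rw [Finset.sum_range_succ]
      have : 1 / ((N : ℝ) + 2) ^ 2 ≤ 1 / (N + 1) - 1 / (N + 2) := by
        rw [div_sub_div _ _ (by positivity) (by positivity), div_le_div_iff₀ (by positivity) (by positivity)]
        nlinarith
      push_cast
      have e : (N : ℝ) + 1 + 1 = N + 2 := by ring
      rw [e]
      linarith
  rw [ENNReal.tsum_eq_iSup_nat]
  refine iSup_le fun N => ?_
  rw [← ENNReal.ofReal_sum_of_nonneg (fun _ _ => by positivity)]
  refine ENNReal.ofReal_le_one.2 ((h N).trans ?_)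
  have : (0 : ℝ) ≤ 1 / ((N : ℝ) + 1) := by positivity
  linarith

/-- Once the number `n + 1` of observations of `k` is fixed, the required divergence is a fixed
level and tilting costs only the factor `2`. The round is then at least `n + 2`, so the terms are at
most `2 (δ / C) / (n + 2)²`, which sum to at most `2 δ / C`. Without observations there is no
deviation. -/
lemma prob_oneDev_le {F : Family} {C δ : ℝ} (hC : 1 ≤ C) (hδ : δ ∈ Set.Ioo (0 : ℝ) 1)
    {μ : Fin K → ℝ} (hμ : ∀ k, μ k ∈ F.means) (A : Algorithm K) (k : Fin K) :
    prob F μ {x | ∃ t, A.hist x t ∈ oneDev F μ (threshold C δ) k} ≤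
      ENNReal.ofReal (2 * (δ / C)) := by
  have hC0 : 0 < C := by linarith
  have hn : ∀ n : ℕ, prob F μ {x | ∃ t, A.hist x t ∈ {h | h ∈ oneDev F μ (threshold C δ) k ∧
      count h k = n + 1}} ≤ ENNReal.ofReal (2 * (δ / C)) * ENNReal.ofReal (1 / ((n : ℝ) + 2) ^ 2) := by
    intro n
    have hn1 : (0 : ℝ) < n + 1 := by positivity
    obtain ⟨W, hW, hW2, hWl⟩ := exists_tilt (hμ k) (threshold C δ (n + 2) / (n + 1))
    have := prob_exists_hist_mem_le F μ A {h | h ∈ oneDev F μ (threshold C δ) k ∧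
      count h k = n + 1} {k} (fun _ l => ENNReal.ofReal (Real.exp (-threshold C δ (n + 2))) * W l)
      (fun _ _ => hW.const_mul _) (by
        rintro h ⟨⟨hg, hh⟩, hcount⟩
        rw [Finset.prod_singleton, Finset.prod_singleton]
        have h1 := le_dExp_of_lt_kl (hg k) (hμ k) hh
        rw [hcount] at h1
        push_cast at h1
        have h2 : threshold C δ (n + 2) ≤ threshold C δ (roundNo h) := by
          refine threshold_mono hC0 hδ.1 (by lia) ?_
          have := count_lt_roundNo h k
          lia
        have h3 := hWl (obs k h) (by rw [← muHat_eq_listMean]; exact hg k) (Or.inr (by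
          rw [div_lt_iff₀ hn1, ← muHat_eq_listMean]
          linarith))
        rw [length_obs, hcount] at h3
        convert h3 using 5
        push_cast
        field_simp)
    refine this.trans ?_
    rw [Finset.prod_singleton, exp_neg_threshold hC0 hδ.1 (by lia)]
    have hδ0 := hδ.1
    refine (mul_le_mul_right hW2 _).trans (le_of_eq ?_)
    rw [← ENNReal.ofReal_mul (by positivity), show (2 : ℝ≥0∞) = ENNReal.ofReal 2 by simp,
      ← ENNReal.ofReal_mul (by positivity)]
    congr 1
    push_cast
    field_simp
  have hsub : {x | ∃ t, A.hist x t ∈ oneDev F μ (threshold C δ) k} ⊆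
      ⋃ n : ℕ, {x | ∃ t, A.hist x t ∈ {h | h ∈ oneDev F μ (threshold C δ) k ∧
        count h k = n + 1}} := by
    rintro x ⟨t, ht⟩
    have h0 : count (A.hist x t) k ≠ 0 := by
      intro h0
      have := ht.2
      rw [h0] at this
      simp at this
    obtain ⟨n, hn⟩ := Nat.exists_eq_succ_of_ne_zero h0
    exact Set.mem_iUnion.2 ⟨n, t, ht, hn⟩
  refine (measure_mono hsub).trans ((measure_iUnion_le _).trans
    ((ENNReal.tsum_le_tsum hn).trans ?_))
  rw [ENNReal.tsum_mul_left]
  exact (mul_le_mul_right tsum_one_div_succ_sq_le _).trans (by simp)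

/-! ### Poisson and binomial weights -/

/-- The Poisson weights. -/
def poi (x : ℝ) (a : ℕ) : ℝ := Real.exp (-x) * x ^ a / a.factorial

lemma poi_nonneg {x : ℝ} (hx : 0 ≤ x) (a : ℕ) : 0 ≤ poi x a := by unfold poi; positivity

lemma sum_poi_mul_poi (x y : ℝ) (c : ℕ) :
    ∑ v ∈ Finset.range (c + 1), poi x v * poi y (c - v) = poi (x + y) c := by
  unfold poi
  rw [add_pow, Finset.mul_sum, Finset.sum_div]
  refine Finset.sum_congr rfl fun v hv => ?_
  have hv' : v ≤ c := by simpa [Nat.lt_succ_iff] using hv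
  rw [Nat.cast_choose ℝ hv', neg_add, Real.exp_add]
  field_simp

lemma tsum_ofReal_poi {x : ℝ} (hx : 0 ≤ x) : ∑' a, ENNReal.ofReal (poi x a) = 1 := by
  have := Family.poisson.tsum_law_singleton x
  simp only [Family.law_poisson_singleton hx] at this
  exact this

/-- The likelihood of a list times the conditional probability that after `n` observations the sum
is `a`. -/
def hitLik (m : ℝ) (n a : ℕ) (l : List ℕ) : ℝ≥0∞ :=
  if l.length ≤ n ∧ l.sum ≤ a then
    seqLik .poisson m l * ENNReal.ofReal (poi ((n - l.length : ℕ) * m) (a - l.sum))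
  else 0

/-- A conditional probability is a martingale under the true law; one step is the convolution of two
Poisson laws. -/
lemma isSubLik_hitLik {m : ℝ} (hm : 0 < m) (n a : ℕ) : IsSubLik (hitLik m n a) := by
  intro l
  by_cases h : l.length + 1 ≤ n ∧ l.sum ≤ a
  · have h0 : ∀ v ∉ Finset.range (a - l.sum + 1), hitLik m n a (v :: l) = 0 := by
      intro v hv
      rw [hitLik, if_neg]
      simp only [Finset.mem_range, not_lt] at hv
      simp only [List.sum_cons]
      lia
    rw [tsum_eq_sum h0, hitLik, if_pos ⟨by lia, h.2⟩]
    have h1 : ∀ v ∈ Finset.range (a - l.sum + 1), hitLik m n a (v :: l) =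
        seqLik .poisson m l * ENNReal.ofReal (poi m v *
          poi ((n - (l.length + 1) : ℕ) * m) (a - l.sum - v)) := by
      intro v hv
      simp only [Finset.mem_range] at hv
      rw [hitLik, if_pos (by simp only [List.length_cons, List.sum_cons]; lia), seqLik_cons,
        Family.law_poisson_singleton hm.le, ENNReal.ofReal_mul (poi_nonneg hm.le _)]
      simp only [List.length_cons, List.sum_cons]
      rw [show a - (v + l.sum) = a - l.sum - v by lia]
      unfold poi
      ring
    rw [Finset.sum_congr rfl h1, ← Finset.mul_sum, ← ENNReal.ofReal_sum_of_nonneg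
      (fun v _ => mul_nonneg (poi_nonneg hm.le _) (poi_nonneg (by positivity) _)), sum_poi_mul_poi]
    refine mul_le_mul_right (le_of_eq ?_) _
    congr 2
    rw [show n - l.length = (n - (l.length + 1)) + 1 by lia]
    push_cast
    ring
  · have h0 : ∀ v, hitLik m n a (v :: l) = 0 := by
      intro v
      rw [hitLik, if_neg]
      simp only [List.sum_cons, List.length_cons]
      lia
    simp [h0]

/-- Adaptive sampling does not help: passing through prescribed counts with prescribed sums is no
more likely than obtaining these sums with sample sizes fixed in advance. -/
lemma prob_exists_hit_le {μ : Fin K → ℝ} (hμ : ∀ k, μ k ∈ Family.poisson.means)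
    (A : Algorithm K) {i j : Fin K} (hij : i ≠ j) (n₁ n₂ a b : ℕ) :
    prob .poisson μ {x | ∃ t, A.hist x t ∈ {h : History K | count h i = n₁ ∧ count h j = n₂ ∧
      (obs i h).sum = a ∧ (obs j h).sum = b}} ≤
      ENNReal.ofReal (poi (n₁ * μ i) a * poi (n₂ * μ j) b) := by
  have hi : 0 < μ i := hμ i
  have hj : 0 < μ j := hμ j
  have := prob_exists_hist_mem_le .poisson μ A {h : History K | count h i = n₁ ∧ count h j = n₂ ∧
      (obs i h).sum = a ∧ (obs j h).sum = b} {i, j}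
    (fun k l => if k = i then hitLik (μ i) n₁ a l else hitLik (μ j) n₂ b l)
    (by
      intro k _
      by_cases hk : k = i
      · simpa only [hk, if_true] using isSubLik_hitLik hi n₁ a
      · simpa only [hk, if_false] using isSubLik_hitLik hj n₂ b)
    (by
      rintro h ⟨h1, h2, h3, h4⟩
      rw [Finset.prod_pair hij, Finset.prod_pair hij, if_pos rfl, if_neg hij.symm]
      rw [← length_obs] at h1 h2
      have key : ∀ (m : ℝ) (l : List ℕ) (n a : ℕ), l.length = n → l.sum = a →
          seqLik .poisson m l ≤ hitLik m n a l := by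
        rintro m l n a rfl rfl
        simp [hitLik, poi]
      exact mul_le_mul' (key _ _ _ _ h1 h3) (key _ _ _ _ h2 h4))
  refine this.trans ?_
  rw [Finset.prod_pair hij, if_pos rfl, if_neg hij.symm, ENNReal.ofReal_mul
    (poi_nonneg (by positivity) _)]
  simp [hitLik]

lemma exp_natCast_mul_log_div (a : ℕ) {u v : ℝ} (hu : a ≠ 0 → 0 < u) (hv : 0 < v) :
    Real.exp (-(a * Real.log (u / v))) * u ^ a = v ^ a := by
  rcases Nat.eq_zero_or_pos a with rfl | ha
  · simp
  · have hu' := hu ha.ne'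
    rw [← mul_neg, ← Real.log_inv, inv_div, Real.exp_nat_mul, Real.exp_log (by positivity), div_pow]
    field_simp

/-- The binomial weight of `a` successes and `b` failures. -/
def binW (p : ℝ) (a b : ℕ) : ℝ := (a + b).choose a * (p ^ a * (1 - p) ^ b)

/-- The deviation of `a` successes and `b` failures from the success probability `p`. -/
def binQ (p : ℝ) (a b : ℕ) : ℝ :=
  a * Real.log ((a / (a + b) : ℝ) / p) + b * Real.log ((b / (a + b) : ℝ) / (1 - p))

lemma binW_nonneg {p : ℝ} (hp : p ∈ Set.Ioo (0 : ℝ) 1) (a b : ℕ) : 0 ≤ binW p a b := by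
  have h1 := hp.1
  have h2 : 0 < 1 - p := by linarith [hp.2]
  unfold binW; positivity

lemma exp_neg_binQ_mul {p : ℝ} (hp : p ∈ Set.Ioo (0 : ℝ) 1) (a b : ℕ) :
    Real.exp (-binQ p a b) * ((a / (a + b) : ℝ) ^ a * (b / (a + b) : ℝ) ^ b) =
      p ^ a * (1 - p) ^ b := by
  have h2 : 0 < 1 - p := by linarith [hp.2]
  rw [binQ, neg_add, Real.exp_add, mul_mul_mul_comm,
    exp_natCast_mul_log_div a (fun h => by positivity) hp.1,
    exp_natCast_mul_log_div b (fun h => by positivity) h2]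

lemma sum_binW_antidiagonal (p : ℝ) (n : ℕ) :
    ∑ x ∈ Finset.HasAntidiagonal.antidiagonal n, binW p x.1 x.2 = 1 := by
  have h := add_pow p (1 - p) n
  rw [add_sub_cancel, one_pow] at h
  rw [h, Finset.Nat.sum_antidiagonal_eq_sum_range_succ_mk]
  refine Finset.sum_congr rfl fun k hk => ?_
  have hk' : k ≤ n := by simpa [Nat.lt_succ_iff] using hk
  rw [binW]
  simp only [Nat.add_sub_cancel' hk']
  ring

/-- A Poisson pair with ordered rates, in terms of its total and of a binomial weight. -/
lemma poi_mul_poi_le {m₁ m₂ : ℝ} (h1 : 0 < m₁) (h12 : m₁ ≤ m₂) {n₁ n₂ : ℕ} (hn₁ : 1 ≤ n₁)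
    (hn₂ : 1 ≤ n₂) {a b : ℕ} (hab : b * n₁ ≤ a * n₂) :
    poi (n₁ * m₁) a * poi (n₂ * m₂) b ≤
      poi (n₁ * m₁ + n₂ * m₂) (a + b) * binW (n₁ / (n₁ + n₂)) a b := by
  have hn₁' : (0 : ℝ) < n₁ := by exact_mod_cast hn₁
  have hn₂' : (0 : ℝ) < n₂ := by exact_mod_cast hn₂
  have h2 : 0 < m₂ := by linarith
  set Λ := n₁ * m₁ + n₂ * m₂ with hΛ
  have hΛ0 : 0 < Λ := by positivity
  set p : ℝ := n₁ / (n₁ + n₂) with hp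
  set p' : ℝ := n₁ * m₁ / Λ with hp'
  have hq : 1 - p = n₂ / (n₁ + n₂) := by rw [hp]; field_simp; ring
  have hq' : 1 - p' = n₂ * m₂ / Λ := by rw [hp']; field_simp; rw [hΛ]; ring
  have hp0 : 0 < p := by positivity
  have hp'0 : 0 < p' := by positivity
  have hq0 : 0 < 1 - p := by rw [hq]; positivity
  have hq'0 : 0 < 1 - p' := by rw [hq']; positivity
  have hpp : p' ≤ p := by
    rw [hp', hp, div_le_div_iff₀ hΛ0 (by positivity), hΛ]
    nlinarith [mul_pos hn₁' hn₂']
  -- The true success probability `p'` is at most `p`, and `p` is at most the observed frequency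
  -- because the sample means are inverted; below the observed frequency the likelihood increases.
  -- The concave logarithm is bounded by its tangent at `p`.
  have hmono : p' ^ a * (1 - p') ^ b ≤ p ^ a * (1 - p) ^ b := by
    have hab' : (b : ℝ) * n₁ ≤ a * n₂ := by exact_mod_cast hab
    have l1 := Real.log_le_sub_one_of_pos (div_pos hp'0 hp0)
    have l2 := Real.log_le_sub_one_of_pos (div_pos hq'0 hq0)
    have hkey : (b : ℝ) / (1 - p) ≤ a / p := by
      rw [hq, hp, div_div_eq_mul_div, div_div_eq_mul_div, div_le_div_iff₀ hn₂' hn₁']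
      nlinarith [add_pos hn₁' hn₂']
    have hle : (a : ℝ) * Real.log (p' / p) + b * Real.log ((1 - p') / (1 - p)) ≤ 0 := by
      have e1 : (a : ℝ) * (p' / p - 1) + b * ((1 - p') / (1 - p) - 1) =
          (p - p') * (b / (1 - p) - a / p) := by field_simp; ring
      have : (p - p') * (b / (1 - p) - a / p) ≤ 0 :=
        mul_nonpos_of_nonneg_of_nonpos (by linarith) (by linarith)
      have := mul_le_mul_of_nonneg_left l1 (Nat.cast_nonneg (α := ℝ) a)
      have := mul_le_mul_of_nonneg_left l2 (Nat.cast_nonneg (α := ℝ) b)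
      linarith
    rw [← div_le_one (by positivity)]
    have : p' ^ a * (1 - p') ^ b / (p ^ a * (1 - p) ^ b) =
        Real.exp ((a : ℝ) * Real.log (p' / p) + b * Real.log ((1 - p') / (1 - p))) := by
      rw [Real.exp_add, Real.exp_nat_mul, Real.exp_nat_mul, Real.exp_log (by positivity),
        Real.exp_log (by positivity), div_pow p' p, div_pow (1 - p') (1 - p), div_mul_div_comm]
    rw [this]
    exact Real.exp_le_one_iff.2 hle
  have hsplit : poi (n₁ * m₁) a * poi (n₂ * m₂) b =
      poi Λ (a + b) * ((a + b).choose a * (p' ^ a * (1 - p') ^ b)) := by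
    rw [Nat.cast_choose ℝ (Nat.le_add_right a b), hq', hp', Nat.add_sub_cancel_left, div_pow, div_pow]
    unfold poi
    rw [hΛ, neg_add, Real.exp_add]
    field_simp
    ring
  rw [hsplit, binW]
  have := poi_nonneg hΛ0.le (a + b)
  gcongr

/-- The binomial Chernoff bound on a finite set of outcomes. -/
lemma sum_binW_le_exp {p : ℝ} (hp : p ∈ Set.Ioo (0 : ℝ) 1) {n : ℕ} {x : ℝ}
    {T : Finset (ℕ × ℕ)} (hT : T ⊆ Finset.HasAntidiagonal.antidiagonal n) (hn : 1 ≤ n)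
    (h : ∀ z ∈ T, p * n ≤ z.1 ∧ x ≤ binQ p z.1 z.2) :
    ∑ z ∈ T, binW p z.1 z.2 ≤ Real.exp (-x) := by
  rcases T.eq_empty_or_nonempty with rfl | hne
  · simp [Real.exp_nonneg]
  obtain ⟨⟨k, l⟩, hkT, hmin⟩ := Finset.exists_min_image T Prod.fst hne
  have hkl : k + l = n := by simpa using hT hkT
  have hn' : (0 : ℝ) < n := by exact_mod_cast hn
  obtain ⟨hk1, hk2⟩ := h _ hkT
  simp only at hk1 hk2
  have hp0 := hp.1
  have hp1 : 0 < 1 - p := by linarith [hp.2]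
  have hkl' : (k : ℝ) + l = n := by exact_mod_cast hkl
  set q : ℝ := k / n with hq
  have hq1 : 1 - q = l / n := by rw [hq]; field_simp; linarith
  have hk0 : 0 < k := by
    have : (0 : ℝ) < k := lt_of_lt_of_le (by positivity) hk1
    exact_mod_cast this
  have hq0 : 0 < q := by rw [hq]; positivity
  have hq1' : 0 ≤ 1 - q := by rw [hq1]; positivity
  have hpq : p ≤ q := by rw [hq, le_div_iff₀ hn']; exact hk1
  have hD : Real.exp (-binQ p k l) * (q ^ k * (1 - q) ^ l) = p ^ k * (1 - p) ^ l := by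
    rw [← exp_neg_binQ_mul hp k l, hq1, hq, hkl']
  have hpos : 0 < q ^ k * (1 - q) ^ l := by
    have h1 : 0 < p ^ k * (1 - p) ^ l := by positivity
    rw [← hD] at h1
    exact pos_of_mul_pos_right h1 (Real.exp_nonneg _)
  -- Change of measure to the frequency `q` of the least deviating outcome: the likelihood ratio of
  -- `p` to `q` decreases with the number of successes, so it is at most `exp (-binQ p k l)` on all
  -- of `T`.
  have hterm : ∀ z ∈ T, binW p z.1 z.2 ≤ Real.exp (-binQ p k l) * binW q z.1 z.2 := by
    rintro ⟨a, b⟩ hz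
    have hab : a + b = n := by simpa using hT hz
    have hka : k ≤ a := hmin _ hz
    obtain ⟨d, rfl⟩ := Nat.exists_eq_add_of_le hka
    have hl : l = b + d := by lia
    subst hl
    simp only [binW]
    rw [mul_left_comm (Real.exp _)]
    refine mul_le_mul_of_nonneg_left ?_ (by positivity)
    have h1 : (p * (1 - q)) ^ d ≤ (q * (1 - p)) ^ d :=
      pow_le_pow_left₀ (by positivity) (by nlinarith) d
    have h2 : p ^ (k + d) * (1 - p) ^ b * (q ^ k * (1 - q) ^ (b + d)) ≤
        q ^ (k + d) * (1 - q) ^ b * (p ^ k * (1 - p) ^ (b + d)) := by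
      have e1 : p ^ (k + d) * (1 - p) ^ b * (q ^ k * (1 - q) ^ (b + d)) =
          (p ^ k * q ^ k * (1 - p) ^ b * (1 - q) ^ b) * (p * (1 - q)) ^ d := by
        rw [mul_pow, pow_add, pow_add]; ring
      have e2 : q ^ (k + d) * (1 - q) ^ b * (p ^ k * (1 - p) ^ (b + d)) =
          (p ^ k * q ^ k * (1 - p) ^ b * (1 - q) ^ b) * (q * (1 - p)) ^ d := by
        rw [mul_pow, pow_add, pow_add]; ring
      rw [e1, e2]
      exact mul_le_mul_of_nonneg_left h1 (by positivity)
    rw [← hD] at h2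
    have h3 : p ^ (k + d) * (1 - p) ^ b * (q ^ k * (1 - q) ^ (b + d)) ≤
        (Real.exp (-binQ p k (b + d)) * (q ^ (k + d) * (1 - q) ^ b)) *
          (q ^ k * (1 - q) ^ (b + d)) := h2.trans (le_of_eq (by ring))
    exact le_of_mul_le_mul_right h3 hpos
  calc ∑ z ∈ T, binW p z.1 z.2 ≤ ∑ z ∈ T, Real.exp (-binQ p k l) * binW q z.1 z.2 :=
        Finset.sum_le_sum hterm
    _ ≤ ∑ z ∈ Finset.HasAntidiagonal.antidiagonal n, Real.exp (-binQ p k l) * binW q z.1 z.2 :=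
        Finset.sum_le_sum_of_subset_of_nonneg hT fun z _ _ => by unfold binW; positivity
    _ = Real.exp (-binQ p k l) := by rw [← Finset.mul_sum, sum_binW_antidiagonal, mul_one]
    _ ≤ Real.exp (-x) := Real.exp_le_exp.2 (by linarith)

/-- Geometric domination of the binomial tail. -/
lemma sum_binW_le_geom {p : ℝ} (hp : p ∈ Set.Ioo (0 : ℝ) 1) {k l : ℕ}
    (hkp : p * (k + l) < k) {T : Finset (ℕ × ℕ)} (hT : T ⊆ Finset.HasAntidiagonal.antidiagonal (k + l))
    (hmin : ∀ z ∈ T, k ≤ z.1) :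
    ∑ z ∈ T, binW p z.1 z.2 ≤ binW p k l * (k * (1 - p) / (k - p * (k + l))) := by
  have hp0 := hp.1
  have hp1 : 0 < 1 - p := by linarith [hp.2]
  have hk0 : (0 : ℝ) < k := lt_of_le_of_lt (by positivity) hkp
  -- `r` bounds the ratio of consecutive weights from `k` successes on; the hypothesis `p (k + l) <
  -- k` is what makes it less than `1`.
  set r : ℝ := l * p / (k * (1 - p)) with hr
  have hr0 : 0 ≤ r := by positivity
  have hr1 : r < 1 := by rw [hr, div_lt_one (by positivity)]; nlinarith
  have hstep : ∀ d b : ℕ, b + d = l → binW p (k + d) b ≤ r ^ d * binW p k l := by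
    intro d
    induction d with
    | zero => rintro b rfl; simp
    | succ d ih =>
      intro b hb
      have h1 := ih (b + 1) (by lia)
      have h2 : binW p (k + (d + 1)) b ≤ r * binW p (k + d) (b + 1) := by
        have hc : ((k + d + 1 + b).choose (k + d + 1) : ℝ) * (k + d + 1) =
            (k + d + (b + 1)).choose (k + d) * (b + 1) := by
          have := Nat.choose_succ_right_eq (k + d + 1 + b) (k + d)
          rw [show k + d + 1 + b - (k + d) = b + 1 by lia] at this
          rw [show k + d + (b + 1) = k + d + 1 + b by lia]
          exact_mod_cast this
        have hbl : (b : ℝ) + 1 ≤ l := by exact_mod_cast (by lia : b + 1 ≤ l)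
        unfold binW
        rw [show k + (d + 1) = k + d + 1 by lia]
        have hkd : (0 : ℝ) < k + d + 1 := by positivity
        have e1 : ((k + d + 1 + b).choose (k + d + 1) : ℝ) =
            (k + d + (b + 1)).choose (k + d) * (b + 1) / (k + d + 1) := by
          rw [← hc]; field_simp
        rw [e1, pow_succ p, pow_succ (1 - p)]
        have e2 : ((k + d + (b + 1)).choose (k + d) : ℝ) * (b + 1) / (k + d + 1) *
            (p ^ (k + d) * p * (1 - p) ^ b) = ((b + 1) * p / ((k + d + 1) * (1 - p))) *
            ((k + d + (b + 1)).choose (k + d) * (p ^ (k + d) * ((1 - p) ^ b * (1 - p)))) := by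
          field_simp
        rw [e2]
        refine mul_le_mul_of_nonneg_right ?_ (by positivity)
        rw [hr]
        have hd0 : (0 : ℝ) ≤ d := by positivity
        apply div_le_div₀ (by positivity) (by gcongr) (by positivity)
        gcongr
        linarith
      calc binW p (k + (d + 1)) b ≤ r * binW p (k + d) (b + 1) := h2
        _ ≤ r * (r ^ d * binW p k l) := by gcongr
        _ = r ^ (d + 1) * binW p k l := by ring
  have hW := binW_nonneg hp k l
  have hinj : Set.InjOn (fun z : ℕ × ℕ => z.1 - k) T := by
    rintro ⟨a, b⟩ hz ⟨a', b'⟩ hz' he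
    have h1 : a + b = k + l := by simpa using hT hz
    have h2 : a' + b' = k + l := by simpa using hT hz'
    have h3 := hmin _ hz
    have h4 := hmin _ hz'
    simp only at he h3 h4
    ext <;> simp only <;> lia
  calc ∑ z ∈ T, binW p z.1 z.2 ≤ ∑ z ∈ T, r ^ (z.1 - k) * binW p k l := by
        refine Finset.sum_le_sum ?_
        rintro ⟨a, b⟩ hz
        have h1 : a + b = k + l := by simpa using hT hz
        have h3 : k ≤ a := hmin _ hz
        have := hstep (a - k) b (by lia)
        rwa [Nat.add_sub_cancel' h3] at this
    _ = (∑ z ∈ T, r ^ (z.1 - k)) * binW p k l := by rw [Finset.sum_mul]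
    _ = (∑ d ∈ T.image (fun z => z.1 - k), r ^ d) * binW p k l := by
        rw [Finset.sum_image hinj]
    _ ≤ (1 - r)⁻¹ * binW p k l := by
        refine mul_le_mul_of_nonneg_right ?_ hW
        rw [← tsum_geometric_of_lt_one hr0 hr1]
        exact (summable_geometric_of_lt_one hr0 hr1).sum_le_tsum _ (fun _ _ => by positivity)
    _ = binW p k l * (k * (1 - p) / (k - p * (k + l))) := by
        rw [mul_comm, hr]
        congr 1
        have : (k : ℝ) - p * (k + l) ≠ 0 := by linarith
        have h3 : 1 - (l : ℝ) * p / (k * (1 - p)) = (k - p * (k + l)) / (k * (1 - p)) := by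
          field_simp; ring
        rw [h3, inv_div]

/-- The Stirling sequence decreases, so it is bounded by its first value `e / √2`. -/
lemma factorial_le_stirling {n : ℕ} (hn : 1 ≤ n) :
    (n.factorial : ℝ) ≤ Real.exp 1 * √n * (n / Real.exp 1) ^ n := by
  obtain ⟨m, rfl⟩ := Nat.exists_eq_add_of_le' hn
  have h := Stirling.stirlingSeq'_antitone (Nat.zero_le m)
  simp only [Function.comp, Nat.succ_eq_add_one, zero_add, Stirling.stirlingSeq_one] at h
  rw [Stirling.stirlingSeq, div_le_iff₀ (by positivity)] at h
  refine h.trans (le_of_eq ?_)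
  rw [Real.sqrt_mul (by norm_num)]
  have : (0 : ℝ) < √2 := by positivity
  field_simp

/-- The largest binomial weight. -/
lemma choose_mul_pow_le {k l : ℕ} (hk : 1 ≤ k) (hl : 1 ≤ l) :
    ((k + l).choose k : ℝ) * ((k / (k + l) : ℝ) ^ k * (l / (k + l) : ℝ) ^ l) ≤
      √((k + l) / (k * l)) := by
  have hk' : (0 : ℝ) < k := by exact_mod_cast hk
  have hl' : (0 : ℝ) < l := by exact_mod_cast hl
  have h1 := factorial_le_stirling (n := k + l) (by lia)
  have h2 := Stirling.le_factorial_stirling k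
  have h3 := Stirling.le_factorial_stirling l
  rw [Nat.cast_choose ℝ (Nat.le_add_right k l), Nat.add_sub_cancel_left]
  have he := Real.exp_pos 1
  -- One upper and two lower Stirling bounds leave the prefactor `e / (2 π)`, which may be dropped.
  have hπ : Real.exp 1 ≤ 2 * Real.pi := by
    have := Real.exp_one_lt_d9
    have := Real.pi_gt_three
    linarith
  have h4 : √(2 * Real.pi * k) * √(2 * Real.pi * l) = 2 * Real.pi * √(k * l) := by
    rw [← Real.sqrt_mul (by positivity), show 2 * Real.pi * k * (2 * Real.pi * l) =
      (2 * Real.pi) ^ 2 * (k * l) by ring, Real.sqrt_mul (by positivity),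
      Real.sqrt_sq (by positivity)]
  rw [Real.sqrt_div (by positivity)]
  have hs : 0 < √((k : ℝ) * l) := by positivity
  rw [div_mul_eq_mul_div, div_le_div_iff₀ (by positivity) hs]
  push_cast at h1
  calc ((k + l).factorial : ℝ) * ((k / (k + l) : ℝ) ^ k * (l / (k + l) : ℝ) ^ l) * √(k * l)
      ≤ (Real.exp 1 * √(k + l) * ((k + l) / Real.exp 1) ^ (k + l)) *
        ((k / (k + l) : ℝ) ^ k * (l / (k + l) : ℝ) ^ l) * √(k * l) := by gcongr
    _ = √(k + l) * (Real.exp 1 * √(k * l) * ((k / Real.exp 1) ^ k * (l / Real.exp 1) ^ l)) := by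
        have e : ((k + l : ℝ) / Real.exp 1) ^ (k + l) *
            ((k / (k + l) : ℝ) ^ k * (l / (k + l) : ℝ) ^ l) =
            (k / Real.exp 1) ^ k * (l / Real.exp 1) ^ l := by
          rw [pow_add, mul_mul_mul_comm, ← mul_pow, ← mul_pow]
          congr 2 <;> field_simp
        rw [← e]
        ring
    _ ≤ √(k + l) * (2 * Real.pi * √(k * l) * ((k / Real.exp 1) ^ k * (l / Real.exp 1) ^ l)) := by
        gcongr
    _ = √(k + l) * ((√(2 * Real.pi * k) * (k / Real.exp 1) ^ k) *
          (√(2 * Real.pi * l) * (l / Real.exp 1) ^ l)) := by rw [← h4]; ring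
    _ ≤ √(k + l) * (k.factorial * l.factorial) := by gcongr

/-- The weight at `n` is maximal for the rate `x = n`, where Stirling's formula applies; the bound
is uniform in the unknown rate. -/
lemma poi_le {x : ℝ} (hx : 0 ≤ x) {n : ℕ} (hn : 1 ≤ n) : poi x n ≤ 1 / √n := by
  have hn' : (0 : ℝ) < n := by exact_mod_cast hn
  have h2 := Stirling.le_factorial_stirling n
  have h1 : Real.exp (-x) * x ^ n ≤ (n / Real.exp 1) ^ n := by
    have h3 : x / n ≤ Real.exp (x / n - 1) := by linarith [Real.add_one_le_exp (x / n - 1)]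
    have h4 := pow_le_pow_left₀ (by positivity) h3 n
    rw [← Real.exp_nat_mul, div_pow, div_le_iff₀ (by positivity)] at h4
    have e : (n : ℝ) * (x / n - 1) = x - n := by field_simp
    rw [e] at h4
    calc Real.exp (-x) * x ^ n ≤ Real.exp (-x) * (Real.exp (x - n) * n ^ n) := by gcongr
      _ = (n / Real.exp 1) ^ n := by
        rw [← mul_assoc, ← Real.exp_add, div_pow, ← Real.exp_nat_mul]
        rw [show -x + (x - n) = -n by ring, Real.exp_neg]
        field_simp
  rw [poi, div_le_div_iff₀ (by positivity) (by positivity), one_mul]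
  have h5 : √(n : ℝ) ≤ √(2 * Real.pi * n) := by
    apply Real.sqrt_le_sqrt
    nlinarith [Real.pi_gt_three]
  calc Real.exp (-x) * x ^ n * √n ≤ (n / Real.exp 1) ^ n * √(2 * Real.pi * n) := by gcongr
    _ = √(2 * Real.pi * n) * (n / Real.exp 1) ^ n := by ring
    _ ≤ _ := h2

/-! ### Inversions of two Poisson slices -/

/-- The pairs of sums of observations for which the deviation exceeds `x`. -/
def devSet (p x : ℝ) : Set (ℕ × ℕ) :=
  {z | 1 ≤ z.1 + z.2 ∧ p * (z.1 + z.2) ≤ z.1 ∧ x < binQ p z.1 z.2}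

lemma tsum_prod_eq_tsum_antidiagonal (f : ℕ × ℕ → ℝ≥0∞) :
    ∑' z, f z = ∑' n : ℕ, ∑ z ∈ Finset.HasAntidiagonal.antidiagonal n, f z := by
  rw [← Finset.HasAntidiagonal.sigmaAntidiagonalEquivProd.tsum_eq f, ENNReal.tsum_sigma']
  refine tsum_congr fun n => ?_
  rw [tsum_fintype, ← Finset.sum_coe_sort (Finset.HasAntidiagonal.antidiagonal n) f]
  rfl

/-- Disintegration by the total `n`: a binomial bound that is uniform in `n` survives averaging over
the Poisson weights, whose sum is `1`. -/
lemma tsum_poi_mul_binW_le {p Λ B : ℝ} (hp : p ∈ Set.Ioo (0 : ℝ) 1) (hΛ : 0 ≤ Λ)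
    (R : Set (ℕ × ℕ)) (h : ∀ n (T : Finset (ℕ × ℕ)), T ⊆ Finset.HasAntidiagonal.antidiagonal n →
      (∀ z ∈ T, z ∈ R) → ∑ z ∈ T, binW p z.1 z.2 ≤ B) :
    ∑' z, R.indicator (fun z => ENNReal.ofReal (poi Λ (z.1 + z.2) * binW p z.1 z.2)) z ≤
      ENNReal.ofReal B := by
  classical
  rw [tsum_prod_eq_tsum_antidiagonal]
  have h1 : ∀ n : ℕ, ∑ z ∈ Finset.HasAntidiagonal.antidiagonal n,
      R.indicator (fun z => ENNReal.ofReal (poi Λ (z.1 + z.2) * binW p z.1 z.2)) z ≤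
      ENNReal.ofReal (poi Λ n) * ENNReal.ofReal B := by
    intro n
    have e : ∀ z ∈ Finset.HasAntidiagonal.antidiagonal n,
        R.indicator (fun z => ENNReal.ofReal (poi Λ (z.1 + z.2) * binW p z.1 z.2)) z =
        if z ∈ R then ENNReal.ofReal (poi Λ n * binW p z.1 z.2) else 0 := by
      intro z hz
      have : z.1 + z.2 = n := by simpa using hz
      simp only [Set.indicator_apply, this]
    rw [Finset.sum_congr rfl e, ← Finset.sum_filter, ← ENNReal.ofReal_sum_of_nonneg
      (fun z _ => mul_nonneg (poi_nonneg hΛ _) (binW_nonneg hp _ _)), ← Finset.mul_sum,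
      ENNReal.ofReal_mul (poi_nonneg hΛ _)]
    exact mul_le_mul_right (ENNReal.ofReal_le_ofReal (h n _ (Finset.filter_subset _ _)
      fun z hz => (Finset.mem_filter.1 hz).2)) _
  refine (ENNReal.tsum_le_tsum h1).trans ?_
  rw [ENNReal.tsum_mul_right, tsum_ofReal_poi hΛ, one_mul]

/-- The event that after `n₁` observations of slice `i` and `n₂` of slice `j` the sums lie in `R`. -/
def pairAt (i j : Fin K) (n₁ n₂ : ℕ) (R : Set (ℕ × ℕ)) : Set (History K) :=
  {h | count h i = n₁ ∧ count h j = n₂ ∧ ((obs i h).sum, (obs j h).sum) ∈ R}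

/-- After this bound the means enter only through the law of the total; the conditional success
probability is replaced by the proportion of measurements of `i`. -/
lemma prob_pairAt_le {μ : Fin K → ℝ} (hμ : ∀ k, μ k ∈ Family.poisson.means)
    (A : Algorithm K) {i j : Fin K} (hij : i ≠ j) (hlt : μ i < μ j) {n₁ n₂ : ℕ} (hn₁ : 1 ≤ n₁)
    (hn₂ : 1 ≤ n₂) (x : ℝ) :
    prob .poisson μ {o | ∃ t, A.hist o t ∈ pairAt i j n₁ n₂ (devSet (n₁ / (n₁ + n₂)) x)} ≤
      ∑' z, (devSet (n₁ / (n₁ + n₂)) x).indicator (fun z => ENNReal.ofReal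
        (poi (n₁ * μ i + n₂ * μ j) (z.1 + z.2) * binW (n₁ / (n₁ + n₂)) z.1 z.2)) z := by
  classical
  set R := devSet (n₁ / (n₁ + n₂)) x with hR
  have hsub : {o | ∃ t, A.hist o t ∈ pairAt i j n₁ n₂ R} ⊆ ⋃ z : ℕ × ℕ,
      if z ∈ R then {o | ∃ t, A.hist o t ∈ {h : History K | count h i = n₁ ∧ count h j = n₂ ∧
        (obs i h).sum = z.1 ∧ (obs j h).sum = z.2}} else ∅ := by
    rintro o ⟨t, h1, h2, h3⟩
    refine Set.mem_iUnion.2 ⟨((obs i (A.hist o t)).sum, (obs j (A.hist o t)).sum), ?_⟩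
    rw [if_pos h3]
    exact ⟨t, h1, h2, rfl, rfl⟩
  refine (measure_mono hsub).trans ((measure_iUnion_le _).trans (ENNReal.tsum_le_tsum fun z => ?_))
  by_cases hz : z ∈ R
  · rw [if_pos hz, Set.indicator_of_mem hz]
    refine (prob_exists_hit_le hμ A hij n₁ n₂ z.1 z.2).trans (ENNReal.ofReal_le_ofReal ?_)
    refine poi_mul_poi_le (hμ i) hlt.le hn₁ hn₂ ?_
    have hn₁' : (0 : ℝ) < n₁ := by exact_mod_cast hn₁
    have hn₂' : (0 : ℝ) < n₂ := by exact_mod_cast hn₂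
    have h2 := hz.2.1
    rw [div_mul_eq_mul_div, div_le_iff₀ (by positivity)] at h2
    have : (z.2 : ℝ) * n₁ ≤ z.1 * n₂ := by linarith
    exact_mod_cast this
  · rw [if_neg hz]
    simp

lemma prob_pairAt_devSet_le_exp {μ : Fin K → ℝ} (hμ : ∀ k, μ k ∈ Family.poisson.means)
    (A : Algorithm K) {i j : Fin K} (hij : i ≠ j) (hlt : μ i < μ j) {n₁ n₂ : ℕ} (hn₁ : 1 ≤ n₁)
    (hn₂ : 1 ≤ n₂) (x : ℝ) :
    prob .poisson μ {o | ∃ t, A.hist o t ∈ pairAt i j n₁ n₂ (devSet (n₁ / (n₁ + n₂)) x)} ≤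
      ENNReal.ofReal (Real.exp (-x)) := by
  have hn₁' : (0 : ℝ) < n₁ := by exact_mod_cast hn₁
  have hn₂' : (0 : ℝ) < n₂ := by exact_mod_cast hn₂
  have hi : 0 < μ i := hμ i
  have hj : 0 < μ j := hμ j
  have hp : (n₁ / (n₁ + n₂) : ℝ) ∈ Set.Ioo (0 : ℝ) 1 :=
    ⟨by positivity, by rw [div_lt_one (by positivity)]; linarith⟩
  refine (prob_pairAt_le hμ A hij hlt hn₁ hn₂ x).trans
    (tsum_poi_mul_binW_le hp (by positivity) _ fun n T hT hTR => ?_)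
  rcases T.eq_empty_or_nonempty with rfl | ⟨z, hz⟩
  · simp [Real.exp_nonneg]
  · refine sum_binW_le_exp hp hT ?_ fun z hz => ?_
    · have h1 : z.1 + z.2 = n := by simpa using hT hz
      rw [← h1]; exact (hTR z hz).1
    · have h1 : z.1 + z.2 = n := by simpa using hT hz
      refine ⟨?_, (hTR z hz).2.2.le⟩
      rw [← h1]; push_cast; exact (hTR z hz).2.1

/-- The Kullback-Leibler divergence is at most the chi-square divergence. A deviation of size `x`
thus puts the successes far from their mean, where the geometric tail bound is efficient. -/
lemma binQ_le_sq {p : ℝ} (hp : p ∈ Set.Ioo (0 : ℝ) 1) {a b : ℕ} (hab : 1 ≤ a + b) :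
    binQ p a b * ((a + b) * (p * (1 - p))) ≤ (a - p * (a + b)) ^ 2 := by
  have hp0 := hp.1
  have hp1 : 0 < 1 - p := by linarith [hp.2]
  have hn : (0 : ℝ) < a + b := by exact_mod_cast hab
  have key : ∀ (c : ℕ) (v : ℝ), 0 < v →
      (c : ℝ) * Real.log ((c / (a + b) : ℝ) / v) ≤ c * ((c / (a + b) : ℝ) / v - 1) := by
    intro c v hv
    rcases Nat.eq_zero_or_pos c with rfl | hc
    · simp
    · exact mul_le_mul_of_nonneg_left (Real.log_le_sub_one_of_pos (by positivity)) (by positivity)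
  have h1 := key a p hp0
  have h2 := key b (1 - p) hp1
  have h3 : ((a : ℝ) * ((a / (a + b) : ℝ) / p - 1) + b * ((b / (a + b) : ℝ) / (1 - p) - 1)) *
      ((a + b) * (p * (1 - p))) = (a - p * (a + b)) ^ 2 := by
    field_simp
    ring
  rw [← h3]
  refine mul_le_mul_of_nonneg_right ?_ (by positivity)
  unfold binQ
  linarith

lemma binW_le_exp_mul {p : ℝ} (hp : p ∈ Set.Ioo (0 : ℝ) 1) {a b : ℕ} :
    binW p a b = Real.exp (-binQ p a b) * (((a + b).choose a : ℝ) *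
      ((a / (a + b) : ℝ) ^ a * (b / (a + b) : ℝ) ^ b)) := by
  rw [binW, ← exp_neg_binQ_mul hp a b]; ring

/-- The binomial tail is smaller than its Chernoff bound if both outcomes are frequent. -/
lemma sum_binW_le_of_frequent {p x : ℝ} {y : ℕ} (hy : 2 ≤ y) (hp1 : 1 / (y : ℝ) ≤ p)
    (hp2 : p ≤ 1 - 1 / (y : ℝ)) (hx : (y : ℝ) ^ 16 ≤ x) {n : ℕ} {T : Finset (ℕ × ℕ)}
    (hT : T ⊆ Finset.HasAntidiagonal.antidiagonal n)
    (hTR : ∀ z ∈ T, z ∈ devSet p x ∧ y ^ 4 ≤ z.2) :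
    ∑ z ∈ T, binW p z.1 z.2 ≤ 2 / (y : ℝ) ^ 2 * Real.exp (-x) := by
  have hy' : (2 : ℝ) ≤ y := by exact_mod_cast hy
  have hy0 : (0 : ℝ) < y := by linarith
  have hyi : 0 < 1 / (y : ℝ) := by positivity
  have hp : p ∈ Set.Ioo (0 : ℝ) 1 := ⟨by linarith, by linarith⟩
  have hp0 := hp.1
  have hq0 : 0 < 1 - p := by linarith [hp.2]
  rcases T.eq_empty_or_nonempty with rfl | hne
  · simp; positivity
  obtain ⟨⟨k, l⟩, hkT, hmin⟩ := Finset.exists_min_image T Prod.fst hne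
  have hkl : k + l = n := by simpa using hT hkT
  obtain ⟨⟨h1, h2, h3⟩, h4⟩ := hTR _ hkT
  simp only at h1 h2 h3 h4
  have hx0 : 0 < x := lt_of_lt_of_le (by positivity) hx
  have hn : (0 : ℝ) < k + l := by exact_mod_cast h1
  have hl1 : 1 ≤ l := le_trans (Nat.one_le_pow _ _ (by lia)) h4
  have hl' : (y : ℝ) ^ 4 ≤ l := by exact_mod_cast h4
  have hl0 : (0 : ℝ) < l := by exact_mod_cast hl1
  have hsq := binQ_le_sq hp h1
  set D : ℝ := k - p * (k + l) with hD
  have hD2 : x * ((k + l) * (p * (1 - p))) < D ^ 2 :=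
    lt_of_lt_of_le (mul_lt_mul_of_pos_right h3 (by positivity)) hsq
  have hDpos : 0 < D := by
    rcases (show 0 ≤ D by rw [hD]; linarith).lt_or_eq with h | h
    · exact h
    · rw [← h] at hD2
      have : 0 ≤ x * ((k + l) * (p * (1 - p))) := by positivity
      linarith [show (0 : ℝ) ^ 2 = 0 by norm_num]
  have hk1 : 1 ≤ k := by
    by_contra hk
    have : k = 0 := by lia
    subst this
    have : 0 ≤ p * (((0 : ℕ) : ℝ) + l) := by positivity
    simp only [hD, Nat.cast_zero] at hDpos this
    linarith
  have hk0 : (0 : ℝ) < k := by exact_mod_cast hk1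
  rw [← hkl] at hT
  refine (sum_binW_le_geom hp (by rw [hD] at hDpos; linarith) hT (fun z hz => hmin z hz)).trans ?_
  rw [binW_le_exp_mul hp, ← hD]
  -- `E` is the gain over the Chernoff bound: the size of the largest binomial weight times the
  -- geometric factor of the tail.
  set E : ℝ := √((k + l) / (k * l)) * (k * (1 - p) / D) with hE
  have hE0 : 0 ≤ E := by positivity
  have hE2 : E ^ 2 ≤ 4 / (y : ℝ) ^ 4 := by
    have e1 : E ^ 2 = (k + l) * k * (1 - p) ^ 2 / (l * D ^ 2) := by
      rw [hE, mul_pow, Real.sq_sqrt (by positivity), div_pow]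
      field_simp
    rw [e1]
    -- If the failures reach half their mean, the chi-square bound makes `D` large relative to the
    -- standard deviation and `x p ≥ y^15` suffices. Otherwise `D` is at least half the mean number
    -- of failures, and `l ≥ y^4` suffices.
    by_cases hcase : (k + l) * (1 - p) / 2 ≤ (l : ℝ)
    · have e2 : (k + l) * k * (1 - p) ^ 2 / (l * D ^ 2) ≤
          (k + l) * k * (1 - p) ^ 2 / (((k + l) * (1 - p) / 2) *
            (x * ((k + l) * (p * (1 - p))))) := by
        gcongr
      have e3 : (k + l) * k * (1 - p) ^ 2 / (((k + l) * (1 - p) / 2) *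
            (x * ((k + l) * (p * (1 - p))))) = 2 * (k / (k + l)) * (1 / (x * p)) := by
        field_simp
      have e4 : (k : ℝ) / (k + l) ≤ 1 := by rw [div_le_one hn]; linarith
      have e5 : (y : ℝ) ^ 15 ≤ x * p := by
        calc (y : ℝ) ^ 15 = (y : ℝ) ^ 16 * (1 / y) := by field_simp
          _ ≤ x * p := by gcongr
      have e6 : 1 / (x * p) ≤ 1 / (y : ℝ) ^ 4 := by
        apply one_div_le_one_div_of_le (by positivity)
        exact (pow_le_pow_right₀ (by linarith) (by norm_num)).trans e5
      calc _ ≤ _ := e2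
        _ = 2 * (k / (k + l)) * (1 / (x * p)) := e3
        _ ≤ 2 * 1 * (1 / (y : ℝ) ^ 4) := by gcongr
        _ ≤ 4 / (y : ℝ) ^ 4 := by
          rw [mul_one_div]; gcongr; norm_num
    · push Not at hcase
      have hDge : (k + l) * (1 - p) / 2 ≤ D := by rw [hD]; linarith
      calc ((k : ℝ) + l) * k * (1 - p) ^ 2 / (l * D ^ 2)
          ≤ ((k : ℝ) + l) * (k + l) * (1 - p) ^ 2 / (l * ((k + l) * (1 - p) / 2) ^ 2) := by
            gcongr; linarith
        _ = 4 / (l : ℝ) := by field_simp; norm_num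
        _ ≤ 4 / (y : ℝ) ^ 4 := by gcongr
  have hEle : E ≤ 2 / (y : ℝ) ^ 2 := by
    refine le_of_sq_le_sq ?_ (by positivity)
    refine hE2.trans (le_of_eq ?_)
    rw [div_pow]; ring
  have hexp : Real.exp (-binQ p k l) ≤ Real.exp (-x) := Real.exp_le_exp.2 (by linarith)
  have hβ := choose_mul_pow_le hk1 hl1
  calc Real.exp (-binQ p k l) * (((k + l).choose k : ℝ) *
        ((k / (k + l) : ℝ) ^ k * (l / (k + l) : ℝ) ^ l)) * (k * (1 - p) / D)
      ≤ Real.exp (-x) * √((k + l) / (k * l)) * (k * (1 - p) / D) := by gcongr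
    _ = E * Real.exp (-x) := by rw [hE]; ring
    _ ≤ _ := by gcongr

/-- For `p` away from `0` and `1` the deviation per observed packet is bounded. A large deviation
therefore forces a large total. -/
lemma binQ_le_mul_log {p κ : ℝ} (hκ : 0 < κ) (h1 : κ ≤ p) (h2 : κ ≤ 1 - p) (a b : ℕ) :
    binQ p a b ≤ (a + b) * (1 / κ) := by
  have key : ∀ (c d : ℕ) (v : ℝ), κ ≤ v →
      (c : ℝ) * Real.log ((c / (c + d) : ℝ) / v) ≤ c * (1 / κ) := by
    intro c d v hv
    rcases Nat.eq_zero_or_pos c with rfl | hc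
    · simp
    · have hv0 : 0 < v := by linarith
      have hc' : (0 : ℝ) < c := by exact_mod_cast hc
      refine mul_le_mul_of_nonneg_left ?_ (by positivity)
      have h3 : (c / (c + d) : ℝ) ≤ 1 := by
        rw [div_le_one (by positivity)]
        have : (0 : ℝ) ≤ d := by positivity
        linarith
      calc Real.log ((c / (c + d) : ℝ) / v) ≤ (c / (c + d) : ℝ) / v - 1 :=
            Real.log_le_sub_one_of_pos (by positivity)
        _ ≤ 1 / v := by have : (c / (c + d) : ℝ) / v ≤ 1 / v := by gcongr
                        linarith
        _ ≤ 1 / κ := by gcongr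
  have ha := key a b p h1
  have hb := key b a (1 - p) h2
  rw [add_comm (b : ℝ) a] at hb
  unfold binQ
  linarith

/-- For a fixed small number of failures the weights decay geometrically. -/
lemma tsum_poi_mul_binW_le_of_rare {p x Λ : ℝ} (hΛ : 0 ≤ Λ) {y : ℕ} (hy : 2 ≤ y)
    (hp1 : 1 / (y : ℝ) ≤ p) (hp2 : p ≤ 1 - 1 / (y : ℝ)) (hx : (y : ℝ) ^ 16 ≤ x) {b : ℕ}
    (hb : b < y ^ 4) :
    ∑' a, (devSet p x).indicator (fun z => ENNReal.ofReal (poi Λ (z.1 + z.2) * binW p z.1 z.2))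
      (a, b) ≤ ENNReal.ofReal (2 / (y : ℝ) ^ 6 * Real.exp (-x)) := by
  classical
  have hy' : (2 : ℝ) ≤ y := by exact_mod_cast hy
  have hy0 : (0 : ℝ) < y := by linarith
  have hyi : 0 < 1 / (y : ℝ) := by positivity
  have hp : p ∈ Set.Ioo (0 : ℝ) 1 := ⟨by linarith, by linarith⟩
  have hp0 := hp.1
  by_cases hex : ∃ a, (a, b) ∈ devSet p x
  swap
  · push Not at hex
    have : ∀ a, (devSet p x).indicator
        (fun z => ENNReal.ofReal (poi Λ (z.1 + z.2) * binW p z.1 z.2)) (a, b) = 0 :=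
      fun a => Set.indicator_of_notMem (hex a) _
    simp [this]
  set k := Nat.find hex with hk
  have hkR : (k, b) ∈ devSet p x := Nat.find_spec hex
  have hmin : ∀ a, (a, b) ∈ devSet p x → k ≤ a := fun a ha => Nat.find_min' hex ha
  obtain ⟨h1, h2, h3⟩ := hkR
  simp only at h1 h2 h3
  -- The deviation exceeds `y^16` but is at most `y` per packet.
  have hσ : ∀ a, (a, b) ∈ devSet p x → (y : ℝ) ^ 15 ≤ a + b := by
    rintro a ⟨_, _, h⟩
    have hQ := binQ_le_mul_log hyi hp1 (by linarith) a b
    simp only at h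
    have h5 : (y : ℝ) ^ 15 * y ≤ (a + b) * y := by
      rw [one_div_one_div] at hQ
      calc (y : ℝ) ^ 15 * y = (y : ℝ) ^ 16 := by ring
        _ ≤ ((a : ℝ) + b) * y := by linarith
    exact le_of_mul_le_mul_right h5 hy0
  have hkσ := hσ k ⟨h1, h2, h3⟩
  have hb' : (b : ℝ) ≤ y ^ 4 := by exact_mod_cast hb.le
  have hy11 : (2 : ℝ) ^ 11 ≤ (y : ℝ) ^ 11 := pow_le_pow_left₀ (by norm_num) hy' 11
  have hbk : (b : ℝ) * (2 * y) ≤ k + 1 := by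
    have e1 : (y : ℝ) ^ 15 = y ^ 4 * y ^ 11 := by ring
    have e2 : (y : ℝ) ^ 10 * y = y ^ 11 := by ring
    have hy10 : (2 : ℝ) ^ 10 ≤ (y : ℝ) ^ 10 := pow_le_pow_left₀ (by norm_num) hy' 10
    have h4 : 0 < (y : ℝ) ^ 4 := by positivity
    have e3 : (b : ℝ) * (2 * y) ≤ y ^ 4 * (2 * y) := by gcongr
    have e4 : (y : ℝ) ^ 4 * (2 * y) + y ^ 4 ≤ y ^ 4 * y ^ 11 := by
      have : 2 * (y : ℝ) + 1 ≤ y ^ 11 := by rw [← e2]; nlinarith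
      nlinarith
    linarith
  -- The ratio of consecutive weights is `p (1 + b / (a + 1))`. As `b` is tiny compared with `a`, it
  -- is at most `(1 - 1 / y)(1 + 1 / (2 y))`.
  set r : ℝ := 1 - 1 / (2 * y) with hr
  have hr0 : 0 ≤ r := by
    have : 1 / (2 * (y : ℝ)) ≤ 1 := by rw [div_le_one (by positivity)]; linarith
    linarith
  have hr1 : r < 1 := by
    have : 0 < 1 / (2 * (y : ℝ)) := by positivity
    linarith
  have hstep : ∀ d : ℕ, binW p (k + d) b ≤ r ^ d * binW p k b := by
    intro d
    induction d with
    | zero => simp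
    | succ d ih =>
      have h2 : binW p (k + (d + 1)) b ≤ r * binW p (k + d) b := by
        have hc : ((k + d + 1 + b).choose (k + d + 1) : ℝ) * (k + d + 1) =
            (k + d + b + 1) * (k + d + b).choose (k + d) := by
          have := Nat.add_one_mul_choose_eq (k + d + b) (k + d)
          rw [show k + d + 1 + b = k + d + b + 1 by lia]
          exact_mod_cast this.symm
        have hkd : (0 : ℝ) < k + d + 1 := by positivity
        have e1 : ((k + d + 1 + b).choose (k + d + 1) : ℝ) =
            (k + d + b + 1) * (k + d + b).choose (k + d) / (k + d + 1) := by
          rw [← hc]; field_simp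
        unfold binW
        rw [show k + (d + 1) = k + d + 1 by lia, e1, pow_succ]
        have hq0 : 0 < 1 - p := by linarith [hp.2]
        have e2 : (k + d + b + 1 : ℝ) * (k + d + b).choose (k + d) / (k + d + 1) *
            (p ^ (k + d) * p * (1 - p) ^ b) = (p * ((k + d + b + 1) / (k + d + 1))) *
            ((k + d + b).choose (k + d) * (p ^ (k + d) * (1 - p) ^ b)) := by
          field_simp
        rw [e2]
        refine mul_le_mul_of_nonneg_right ?_ (by positivity)
        have e3 : (k + d + b + 1 : ℝ) / (k + d + 1) ≤ 1 + 1 / (2 * y) := by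
          rw [div_le_iff₀ hkd, add_mul, one_mul, div_mul_eq_mul_div, one_mul]
          have : (b : ℝ) ≤ (k + d + 1) / (2 * y) := by
            rw [le_div_iff₀ (by positivity)]
            have : (0 : ℝ) ≤ d := by positivity
            linarith
          linarith
        have hyc : 0 ≤ 1 - 1 / (y : ℝ) := by linarith
        calc p * ((k + d + b + 1) / (k + d + 1)) ≤ (1 - 1 / y) * (1 + 1 / (2 * y)) := by
              gcongr
          _ ≤ r := by
              rw [hr]
              have : 1 / (2 * (y : ℝ)) = 1 / y / 2 := by field_simp
              rw [this]
              nlinarith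
      calc binW p (k + (d + 1)) b ≤ r * binW p (k + d) b := h2
        _ ≤ r * (r ^ d * binW p k b) := by gcongr
        _ = r ^ (d + 1) * binW p k b := by ring
  have hWk : binW p k b ≤ Real.exp (-x) := by
    have h5 := sum_binW_le_exp hp (n := k + b) (x := x) (T := {(k, b)}) (by simp) h1 (by
      intro z hz
      rw [Finset.mem_singleton] at hz
      subst hz
      push_cast
      exact ⟨h2, h3.le⟩)
    simpa using h5
  have hWk0 := binW_nonneg hp k b
  -- With few failures the gain comes from the Poisson weight of the total, at most `1 / √(y^15)`;
  -- the geometric series then costs the factor `2 y`.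
  have hpoi : ∀ a, (a, b) ∈ devSet p x → poi Λ (a + b) ≤ 1 / (y : ℝ) ^ 7 := by
    intro a ha
    refine (poi_le hΛ ha.1).trans ?_
    apply one_div_le_one_div_of_le (by positivity)
    apply Real.le_sqrt_of_sq_le
    push_cast
    refine le_trans ?_ (hσ a ha)
    rw [← pow_mul]
    exact pow_le_pow_right₀ (by linarith) (by norm_num)
  have hterm : ∀ a, (devSet p x).indicator
      (fun z => ENNReal.ofReal (poi Λ (z.1 + z.2) * binW p z.1 z.2)) (a, b) ≤
      if k ≤ a then ENNReal.ofReal (1 / (y : ℝ) ^ 7 * Real.exp (-x)) *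
        ENNReal.ofReal r ^ (a - k) else 0 := by
    intro a
    by_cases ha : (a, b) ∈ devSet p x
    · rw [Set.indicator_of_mem ha, if_pos (hmin a ha), ← ENNReal.ofReal_pow hr0,
        ← ENNReal.ofReal_mul (by positivity)]
      refine ENNReal.ofReal_le_ofReal ?_
      have h6 := hstep (a - k)
      rw [Nat.add_sub_cancel' (hmin a ha)] at h6
      calc poi Λ (a + b) * binW p a b ≤ 1 / (y : ℝ) ^ 7 * (r ^ (a - k) * Real.exp (-x)) := by
            refine mul_le_mul (hpoi a ha) (h6.trans ?_) (binW_nonneg hp _ _) (by positivity)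
            gcongr
        _ = _ := by ring
    · rw [Set.indicator_of_notMem ha]
      exact zero_le
  refine (ENNReal.tsum_le_tsum hterm).trans ?_
  have hinj : Function.Injective fun d : ℕ => k + d := add_right_injective k
  rw [← hinj.tsum_eq (by
    intro a ha
    rw [Function.mem_support] at ha
    have : k ≤ a := by
      by_contra hcon
      exact ha (if_neg hcon)
    exact ⟨a - k, by simp only; lia⟩)]
  have e7 : ∀ d : ℕ, (if k ≤ k + d then ENNReal.ofReal (1 / (y : ℝ) ^ 7 * Real.exp (-x)) *
        ENNReal.ofReal r ^ (k + d - k) else 0) =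
      ENNReal.ofReal (1 / (y : ℝ) ^ 7 * Real.exp (-x)) * ENNReal.ofReal r ^ d := by
    intro d
    rw [if_pos (by lia), Nat.add_sub_cancel_left]
  simp only [e7]
  rw [ENNReal.tsum_mul_left, ENNReal.tsum_geometric, ← ENNReal.ofReal_one,
    ← ENNReal.ofReal_sub _ hr0, ← ENNReal.ofReal_inv_of_pos (by linarith),
    ← ENNReal.ofReal_mul (by positivity)]
  refine ENNReal.ofReal_le_ofReal (le_of_eq ?_)
  rw [hr, show (1 : ℝ) - (1 - 1 / (2 * y)) = 1 / (2 * y) by ring, one_div (2 * (y : ℝ)), inv_inv]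
  field_simp

/-- Outcomes with at least `y^4` packets on slice `j` gain through the binomial weights. The fewer
than `y^4` packets that remain possible contribute at most `2 / y^6` times the Chernoff bound for
each number, hence `2 / y²` together. -/
lemma prob_pairAt_devSet_le_of_balanced {μ : Fin K → ℝ} (hμ : ∀ k, μ k ∈ Family.poisson.means)
    (A : Algorithm K) {i j : Fin K} (hij : i ≠ j) (hlt : μ i < μ j) {n₁ n₂ : ℕ} (hn₁ : 1 ≤ n₁)
    (hn₂ : 1 ≤ n₂) {x : ℝ} {y : ℕ} (hy : 2 ≤ y) (hp1 : 1 / (y : ℝ) ≤ n₁ / (n₁ + n₂))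
    (hp2 : (n₁ / (n₁ + n₂) : ℝ) ≤ 1 - 1 / (y : ℝ)) (hx : (y : ℝ) ^ 16 ≤ x) :
    prob .poisson μ {o | ∃ t, A.hist o t ∈ pairAt i j n₁ n₂ (devSet (n₁ / (n₁ + n₂)) x)} ≤
      ENNReal.ofReal (4 / (y : ℝ) ^ 2 * Real.exp (-x)) := by
  classical
  have hn₁' : (0 : ℝ) < n₁ := by exact_mod_cast hn₁
  have hn₂' : (0 : ℝ) < n₂ := by exact_mod_cast hn₂
  have hy0 : (0 : ℝ) < y := by exact_mod_cast (by lia : 0 < y)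
  have hi : 0 < μ i := hμ i
  have hj : 0 < μ j := hμ j
  have hΛ : 0 ≤ (n₁ : ℝ) * μ i + n₂ * μ j := by positivity
  have hp : (n₁ / (n₁ + n₂) : ℝ) ∈ Set.Ioo (0 : ℝ) 1 :=
    ⟨by positivity, by rw [div_lt_one (by positivity)]; linarith⟩
  refine (prob_pairAt_le hμ A hij hlt hn₁ hn₂ x).trans ?_
  set p : ℝ := n₁ / (n₁ + n₂) with hpdef
  set Λ : ℝ := (n₁ : ℝ) * μ i + n₂ * μ j with hΛdef
  set f : ℕ × ℕ → ℝ≥0∞ := fun z => ENNReal.ofReal (poi Λ (z.1 + z.2) * binW p z.1 z.2) with hf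
  have hsplit : ∀ z, (devSet p x).indicator f z ≤
      {z | z ∈ devSet p x ∧ y ^ 4 ≤ z.2}.indicator f z +
        if z.2 < y ^ 4 then (devSet p x).indicator f z else 0 := by
    intro z
    by_cases hz : z ∈ devSet p x
    · by_cases hzy : z.2 < y ^ 4
      · rw [if_pos hzy]; exact le_add_self
      · rw [Set.indicator_of_mem hz, Set.indicator_of_mem (show z ∈ {z | z ∈ devSet p x ∧
          y ^ 4 ≤ z.2} from ⟨hz, not_lt.1 hzy⟩)]
        exact le_self_add
    · rw [Set.indicator_of_notMem hz]; exact zero_le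
  refine (ENNReal.tsum_le_tsum hsplit).trans ?_
  rw [ENNReal.tsum_add]
  have h1 : ∑' z, {z | z ∈ devSet p x ∧ y ^ 4 ≤ z.2}.indicator f z ≤
      ENNReal.ofReal (2 / (y : ℝ) ^ 2 * Real.exp (-x)) :=
    tsum_poi_mul_binW_le hp hΛ _ fun n T hT hTR => sum_binW_le_of_frequent hy hp1 hp2 hx hT hTR
  have h2 : ∑' z : ℕ × ℕ, (if z.2 < y ^ 4 then (devSet p x).indicator f z else 0) ≤
      ENNReal.ofReal (2 / (y : ℝ) ^ 2 * Real.exp (-x)) := by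
    rw [ENNReal.tsum_prod', ENNReal.tsum_comm]
    have h3 : ∀ b ∉ Finset.range (y ^ 4), ∑' a : ℕ,
        (if b < y ^ 4 then (devSet p x).indicator f (a, b) else 0) = 0 := by
      intro b hb
      have : ¬ b < y ^ 4 := by simpa using hb
      simp [this]
    rw [tsum_eq_sum h3]
    calc _ ≤ ∑ b ∈ Finset.range (y ^ 4), ENNReal.ofReal (2 / (y : ℝ) ^ 6 * Real.exp (-x)) := by
          refine Finset.sum_le_sum fun b hb => ?_
          have hb' : b < y ^ 4 := by simpa using hb
          simp only [hb', if_true]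
          exact tsum_poi_mul_binW_le_of_rare hΛ hy hp1 hp2 hx hb'
      _ = _ := by
          rw [Finset.sum_const, Finset.card_range, nsmul_eq_mul, ← ENNReal.ofReal_natCast,
            ← ENNReal.ofReal_mul (by positivity)]
          congr 1
          push_cast
          field_simp
  refine (add_le_add h1 h2).trans (le_of_eq ?_)
  rw [← ENNReal.ofReal_add (by positivity) (by positivity)]
  congr 1
  ring

lemma natCast_mul_dExp_poisson (n a : ℕ) {m : ℝ} (hm : 0 < m) (hn : 1 ≤ n) :
    (n : ℝ) * Family.poisson.dExp (a / n) m = a * Real.log (a / n / m) - a + n * m := by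
  have hn' : (0 : ℝ) < n := by exact_mod_cast hn
  have h1 : (a : ℝ) * Real.log (a / n / m) = a * (Real.log (a / n) - Real.log m) := by
    rcases Nat.eq_zero_or_pos a with rfl | ha
    · simp
    · have ha' : (0 : ℝ) < a := by exact_mod_cast ha
      rw [Real.log_div (by positivity) hm.ne']
  rw [h1]
  simp only [Family.dExp, Family.conj, Family.natParam, Family.logPart]
  field_simp
  ring

/-- The common alternative is taken to be the pooled mean `m`, which is allowed as it is at most the
sample mean of `i`, below `g`. The terms linear in the sums cancel and what remains is the binomial
deviation `binQ` at the proportion of measurements of `i`. -/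
lemma pairDev_poisson_subset {C δ : ℝ} (hC : 1 ≤ C) (hδ : δ ∈ Set.Ioo (0 : ℝ) 1)
    {μ : Fin K → ℝ} (hμ : ∀ k, μ k ∈ Family.poisson.means) {i j : Fin K} (hij : i ≠ j)
    {h : History K} (hh : h ∈ pairDev .poisson μ (threshold C δ) i j) :
    1 ≤ count h i ∧ 1 ≤ count h j ∧
    ((obs i h).sum, (obs j h).sum) ∈ devSet (count h i / (count h i + count h j))
      (threshold C δ (count h i + count h j + 1)) ∧
    threshold C δ (count h i + count h j + 1) <
      count h i * Family.poisson.dExp (muHat h i) (μ i) +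
        count h j * Family.poisson.dExp (muHat h j) (μ j) := by
  obtain ⟨hg, hle, hdev, g, hgi, hgm⟩ := hh
  have hxr := threshold_mono (C := C) (δ := δ) (by linarith) hδ.1 (by lia)
    (count_add_count_lt_roundNo h hij)
  have hx0 := threshold_pos hC hδ (t := roundNo h) (by simp [roundNo])
  set x := threshold C δ (roundNo h) with hx
  have hgm' : ∀ m, 0 < m → m < g → x < count h i * Family.poisson.dExp (muHat h i) m +
      count h j * Family.poisson.dExp (muHat h j) m := fun m hm hmg =>
    le_dExp_of_lt_kl_add (hg i) hm (hg j) hm (hgm m hm hmg)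
  have hmi : 0 ≤ muHat h i := hg i
  have hmj : 0 ≤ muHat h j := hg j
  -- If both sample means vanished, a common mean `m` would cost `(n_i + n_j) m`; for `m` small
  -- enough this is at most the threshold.
  have hipos : 0 < muHat h i := by
    rcases hmi.lt_or_eq with hlt | heq
    · exact hlt
    · exfalso
      have hj0 : muHat h j = 0 := by linarith
      rw [← heq] at hgi
      set N : ℝ := count h i + count h j + 1 with hN
      have hN0 : 0 < N := by positivity
      have h1 := hgm' (min (g / 2) (x / N)) (by positivity)
        (lt_of_le_of_lt (min_le_left _ _) (by linarith))
      rw [← heq, hj0] at h1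
      simp only [Family.dExp, Family.conj, Family.natParam, Family.logPart, zero_mul, sub_zero,
        zero_add] at h1
      have h2 : min (g / 2) (x / N) * N ≤ x :=
        (mul_le_mul_of_nonneg_right (min_le_right _ _) hN0.le).trans (by field_simp; rfl)
      have h3 : 0 < min (g / 2) (x / N) := by positivity
      rw [hN] at h2
      nlinarith
  have hni : 1 ≤ count h i := by
    by_contra hcon
    have : count h i = 0 := by lia
    rw [muHat, this] at hipos
    simp at hipos
  -- If `j` was never measured, the sample mean of `i` is a common alternative of cost zero.
  have hnj : 1 ≤ count h j := by
    by_contra hcon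
    have h0 : count h j = 0 := by lia
    have h1 := hgm' _ hipos hgi
    rw [h0, Family.dExp_self] at h1
    simp at h1
    linarith
  have hni' : (0 : ℝ) < count h i := by exact_mod_cast hni
  have hnj' : (0 : ℝ) < count h j := by exact_mod_cast hnj
  have hmi_eq : muHat h i = ((obs i h).sum : ℕ) / count h i := by
    rw [muHat_eq_listMean, listMean, length_obs]
  have hmj_eq : muHat h j = ((obs j h).sum : ℕ) / count h j := by
    rw [muHat_eq_listMean, listMean, length_obs]
  set a := (obs i h).sum
  set b := (obs j h).sum
  set n₁ := count h i
  set n₂ := count h j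
  have ha : 0 < (a : ℝ) := by
    rw [hmi_eq] at hipos
    by_contra hcon
    have : (a : ℝ) / n₁ ≤ 0 := div_nonpos_of_nonpos_of_nonneg (not_lt.1 hcon) hni'.le
    linarith
  have hb : (0 : ℝ) ≤ b := by positivity
  have hba : (b : ℝ) * n₁ ≤ a * n₂ := by
    rw [hmi_eq, hmj_eq, div_le_div_iff₀ hnj' hni'] at hle
    exact hle
  set m : ℝ := (a + b) / (n₁ + n₂) with hm
  have hm0 : 0 < m := by positivity
  have hmg : m < g := by
    refine lt_of_le_of_lt ?_ hgi
    rw [hmi_eq, hm, div_le_div_iff₀ (by positivity) hni']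
    linarith
  have hkey := hgm' m hm0 hmg
  rw [hmi_eq, hmj_eq, natCast_mul_dExp_poisson _ _ hm0 hni, natCast_mul_dExp_poisson _ _ hm0 hnj]
    at hkey
  refine ⟨hni, hnj, ⟨?_, ?_, ?_⟩, ?_⟩
  · have : 0 < a := by exact_mod_cast ha
    simp only; lia
  · simp only
    rw [div_mul_eq_mul_div, div_le_iff₀ (by positivity)]
    linarith
  · refine lt_of_le_of_lt hxr (hkey.trans_le (le_of_eq ?_))
    have e1 : (a : ℝ) / n₁ / m = a / (a + b) / (n₁ / (n₁ + n₂)) := by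
      rw [hm]; field_simp
    have e2 : (b : ℝ) / n₂ / m = b / (a + b) / (1 - n₁ / (n₁ + n₂)) := by
      have : (1 : ℝ) - n₁ / (n₁ + n₂) = n₂ / (n₁ + n₂) := by field_simp; ring
      rw [this, hm]; field_simp
    have e3 : (n₁ : ℝ) * m + n₂ * m = a + b := by rw [hm]; field_simp
    simp only [binQ]
    rw [e1, e2]
    linarith
  · exact lt_of_le_of_lt hxr (le_dExp_of_lt_kl_add (hg i) (hμ i) (hg j) (hμ j) hdev)

/-- The histories in `pairDev` with `s` observations of the two slices. -/
def pairDevAt (μ : Fin K → ℝ) (C δ : ℝ) (i j : Fin K) (s : ℕ) : Set (History K) :=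
  {h | h ∈ pairDev .poisson μ (threshold C δ) i j ∧ count h i + count h j = s}

lemma prob_pairDevAt_le_sum {C δ : ℝ} (hC : 1 ≤ C) (hδ : δ ∈ Set.Ioo (0 : ℝ) 1)
    {μ : Fin K → ℝ} (hμ : ∀ k, μ k ∈ Family.poisson.means) (A : Algorithm K) {i j : Fin K}
    (hij : i ≠ j) (s : ℕ) :
    prob .poisson μ {o | ∃ t, A.hist o t ∈ pairDevAt μ C δ i j s} ≤
      ∑ n ∈ Finset.Ioo 0 s, prob .poisson μ {o | ∃ t, A.hist o t ∈
        pairAt i j n (s - n) (devSet (n / (n + (s - n : ℕ))) (threshold C δ (s + 1)))} := by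
  refine le_trans (measure_mono ?_) (measure_biUnion_finset_le _ _)
  rintro o ⟨t, hd, hs⟩
  obtain ⟨h1, h2, h3, _⟩ := pairDev_poisson_subset hC hδ hμ hij hd
  have e : s - count (A.hist o t) i = count (A.hist o t) j := by lia
  refine Set.mem_biUnion (x := count (A.hist o t) i) (by simp; lia) ⟨t, rfl, e.symm, ?_⟩
  rw [e]
  rw [hs] at h3
  exact h3

lemma sum_Ioo_const_le {s : ℕ} {e : ℝ} (he : 0 ≤ e) :
    ∑ _n ∈ Finset.Ioo 0 s, ENNReal.ofReal (e / (s + 1 : ℝ) ^ 2) ≤ ENNReal.ofReal (e * (1 / (s + 1 : ℝ))) := by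
  rw [Finset.sum_const, Nat.card_Ioo, nsmul_eq_mul, ← ENNReal.ofReal_natCast,
    ← ENNReal.ofReal_mul (by positivity)]
  refine ENNReal.ofReal_le_ofReal ?_
  have h1 : ((s - 0 - 1 : ℕ) : ℝ) ≤ s + 1 := by
    have : s - 0 - 1 ≤ s + 1 := by lia
    exact_mod_cast this
  calc ((s - 0 - 1 : ℕ) : ℝ) * (e / (s + 1 : ℝ) ^ 2) ≤ (s + 1) * (e / (s + 1 : ℝ) ^ 2) := by gcongr
    _ = _ := by field_simp

/-- There are fewer than `s + 1` splits and each costs `(δ / C) / (s + 1)²`. The resulting harmonic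
terms are not summable over `s`, which is why the next two bounds are needed. -/
lemma prob_pairDevAt_le {C δ : ℝ} (hC : 1 ≤ C) (hδ : δ ∈ Set.Ioo (0 : ℝ) 1)
    {μ : Fin K → ℝ} (hμ : ∀ k, μ k ∈ Family.poisson.means) (A : Algorithm K) {i j : Fin K}
    (hij : i ≠ j) (hlt : μ i < μ j) (s : ℕ) :
    prob .poisson μ {o | ∃ t, A.hist o t ∈ pairDevAt μ C δ i j s} ≤
      ENNReal.ofReal (δ / C * (1 / (s + 1 : ℝ))) := by
  have hδ0 := hδ.1
  refine (prob_pairDevAt_le_sum hC hδ hμ A hij s).trans (le_trans (Finset.sum_le_sum fun n hn => ?_)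
    (sum_Ioo_const_le (by positivity)))
  rw [Finset.mem_Ioo] at hn
  refine (prob_pairAt_devSet_le_exp hμ A hij hlt hn.1 (by lia) _).trans (le_of_eq ?_)
  rw [exp_neg_threshold (by linarith) hδ.1 (by lia)]
  push_cast; rfl

lemma card_filter_mul_lt_le {y : ℕ} (hy : 1 ≤ y) (s : ℕ) :
    (((Finset.Ioo 0 s).filter fun n => y * n < s).card : ℝ) ≤ s / y := by
  have hsub : ((Finset.Ioo 0 s).filter fun n => y * n < s) ⊆ Finset.Ioc 0 (s / y) := by
    intro n hn
    rw [Finset.mem_filter, Finset.mem_Ioo] at hn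
    rw [Finset.mem_Ioc]
    exact ⟨hn.1.1, (Nat.le_div_iff_mul_le hy).2 (by nlinarith [hn.2])⟩
  have h1 := Finset.card_le_card hsub
  rw [Nat.card_Ioc, Nat.sub_zero] at h1
  calc (((Finset.Ioo 0 s).filter fun n => y * n < s).card : ℝ) ≤ ((s / y : ℕ) : ℝ) := by
        exact_mod_cast h1
    _ ≤ s / y := Nat.cast_div_le

/-- At most `2 s / y` splits give one of the slices a share below `1 / y`; they keep the plain
Chernoff bound. The others gain `4 / y² ≤ 1 / y`, so the total gain is `3 / y`. -/
lemma prob_pairDevAt_le_of_pow_le {C δ : ℝ} (hC : 1 ≤ C) (hδ : δ ∈ Set.Ioo (0 : ℝ) 1)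
    {μ : Fin K → ℝ} (hμ : ∀ k, μ k ∈ Family.poisson.means) (A : Algorithm K) {i j : Fin K}
    (hij : i ≠ j) (hlt : μ i < μ j) (s : ℕ) {y : ℕ} (hy : 4 ≤ y)
    (hx : (y : ℝ) ^ 16 ≤ threshold C δ (s + 1)) :
    prob .poisson μ {o | ∃ t, A.hist o t ∈ pairDevAt μ C δ i j s} ≤
      ENNReal.ofReal (δ / C * (3 / y * (1 / (s + 1 : ℝ)))) := by
  have hδ0 := hδ.1
  have hy' : (4 : ℝ) ≤ y := by exact_mod_cast hy
  have hy0 : (0 : ℝ) < y := by linarith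
  set e : ℝ := δ / C / (s + 1 : ℝ) ^ 2 with he
  have he0 : 0 ≤ e := by positivity
  have hexp : Real.exp (-threshold C δ (s + 1)) = e := by
    rw [exp_neg_threshold (by linarith) hδ.1 (by lia), he]
    push_cast; rfl
  have hterm : ∀ n ∈ Finset.Ioo 0 s, prob .poisson μ {o | ∃ t, A.hist o t ∈
        pairAt i j n (s - n) (devSet (n / (n + (s - n : ℕ))) (threshold C δ (s + 1)))} ≤
      ENNReal.ofReal (4 / (y : ℝ) ^ 2 * e + (if y * n < s then e else 0) +
        if y * (s - n) < s then e else 0) := by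
    intro n hn
    rw [Finset.mem_Ioo] at hn
    have hn2 : 1 ≤ s - n := by lia
    have hcast : ((n : ℝ) + (s - n : ℕ)) = s := by
      have : n + (s - n) = s := by lia
      exact_mod_cast this
    have hs0 : (0 : ℝ) < s := by exact_mod_cast (by lia : 0 < s)
    by_cases h1 : y * n < s
    · refine (prob_pairAt_devSet_le_exp hμ A hij hlt hn.1 hn2 _).trans
        (ENNReal.ofReal_le_ofReal ?_)
      rw [hexp, if_pos h1]
      have : 0 ≤ 4 / (y : ℝ) ^ 2 * e := by positivity
      split_ifs <;> linarith
    by_cases h2 : y * (s - n) < s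
    · refine (prob_pairAt_devSet_le_exp hμ A hij hlt hn.1 hn2 _).trans
        (ENNReal.ofReal_le_ofReal ?_)
      rw [hexp, if_pos h2]
      have : 0 ≤ 4 / (y : ℝ) ^ 2 * e := by positivity
      split_ifs; linarith
    rw [if_neg h1, if_neg h2, add_zero, add_zero, ← hexp]
    push Not at h1 h2
    have h1' : (s : ℝ) ≤ y * n := by exact_mod_cast h1
    have h2' : (s : ℝ) ≤ y * (s - n : ℕ) := by exact_mod_cast h2
    refine prob_pairAt_devSet_le_of_balanced hμ A hij hlt hn.1 hn2 (by lia) ?_ ?_ hx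
    · rw [hcast, div_le_div_iff₀ hy0 hs0]; linarith
    · rw [hcast, le_sub_iff_add_le, div_add_div _ _ hs0.ne' hy0.ne', div_le_one (by positivity)]
      rw [← hcast] at h2' ⊢
      nlinarith
  refine (prob_pairDevAt_le_sum hC hδ hμ A hij s).trans ((Finset.sum_le_sum hterm).trans ?_)
  rw [← ENNReal.ofReal_sum_of_nonneg (fun n _ => by positivity)]
  refine ENNReal.ofReal_le_ofReal ?_
  rw [Finset.sum_add_distrib, Finset.sum_add_distrib, Finset.sum_const, Nat.card_Ioo,
    ← Finset.sum_filter, ← Finset.sum_filter, Finset.sum_const, Finset.sum_const, nsmul_eq_mul,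
    nsmul_eq_mul, nsmul_eq_mul]
  have hc1 := card_filter_mul_lt_le (y := y) (by lia) s
  have hc2 : (((Finset.Ioo 0 s).filter fun n => y * (s - n) < s).card : ℝ) ≤ s / y := by
    refine le_trans ?_ hc1
    have : ((Finset.Ioo 0 s).filter fun n => y * (s - n) < s).card ≤
        ((Finset.Ioo 0 s).filter fun n => y * n < s).card := by
      refine Finset.card_le_card_of_injOn (fun n => s - n) ?_ ?_
      · intro n hn
        simp only [Finset.coe_filter, Finset.mem_Ioo, Set.mem_ofPred_eq] at hn ⊢
        exact ⟨by lia, hn.2⟩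
      · intro n hn n' hn' h
        simp only [Finset.coe_filter, Finset.mem_Ioo, Set.mem_ofPred_eq] at hn hn' h
        lia
    exact_mod_cast this
  have h1 : ((s - 0 - 1 : ℕ) : ℝ) ≤ s := by
    have : s - 0 - 1 ≤ s := by lia
    exact_mod_cast this
  have h4 : 4 / (y : ℝ) ^ 2 ≤ 1 / y := by
    rw [div_le_div_iff₀ (by positivity) hy0]; nlinarith
  calc ((s - 0 - 1 : ℕ) : ℝ) * (4 / (y : ℝ) ^ 2 * e) +
      (((Finset.Ioo 0 s).filter fun n => y * n < s).card : ℝ) * e +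
      (((Finset.Ioo 0 s).filter fun n => y * (s - n) < s).card : ℝ) * e
      ≤ s * (1 / y * e) + s / y * e + s / y * e := by gcongr
    _ = s * (3 / y * e) := by ring
    _ ≤ (s + 1) * (3 / y * e) := by gcongr; linarith
    _ = _ := by rw [he]; field_simp

/-- When `s` is huge compared with `log (C / δ)`, peeling replaces the union over the splits by a
factor bounded by a small power of `r`. The `(s + 1)^(-2) = r^(-40)` of the threshold then leaves
`r^(-25) = (s + 1)^(-5/4)`, which is summable. -/
lemma prob_pairDevAt_le_peel {C δ : ℝ} (hC : 1 ≤ C) (hδ : δ ∈ Set.Ioo (0 : ℝ) 1)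
    {μ : Fin K → ℝ} (hμ : ∀ k, μ k ∈ Family.poisson.means) (A : Algorithm K) {i j : Fin K}
    (hij : i ≠ j) {s : ℕ} {r : ℝ} (hr : 20000 ≤ r) (hrs : r ^ 20 = s + 1)
    (hx : Real.log (C / δ) ≤ r ^ 4) :
    prob .poisson μ {o | ∃ t, A.hist o t ∈ pairDevAt μ C δ i j s} ≤
      ENNReal.ofReal (δ / C * (1 / r ^ 25)) := by
  have hδ0 := hδ.1
  set x := threshold C δ (s + 1) with hxdef
  have hx0 : 0 < x := threshold_pos hC hδ (by lia)
  have hs1 : (0 : ℝ) < s + 1 := by positivity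
  have hr0 : 0 < r := by linarith
  have hlogr : Real.log r ≤ r / 1000 := by
    have h1 := Real.log_le_sub_one_of_pos (show 0 < r / 2000 by positivity)
    have h2 : Real.log 2000 ≤ 8 := by
      rw [Real.log_le_iff_le_exp (by norm_num)]
      have h3 := Real.exp_one_gt_d9
      have : Real.exp 8 = Real.exp 1 ^ 8 := by rw [← Real.exp_nat_mul]; norm_num
      rw [this]
      calc (2000 : ℝ) ≤ 2.7182818283 ^ 8 := by norm_num
        _ ≤ _ := by gcongr
    have h3 : Real.log r = Real.log (r / 2000) + Real.log 2000 := by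
      rw [← Real.log_mul (by positivity) (by norm_num)]; congr 1; field_simp
    linarith
  have hlogv : Real.log (s + 1) ≤ r / 50 := by
    rw [← hrs, Real.log_pow]; push_cast; linarith
  have hlogv0 : 0 ≤ Real.log ((s : ℝ) + 1) := Real.log_nonneg (by linarith [Nat.cast_nonneg (α := ℝ) s])
  have hxle : x + 1 ≤ 2 * r ^ 4 := by
    have h1 : x = Real.log (C / δ) + 2 * Real.log (s + 1) := by
      rw [hxdef, threshold, mul_div_right_comm, Real.log_mul (by positivity) (by positivity),
        Real.log_pow]
      push_cast; ring
    have h2 : r ≤ r ^ 4 := by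
      have := pow_le_pow_right₀ (by linarith : 1 ≤ r) (by norm_num : 1 ≤ 4)
      simpa using this
    rw [h1]
    linarith
  -- Enough geometric layers of ratio `1 + 1 / x` to reach `s`, because `log (1 + 1 / x) ≥ 1 / (x +
  -- 1)`.
  set R := ⌈(x + 1) * Real.log (s + 1)⌉₊ with hR
  have hRle : (R : ℝ) + 1 ≤ r ^ 5 / 10 := by
    have h1 := Nat.ceil_lt_add_one (show 0 ≤ (x + 1) * Real.log (s + 1) by positivity)
    have h2 : (x + 1) * Real.log (s + 1) ≤ 2 * r ^ 4 * (r / 50) := by gcongr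
    have h3 : r ≤ r ^ 5 := by
      have := pow_le_pow_right₀ (by linarith : 1 ≤ r) (by norm_num : 1 ≤ 5)
      simpa using this
    have h4 : 2 * r ^ 4 * (r / 50) = r ^ 5 / 25 := by ring
    rw [← hR] at h1
    linarith
  have hpow : (s : ℝ) < (1 + 1 / x) ^ (R + 1) := by
    have h1 : 1 / (x + 1) ≤ Real.log (1 + 1 / x) := by
      have h2 := Real.one_sub_inv_le_log_of_pos (show 0 < 1 + 1 / x by positivity)
      refine le_trans (le_of_eq ?_) h2
      field_simp
      ring
    have h3 : Real.log (s + 1) ≤ (R + 1 : ℕ) * Real.log (1 + 1 / x) := by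
      have h4 : (x + 1) * Real.log (s + 1) ≤ R := Nat.le_ceil _
      have h5 : Real.log (s + 1) ≤ R * (1 / (x + 1)) := by
        rw [mul_one_div, le_div_iff₀ (by linarith)]; linarith
      calc Real.log (s + 1) ≤ R * (1 / (x + 1)) := h5
        _ ≤ (R + 1 : ℕ) * Real.log (1 + 1 / x) := by
          gcongr
          linarith
    rw [← Real.log_pow, Real.log_le_log_iff hs1 (by positivity)] at h3
    linarith
  have hpeel := prob_exists_sum_dev_le hμ A hij hx0 hpow
  refine le_trans (measure_mono ?_) (hpeel.trans (ENNReal.ofReal_le_ofReal ?_))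
  · rintro o ⟨t, hd, hs⟩
    obtain ⟨h1, h2, _, h3⟩ := pairDev_poisson_subset hC hδ hμ hij hd
    rw [hs] at h3
    exact ⟨t, hd.1, h1, h2, by lia, by lia, h3⟩
  · rw [hxdef, exp_neg_threshold (by linarith) hδ.1 (by lia)]
    have hv : (((s + 1 : ℕ) : ℝ)) = r ^ 20 := by rw [hrs]; push_cast; rfl
    rw [hv]
    have he2 : Real.exp 2 ≤ 8 := by
      have h3 := Real.exp_one_lt_d9
      have : Real.exp 2 = Real.exp 1 ^ 2 := by rw [← Real.exp_nat_mul]; norm_num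
      rw [this]
      calc Real.exp 1 ^ 2 ≤ 2.7182818286 ^ 2 := by gcongr
        _ ≤ 8 := by norm_num
    calc 4 * Real.exp 2 * (threshold C δ (s + 1) + 1) * (R + 1) ^ 2 * (δ / C / (r ^ 20) ^ 2)
        ≤ 4 * 8 * (2 * r ^ 4) * (r ^ 5 / 10) ^ 2 * (δ / C / (r ^ 20) ^ 2) := by gcongr
      _ = δ / C * (0.64 * r ^ 14 / r ^ 40) := by ring
      _ ≤ δ / C * (1 / r ^ 25) := by
        refine mul_le_mul_of_nonneg_left ?_ (by positivity)
        rw [div_le_div_iff₀ (by positivity) (by positivity)]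
        calc 0.64 * r ^ 14 * r ^ 25 = r ^ 39 * 0.64 := by ring
          _ ≤ r ^ 39 * r := by gcongr; linarith
          _ = 1 * r ^ 40 := by ring

/-- Comparison with the telescoping differences of `4 (s + 1)^(-1/4)`. -/
lemma tsum_one_div_sqrt_sqrt_pow_le :
    ∑' s : ℕ, ENNReal.ofReal (if s = 0 then 0 else 1 / √√((s : ℝ) + 1) ^ 5) ≤ ENNReal.ofReal 4 := by
  have h : ∀ N : ℕ, ∑ s ∈ Finset.range (N + 1), (if s = 0 then 0 else 1 / √√((s : ℝ) + 1) ^ 5) ≤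
      4 - 4 / √√((N : ℝ) + 1) := by
    intro N
    induction N with
    | zero => simp
    | succ N ih =>
      rw [Finset.sum_range_succ, if_neg (by lia)]
      push_cast
      set a := √√((N : ℝ) + 1) with ha
      set b := √√((N : ℝ) + 1 + 1) with hb
      have ha0 : 0 < a := by positivity
      have hb0 : 0 < b := by positivity
      have hab : a ≤ b := Real.sqrt_le_sqrt (Real.sqrt_le_sqrt (by linarith))
      have ha4 : a ^ 4 = N + 1 := by
        rw [show (4 : ℕ) = 2 * 2 by norm_num, pow_mul, ha, Real.sq_sqrt (by positivity),
          Real.sq_sqrt (by positivity)]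
      have hb4 : b ^ 4 = N + 1 + 1 := by
        rw [show (4 : ℕ) = 2 * 2 by norm_num, pow_mul, hb, Real.sq_sqrt (by positivity),
          Real.sq_sqrt (by positivity)]
      have h1 : 1 ≤ (b - a) * (4 * b ^ 3) := by
        have e : (b - a) * (b ^ 3 + b ^ 2 * a + b * a ^ 2 + a ^ 3) = 1 := by
          have : (b - a) * (b ^ 3 + b ^ 2 * a + b * a ^ 2 + a ^ 3) = b ^ 4 - a ^ 4 := by ring
          rw [this, ha4, hb4]; ring
        rw [← e]
        refine mul_le_mul_of_nonneg_left ?_ (by linarith)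
        have e1 : b ^ 2 * a ≤ b ^ 2 * b := by gcongr
        have e2 : b * a ^ 2 ≤ b * b ^ 2 := by gcongr
        have e3 : a ^ 3 ≤ b ^ 3 := by gcongr
        nlinarith
      have h2 : 1 / b ^ 5 ≤ 4 / a - 4 / b := by
        rw [div_sub_div _ _ ha0.ne' hb0.ne', div_le_div_iff₀ (by positivity) (by positivity)]
        have e : (4 * b - a * 4) * b ^ 5 = ((b - a) * (4 * b ^ 3)) * (b * b) := by ring
        rw [e]
        calc 1 * (a * b) ≤ 1 * (b * b) := by gcongr
          _ ≤ _ := by gcongr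
      linarith
  rw [ENNReal.tsum_eq_iSup_nat]
  refine iSup_le fun N => ?_
  rw [← ENNReal.ofReal_sum_of_nonneg (fun _ _ => by positivity)]
  refine ENNReal.ofReal_le_ofReal ((Finset.sum_le_sum_of_subset_of_nonneg
    (Finset.range_mono (Nat.le_succ N)) fun _ _ _ => by positivity).trans ((h N).trans ?_))
  have : (0 : ℝ) ≤ 4 / √√((N : ℝ) + 1) := by positivity
  linarith

/-- A harmonic sum up to `L` without its first term; omitting `s = 0` removes the additive `1` of
the usual bound. -/
lemma tsum_one_div_le_log {L : ℝ} (hL : 1 ≤ L) :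
    ∑' s : ℕ, ENNReal.ofReal (if s = 0 ∨ L < s + 1 then 0 else 1 / ((s : ℝ) + 1)) ≤
      ENNReal.ofReal (Real.log L) := by
  have hz : ∀ s ∉ Finset.range ⌊L⌋₊,
      ENNReal.ofReal (if s = 0 ∨ L < s + 1 then 0 else 1 / ((s : ℝ) + 1)) = 0 := by
    intro s hs
    rw [Finset.mem_range, not_lt] at hs
    have : L < s + 1 := (Nat.lt_floor_add_one L).trans_le (by
      have : (⌊L⌋₊ : ℝ) ≤ s := by exact_mod_cast hs
      linarith)
    rw [if_pos (Or.inr this), ENNReal.ofReal_zero]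
  rw [tsum_eq_sum hz, ← ENNReal.ofReal_sum_of_nonneg (fun _ _ => by positivity)]
  refine ENNReal.ofReal_le_ofReal ?_
  have hh := harmonic_floor_le_one_add_log L hL
  have h1 : 0 < ⌊L⌋₊ := Nat.floor_pos.2 hL
  obtain ⟨M, hM⟩ := Nat.exists_eq_succ_of_ne_zero h1.ne'
  rw [hM] at hh ⊢
  rw [harmonic, Finset.sum_range_succ'] at hh
  rw [Finset.sum_range_succ', if_pos (Or.inl rfl), add_zero]
  push_cast at hh
  simp only [inv_one] at hh
  refine (Finset.sum_le_sum (g := fun s : ℕ => ((s : ℝ) + 1 + 1)⁻¹) fun s _ => ?_).trans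
    (by linarith)
  by_cases hc : s + 1 = 0 ∨ L < ((s + 1 : ℕ) : ℝ) + 1
  · rw [if_pos hc]; positivity
  · rw [if_neg hc]; push_cast; rw [one_div]

/-- Union bound over all numbers of observations of two slices with Poisson traffic. -/
lemma prob_pairDev_poisson {C δ : ℝ} (hC : 1 ≤ C) (hδ : δ ∈ Set.Ioo (0 : ℝ) 1)
    {μ : Fin K → ℝ} (hμ : ∀ k, μ k ∈ Family.poisson.means) (A : Algorithm K) {i j : Fin K}
    (hij : i ≠ j) (hlt : μ i < μ j) :
    prob .poisson μ {o | ∃ t, A.hist o t ∈ pairDev .poisson μ (threshold C δ) i j} ≤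
      ENNReal.ofReal (δ / C * 204) := by
  have hδ0 := hδ.1
  set x₀ := Real.log (C / δ) with hx₀
  have he10 : (20000 : ℝ) ≤ Real.exp 10 := by
    have h3 := Real.exp_one_gt_d9
    have : Real.exp 10 = Real.exp 1 ^ 10 := by rw [← Real.exp_nat_mul]; norm_num
    rw [this]
    calc (20000 : ℝ) ≤ 2.7182818283 ^ 10 := by norm_num
      _ ≤ _ := by gcongr
  have hthr : ∀ s : ℕ, x₀ ≤ threshold C δ (s + 1) := by
    intro s
    have : x₀ = threshold C δ 1 := by rw [hx₀, threshold]; norm_num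
    rw [this]
    exact threshold_mono (by linarith) hδ0 (by lia) (by lia)
  -- Below `M^5` the bound is `θ` times a harmonic sum, so `θ log (M^5)` must be bounded
  -- independently of `δ`. For `log (C / δ) ≤ e^40` one has `θ = 1` and `log (M^5) = 200`. Otherwise
  -- `M = log (C / δ) = u^16`, and `θ = 3 / y` with `y` the integer part of `u` beats `log (M^5) =
  -- 80 log u`.
  obtain ⟨M, θ, hM1, hM2, hθ0, hθM, hθ⟩ : ∃ M θ : ℝ, Real.exp 40 ≤ M ∧ x₀ ≤ M ∧ 0 ≤ θ ∧
      θ * Real.log (M ^ 5) ≤ 200 ∧ ∀ s : ℕ,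
      prob .poisson μ {o | ∃ t, A.hist o t ∈ pairDevAt μ C δ i j s} ≤
        ENNReal.ofReal (δ / C * (θ * (1 / (s + 1 : ℝ)))) := by
    rcases le_total x₀ (Real.exp 40) with hle | hle
    · refine ⟨Real.exp 40, 1, le_rfl, hle, zero_le_one, ?_, fun s => ?_⟩
      · rw [Real.log_pow, Real.log_exp]; norm_num
      · rw [one_mul]; exact prob_pairDevAt_le hC hδ hμ A hij hlt s
    · have hx0 : 0 < x₀ := (Real.exp_pos _).trans_le hle
      set u := x₀ ^ ((1 : ℝ) / 16) with hu
      have hu16 : u ^ 16 = x₀ := by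
        rw [hu, ← Real.rpow_natCast, ← Real.rpow_mul hx0.le]; norm_num
      have hu0 : 0 ≤ u := by positivity
      have hu12 : 12 ≤ u := by
        have h1 : Real.exp 2.5 ≤ u := by
          rw [hu, show Real.exp 2.5 = Real.exp 40 ^ ((1 : ℝ) / 16) by
            rw [← Real.exp_mul]; norm_num]
          gcongr
        refine le_trans ?_ h1
        have h2 : (12 : ℝ) ^ 2 ≤ Real.exp 2.5 ^ 2 := by
          rw [← Real.exp_nat_mul]
          have h3 := Real.exp_one_gt_d9
          have : Real.exp ((2 : ℕ) * 2.5) = Real.exp 1 ^ 5 := by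
            rw [← Real.exp_nat_mul]; norm_num
          rw [this]
          calc (12 : ℝ) ^ 2 ≤ 2.7182818283 ^ 5 := by norm_num
            _ ≤ _ := by gcongr
        exact le_of_sq_le_sq h2 (by positivity)
      set y := ⌊u⌋₊ with hy
      have hy12 : 12 ≤ y := Nat.le_floor (by exact_mod_cast hu12)
      have hy12' : (12 : ℝ) ≤ y := by exact_mod_cast hy12
      have hyu : (y : ℝ) ≤ u := Nat.floor_le hu0
      have huy : u < y + 1 := Nat.lt_floor_add_one u
      refine ⟨x₀, 3 / y, hle, le_rfl, by positivity, ?_, fun s => ?_⟩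
      · rw [← hu16, ← pow_mul, Real.log_pow]
        have h1 : Real.log u ≤ y / 2 + 1 / 2 := by
          have h2 := Real.log_le_sub_one_of_pos (show 0 < u / 2 by linarith)
          have h3 : Real.log u = Real.log (u / 2) + Real.log 2 := by
            rw [← Real.log_mul (by positivity) (by norm_num)]; congr 1; field_simp
          have := Real.log_two_lt_d9
          linarith
        rw [div_mul_eq_mul_div, div_le_iff₀ (by linarith)]
        push_cast
        linarith
      · refine prob_pairDevAt_le_of_pow_le hC hδ hμ A hij hlt s (by lia) (le_trans ?_ (hthr s))
        rw [← hu16]; gcongr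
  have hM0 : 0 < M := (Real.exp_pos _).trans_le hM1
  set L := M ^ 5 with hL
  have hL1 : 1 ≤ L := by
    apply one_le_pow₀
    exact le_trans (Real.one_le_exp (by norm_num)) hM1
  have hterm : ∀ s : ℕ, prob .poisson μ {o | ∃ t, A.hist o t ∈ pairDevAt μ C δ i j s} ≤
      ENNReal.ofReal (δ / C) * (ENNReal.ofReal θ *
        ENNReal.ofReal (if s = 0 ∨ L < s + 1 then 0 else 1 / ((s : ℝ) + 1)) +
        ENNReal.ofReal (if s = 0 then 0 else 1 / √√((s : ℝ) + 1) ^ 5)) := by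
    intro s
    by_cases hs : s = 0
    · have : {o : Outcomes K | ∃ t, A.hist o t ∈ pairDevAt μ C δ i j s} = ∅ := by
        refine Set.eq_empty_of_forall_notMem ?_
        rintro o ⟨t, hd, hs'⟩
        have := (pairDev_poisson_subset hC hδ hμ hij hd).1
        lia
      rw [this, measure_empty]
      exact zero_le
    -- Beyond `M^5` the number `r = (s + 1)^(1/20)` satisfies `r^4 ≥ M`, which dominates both `e^40`
    -- and `log (C / δ)`: peeling applies.
    by_cases hsL : L < s + 1
    · have hs1 : (0 : ℝ) ≤ s + 1 := by positivity
      set r : ℝ := ((s : ℝ) + 1) ^ ((1 : ℝ) / 20) with hr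
      have hr0 : 0 ≤ r := by positivity
      have hr20 : r ^ 20 = s + 1 := by
        rw [hr, ← Real.rpow_natCast, ← Real.rpow_mul hs1]; norm_num
      have hMr : M ≤ r ^ 4 := by
        refine le_of_lt (lt_of_pow_lt_pow_left₀ 5 (by positivity) ?_)
        rw [← pow_mul, hr20]; exact hsL
      have hr1 : Real.exp 10 ≤ r := by
        refine le_of_pow_le_pow_left₀ (n := 4) (by norm_num) hr0 (le_trans ?_ hMr)
        rw [← Real.exp_nat_mul]
        refine le_trans (le_of_eq ?_) hM1
        norm_num
      have hr5 : √√((s : ℝ) + 1) = r ^ 5 := by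
        rw [← hr20, show r ^ 20 = (r ^ 10) ^ 2 by ring, Real.sqrt_sq (by positivity),
          show r ^ 10 = (r ^ 5) ^ 2 by ring, Real.sqrt_sq (by positivity)]
      refine (prob_pairDevAt_le_peel hC hδ hμ A hij (he10.trans hr1) hr20 (hM2.trans hMr)).trans ?_
      rw [if_pos (Or.inr hsL), if_neg hs, hr5, ENNReal.ofReal_zero, mul_zero, zero_add,
        ← ENNReal.ofReal_mul (by positivity), ← pow_mul]
    · rw [if_neg (by tauto)]
      refine (hθ s).trans ?_
      rw [ENNReal.ofReal_mul (by positivity), ENNReal.ofReal_mul hθ0]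
      exact mul_le_mul_right le_self_add _
  have hsub : {o | ∃ t, A.hist o t ∈ pairDev .poisson μ (threshold C δ) i j} ⊆
      ⋃ s : ℕ, {o | ∃ t, A.hist o t ∈ pairDevAt μ C δ i j s} := by
    rintro o ⟨t, ht⟩
    exact Set.mem_iUnion.2 ⟨_, t, ht, rfl⟩
  refine (measure_mono hsub).trans ((measure_iUnion_le _).trans
    ((ENNReal.tsum_le_tsum hterm).trans ?_))
  rw [ENNReal.tsum_mul_left, ENNReal.tsum_add, ENNReal.tsum_mul_left,
    ENNReal.ofReal_mul (by positivity)]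
  refine mul_le_mul_right ?_ _
  calc _ ≤ ENNReal.ofReal θ * ENNReal.ofReal (Real.log L) + ENNReal.ofReal 4 :=
        add_le_add (mul_le_mul_right (tsum_one_div_le_log hL1) _) tsum_one_div_sqrt_sqrt_pow_le
    _ = ENNReal.ofReal (θ * Real.log L + 4) := by
        rw [← ENNReal.ofReal_mul hθ0, ← ENNReal.ofReal_add (mul_nonneg hθ0 (Real.log_nonneg hL1))
          (by norm_num)]
    _ ≤ ENNReal.ofReal 204 := ENNReal.ofReal_le_ofReal (by linarith)

/-! ### The constant of the exploration threshold -/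

/-- Powers of logarithms are bounded by fourth roots, leaving terms of order `t^(-5/4)`. Summability
matters because a divergent `tsum` is `0` by default, and then the condition on `C` would give no
lower bound. -/
lemma summable_threshold_series {C : ℝ} (hC : 1 ≤ C) {n : ℕ} (hn : n ≠ 0) (a : ℝ) (ha : 0 ≤ a) :
    Summable fun t : ℕ => a * (Real.log (C * ((t : ℝ) + 1) ^ 2) * Real.log ((t : ℝ) + 1)) ^ n /
      ((t : ℝ) + 1) ^ 2 := by
  have hn0 : (0 : ℝ) < n := by positivity
  set ε : ℝ := 1 / (4 * n) with hε
  have hε0 : 0 < ε := by positivity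
  have hs : Summable fun t : ℕ => a * ((1 / ε) ^ n * (1 / ε) ^ n * C ^ ((1 : ℝ) / 4)) *
      (1 / |(t : ℝ) + 1| ^ ((5 : ℝ) / 4)) :=
    ((Real.summable_one_div_nat_add_rpow 1 (5 / 4)).2 (by norm_num)).mul_left _
  refine Summable.of_nonneg_of_le (fun t => ?_) (fun t => ?_) hs
  · have h1 : (1 : ℝ) ≤ (t : ℝ) + 1 := by linarith [Nat.cast_nonneg (α := ℝ) t]
    have h2 : 0 ≤ Real.log ((t : ℝ) + 1) := Real.log_nonneg h1
    have h3 : 0 ≤ Real.log (C * ((t : ℝ) + 1) ^ 2) := Real.log_nonneg (by nlinarith)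
    positivity
  · set u : ℝ := (t : ℝ) + 1 with hu
    have h1 : (1 : ℝ) ≤ u := by rw [hu]; linarith [Nat.cast_nonneg (α := ℝ) t]
    have hu0 : 0 < u := by linarith
    have h2 : 0 ≤ Real.log u := Real.log_nonneg h1
    have h3 : 0 ≤ Real.log (C * u ^ 2) := Real.log_nonneg (by nlinarith)
    have hlog : ∀ v : ℝ, 1 ≤ v → Real.log v ^ n ≤ (1 / ε) ^ n * v ^ ((1 : ℝ) / 4) := by
      intro v hv
      have e1 := Real.log_le_rpow_div (by linarith : 0 ≤ v) hε0
      calc Real.log v ^ n ≤ (v ^ ε / ε) ^ n := by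
            gcongr; exact Real.log_nonneg hv
        _ = (1 / ε) ^ n * (v ^ ε) ^ n := by rw [← mul_pow]; ring
        _ = _ := by
            rw [← Real.rpow_natCast (v ^ ε), ← Real.rpow_mul (by linarith)]
            congr 2
            rw [hε]; field_simp
    have e1 := hlog u h1
    have e2 := hlog (C * u ^ 2) (by nlinarith)
    have e3 : (C * u ^ 2) ^ ((1 : ℝ) / 4) * u ^ ((1 : ℝ) / 4) / u ^ 2 =
        C ^ ((1 : ℝ) / 4) * (1 / |u| ^ ((5 : ℝ) / 4)) := by
      rw [Real.mul_rpow (by linarith) (by positivity), ← Real.rpow_natCast u 2,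
        ← Real.rpow_mul hu0.le, mul_assoc, ← Real.rpow_add hu0, mul_div_assoc,
        ← Real.rpow_sub hu0, abs_of_pos hu0, one_div (u ^ ((5 : ℝ) / 4)), ← Real.rpow_neg hu0.le]
      norm_num
    calc a * (Real.log (C * u ^ 2) * Real.log u) ^ n / u ^ 2
        = a * (Real.log (C * u ^ 2) ^ n * Real.log u ^ n) / u ^ 2 := by rw [mul_pow]
      _ ≤ a * (((1 / ε) ^ n * (C * u ^ 2) ^ ((1 : ℝ) / 4)) *
          ((1 / ε) ^ n * u ^ ((1 : ℝ) / 4))) / u ^ 2 := by gcongr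
      _ = a * ((1 / ε) ^ n * (1 / ε) ^ n) *
          ((C * u ^ 2) ^ ((1 : ℝ) / 4) * u ^ ((1 : ℝ) / 4) / u ^ 2) := by ring
      _ = _ := by rw [e3]; ring

/-- Since `C ≥ 1`, `log (C t²) ≥ 2 log t`; this removes `C` from the series and leaves numerical
sums. -/
lemma sum_log_pow_le_of_threshold_series [NeZero K] {C : ℝ} (hC1 : 1 ≤ C)
    (hC : Real.exp 1 * ∑' t : ℕ, (Real.exp 1 / K) ^ K *
        (Real.log (C * ((t : ℝ) + 1) ^ 2) * Real.log ((t : ℝ) + 1)) ^ K / ((t : ℝ) + 1) ^ 2 ≤ C)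
    (N : ℕ) :
    Real.exp 1 * (2 * Real.exp 1 / K) ^ K *
      ∑ t ∈ Finset.Ico 1 N, Real.log t ^ (2 * K) / (t : ℝ) ^ 2 ≤ C := by
  have hK : K ≠ 0 := NeZero.ne K
  have hs := summable_threshold_series hC1 hK ((Real.exp 1 / K) ^ K) (by positivity)
  refine le_trans ?_ hC
  rw [mul_assoc]
  refine mul_le_mul_of_nonneg_left ?_ (Real.exp_nonneg _)
  refine le_trans ?_ (hs.sum_le_tsum (Finset.range (N - 1)) fun t _ => ?_)
  · rw [Finset.sum_Ico_eq_sum_range, Finset.mul_sum]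
    refine Finset.sum_le_sum fun t _ => ?_
    push_cast
    rw [add_comm (1 : ℝ) t]
    set u : ℝ := (t : ℝ) + 1 with hu
    have h1 : (1 : ℝ) ≤ u := by rw [hu]; linarith [Nat.cast_nonneg (α := ℝ) t]
    have h2 : 0 ≤ Real.log u := Real.log_nonneg h1
    have h3 : 2 * Real.log u ≤ Real.log (C * u ^ 2) := by
      rw [Real.log_mul (by linarith) (by positivity), Real.log_pow]
      have := Real.log_nonneg hC1
      push_cast; linarith
    calc (2 * Real.exp 1 / K) ^ K * (Real.log u ^ (2 * K) / u ^ 2)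
        = (Real.exp 1 / K) ^ K * (2 * Real.log u * Real.log u) ^ K / u ^ 2 := by
          rw [mul_pow, mul_pow, pow_mul, div_pow, div_pow, mul_pow, sq, mul_pow]; ring
      _ ≤ _ := by gcongr
  · have h1 : (1 : ℝ) ≤ (t : ℝ) + 1 := by linarith [Nat.cast_nonneg (α := ℝ) t]
    have h2 : 0 ≤ Real.log ((t : ℝ) + 1) := Real.log_nonneg h1
    have h3 : 0 ≤ Real.log (C * ((t : ℝ) + 1) ^ 2) := Real.log_nonneg (by nlinarith)
    positivity

lemma one_div_two_mul_le_sum_Ico {A : ℕ} (hA : 1 ≤ A) :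
    1 / (2 * A : ℝ) ≤ ∑ t ∈ Finset.Ico A (2 * A), 1 / (t : ℝ) ^ 2 := by
  have h : ∀ n : ℕ, 1 / (A : ℝ) - 1 / (A + n) ≤ ∑ t ∈ Finset.Ico A (A + n), 1 / (t : ℝ) ^ 2 := by
    intro n
    induction n with
    | zero => simp
    | succ n ih =>
      rw [← add_assoc, Finset.sum_Ico_succ_top (by lia)]
      have hA' : (0 : ℝ) < A := by exact_mod_cast hA
      have : 1 / ((A : ℝ) + n) - 1 / (A + n + 1) ≤ 1 / ((A : ℝ) + n) ^ 2 := by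
        rw [div_sub_div _ _ (by positivity) (by positivity),
          div_le_div_iff₀ (by positivity) (by positivity)]
        nlinarith [show (0 : ℝ) < A + n by positivity]
      push_cast
      rw [← add_assoc]
      linarith
  have h1 := h A
  rw [← two_mul, ← two_mul] at h1
  refine le_trans (le_of_eq ?_) h1
  have hA' : (0 : ℝ) < A := by exact_mod_cast hA
  field_simp
  norm_num

lemma log_pow_div_le_sum_Ico {A : ℕ} (hA : 1 ≤ A) {b : ℝ} (hb : 0 ≤ b) (hbA : b ≤ Real.log A)
    (n : ℕ) :
    b ^ n / (2 * A) ≤ ∑ t ∈ Finset.Ico A (2 * A), Real.log t ^ n / (t : ℝ) ^ 2 := by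
  have h := mul_le_mul_of_nonneg_left (one_div_two_mul_le_sum_Ico hA) (pow_nonneg hb n)
  rw [Finset.mul_sum, mul_one_div] at h
  refine h.trans (Finset.sum_le_sum fun t ht => ?_)
  rw [mul_one_div]
  have hA' : (0 : ℝ) < A := by exact_mod_cast hA
  have ht' : (A : ℝ) ≤ t := by exact_mod_cast (Finset.mem_Ico.1 ht).1
  have : Real.log A ≤ Real.log t := Real.log_le_log hA' ht'
  gcongr
  linarith

/-- On each dyadic block the logarithm is bounded below by its value at the left end, using `0.69 <
log 2`. -/
lemma sum_dyadic_le (n N : ℕ) :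
    ∑ m ∈ Finset.range N, (0.69 * (m : ℝ)) ^ n / (2 * 2 ^ m) ≤
      ∑ t ∈ Finset.Ico 1 (2 ^ N : ℕ), Real.log (t : ℝ) ^ n / (t : ℝ) ^ 2 := by
  induction N with
  | zero => simp
  | succ N ih =>
    rw [Finset.sum_range_succ, ← Finset.sum_Ico_consecutive _ (Nat.one_le_two_pow (n := N))
      (Nat.pow_le_pow_right (by norm_num) (Nat.le_succ N))]
    refine add_le_add ih ?_
    have := log_pow_div_le_sum_Ico (A := 2 ^ N) Nat.one_le_two_pow (b := 0.69 * N) (by positivity) (by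
      push_cast
      rw [Real.log_pow]
      have := Real.log_two_gt_d9
      have hN : (0 : ℝ) ≤ N := by positivity
      nlinarith) n
    rw [pow_succ, mul_comm (2 ^ N) 2]
    push_cast at this
    exact this

/-- The constant of the exploration threshold absorbs the union bound over the slices. -/
lemma const_ge_of_threshold_series [NeZero K] {C : ℝ} (hC1 : 1 ≤ C)
    (hC : Real.exp 1 * ∑' t : ℕ, (Real.exp 1 / K) ^ K *
        (Real.log (C * ((t : ℝ) + 1) ^ 2) * Real.log ((t : ℝ) + 1)) ^ K / ((t : ℝ) + 1) ^ 2 ≤ C) :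
    (K : ℝ) * 2 + (K - 1 : ℕ) * 204 ≤ C := by
  have hS := sum_log_pow_le_of_threshold_series hC1 hC
  have hK : K ≠ 0 := NeZero.ne K
  have he := Real.exp_one_gt_d9
  have he' := Real.exp_one_lt_d9
  -- The required constants are `2` and `208` for `K = 1` and `K = 2`; `3` and `13` dyadic blocks
  -- reach them numerically.
  rcases (show K = 1 ∨ K = 2 ∨ 3 ≤ K by lia) with h1 | h2 | h3
  · subst h1
    have h := sum_dyadic_le 2 3
    have h4 := hS (2 ^ 3)
    simp only [Finset.sum_range_succ, Finset.sum_range_zero] at h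
    norm_num at h h4 ⊢
    have h5 : (7 : ℝ) ≤ Real.exp 1 * (2 * Real.exp 1) := by nlinarith
    nlinarith
  · subst h2
    have h := sum_dyadic_le 4 13
    have h4 := hS (2 ^ 13)
    simp only [Finset.sum_range_succ, Finset.sum_range_zero] at h
    norm_num at h h4 ⊢
    have h5 : (20 : ℝ) ≤ Real.exp 1 * Real.exp 2 := by
      have : Real.exp 1 * Real.exp 2 = Real.exp 1 ^ 3 := by
        rw [← Real.exp_add, ← Real.exp_nat_mul]; norm_num
      rw [this]
      calc (20 : ℝ) ≤ 2.7182818283 ^ 3 := by norm_num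
        _ ≤ _ := by gcongr
    nlinarith
  -- One block suffices for `K ≥ 3`. Up to constants its contribution is `(log t)^(2 K) / t` at its
  -- left end, and this is maximal at `t = exp (2 K)`; it yields a multiple of `(8 K / e)^K`, which
  -- exceeds `206 K`.
  · set A := ⌈Real.exp (2 * K)⌉₊ with hA
    have hK3 : (3 : ℝ) ≤ K := by exact_mod_cast h3
    have hK0 : (0 : ℝ) < K := by linarith
    have hE : (100 : ℝ) ≤ Real.exp (2 * K) := by
      have h1 : Real.exp 6 ≤ Real.exp (2 * K) := Real.exp_le_exp.2 (by linarith)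
      have h2 : Real.exp 6 = Real.exp 1 ^ 6 := by rw [← Real.exp_nat_mul]; norm_num
      rw [h2] at h1
      refine le_trans ?_ h1
      calc (100 : ℝ) ≤ 2.7182818283 ^ 6 := by norm_num
        _ ≤ _ := by gcongr
    have hAle : (A : ℝ) ≤ 1.01 * Real.exp (2 * K) := by
      have := Nat.ceil_lt_add_one (Real.exp_nonneg (2 * K))
      rw [← hA] at this
      linarith
    have hAge : Real.exp (2 * K) ≤ A := Nat.le_ceil _
    have hA1 : 1 ≤ A := by
      have : (1 : ℝ) ≤ A := by linarith
      exact_mod_cast this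
    have hA0 : (0 : ℝ) < A := by linarith
    have hblock := log_pow_div_le_sum_Ico hA1 (b := 2 * K) (by positivity)
      ((Real.le_log_iff_exp_le hA0).2 hAge) (2 * K)
    have hsub : ∑ t ∈ Finset.Ico A (2 * A), Real.log t ^ (2 * K) / (t : ℝ) ^ 2 ≤
        ∑ t ∈ Finset.Ico 1 (2 * A), Real.log t ^ (2 * K) / (t : ℝ) ^ 2 :=
      Finset.sum_le_sum_of_subset_of_nonneg (Finset.Ico_subset_Ico_left hA1) fun t _ _ => by
        rw [pow_mul]; positivity
    refine le_trans ?_ (hS (2 * A))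
    have hlow : (2 * K : ℝ) ^ (2 * K) / (2 * (1.01 * Real.exp (2 * K))) ≤
        ∑ t ∈ Finset.Ico 1 (2 * A), Real.log t ^ (2 * K) / (t : ℝ) ^ 2 := by
      refine le_trans ?_ (hblock.trans hsub)
      gcongr
    have hpow : Real.exp 1 * (2 * Real.exp 1 / K) ^ K *
        ((2 * K : ℝ) ^ (2 * K) / (2 * (1.01 * Real.exp (2 * K)))) =
        Real.exp 1 / 2.02 * (8 * K / Real.exp 1) ^ K := by
      have e1 : Real.exp (2 * K) = Real.exp 1 ^ K * Real.exp 1 ^ K := by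
        rw [← Real.exp_nat_mul, ← Real.exp_add]; congr 1; ring
      have e2 : (2 * K : ℝ) ^ (2 * K) = 4 ^ K * (K ^ K * K ^ K) := by
        rw [pow_mul, ← mul_pow, ← mul_pow]; congr 1; ring
      have e3 : (8 : ℝ) ^ K = 2 ^ K * 4 ^ K := by rw [← mul_pow]; norm_num
      rw [e1, e2, div_pow, div_pow, mul_pow, mul_pow, e3]
      have : (K : ℝ) ^ K ≠ 0 := by positivity
      field_simp
      norm_num
    have hfin : (K : ℝ) * 206 ≤ Real.exp 1 / 2.02 * (8 * K / Real.exp 1) ^ K := by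
      have e0 : (2.9 : ℝ) * K ≤ 8 * K / Real.exp 1 := by
        rw [le_div_iff₀ (by linarith)]; nlinarith
      have e1 : (8.7 : ℝ) ≤ 8 * K / Real.exp 1 := by linarith
      have e2 : (8 * K / Real.exp 1) ^ 3 ≤ (8 * K / Real.exp 1) ^ K :=
        pow_le_pow_right₀ (by linarith) h3
      have e3 : (2.9 : ℝ) * K * 8.7 ^ 2 ≤ (8 * K / Real.exp 1) ^ 3 := by
        rw [pow_succ' _ 2]
        gcongr
      have e4 : (1.3 : ℝ) ≤ Real.exp 1 / 2.02 := by
        rw [le_div_iff₀ (by norm_num)]; linarith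
      calc (K : ℝ) * 206 ≤ 1.3 * (2.9 * K * 8.7 ^ 2) := by nlinarith
        _ ≤ _ := by gcongr; exact e3.trans e2
    have hKm : ((K - 1 : ℕ) : ℝ) ≤ K := by exact_mod_cast Nat.sub_le K 1
    calc (K : ℝ) * 2 + (K - 1 : ℕ) * 204 ≤ K * 206 := by linarith
      _ ≤ _ := hfin
      _ = _ := hpow.symm
      _ ≤ _ := by gcongr

/-! ### The probability of error -/

/-- The probability of a wrong answer is at most `δ`. -/
lemma prob_errorEvent_trackAndStop_le [NeZero K] {F : Family} {c : Criterion} {γ C δ : ℝ}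
    (hC1 : 1 ≤ C)
    (hC : Real.exp 1 * ∑' t : ℕ, (Real.exp 1 / K) ^ K *
        (Real.log (C * ((t : ℝ) + 1) ^ 2) * Real.log ((t : ℝ) + 1)) ^ K / ((t : ℝ) + 1) ^ 2 ≤ C)
    (hδ : δ ∈ Set.Ioo (0 : ℝ) 1) (ρ : History K → Fin K) {μ : Fin K → ℝ}
    (hμ : ∀ k, μ k ∈ F.means) :
    prob F μ ((trackAndStop F c γ C δ ρ).errorEvent c γ μ) ≤ ENNReal.ofReal δ := by
  have hCK := const_ge_of_threshold_series hC1 hC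
  have hδ0 := hδ.1
  have hC0 : 0 < C := by linarith
  have hpair : ∀ i j, i ≠ j → μ i < μ j → prob F μ {x | ∃ t, (trackAndStop F c γ C δ ρ).hist x t ∈
      pairDev F μ (threshold C δ) i j} ≤ ENNReal.ofReal (δ / C * 204) := by
    intro i j hij hlt
    cases F
    · refine (prob_pairDev_bernoulli hC0 hδ0 hμ _ hij).trans (ENNReal.ofReal_le_ofReal ?_)
      have : 0 ≤ δ / C := by positivity
      linarith
    · exact prob_pairDev_poisson hC1 hδ hμ _ hij hlt
  refine (prob_errorEvent_le hμ ρ (fun k => prob_oneDev_le hC1 hδ hμ _ k) hpair).trans ?_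
  rw [← ENNReal.ofReal_natCast, ← ENNReal.ofReal_natCast, ← ENNReal.ofReal_mul (by positivity),
    ← ENNReal.ofReal_mul (by positivity), ← ENNReal.ofReal_add (by positivity) (by positivity)]
  refine ENNReal.ofReal_le_ofReal ?_
  calc (K : ℝ) * (2 * (δ / C)) + (K - 1 : ℕ) * (δ / C * 204)
      = δ / C * (K * 2 + (K - 1 : ℕ) * 204) := by ring
    _ ≤ δ / C * C := by gcongr
    _ = δ := by field_simp

/-! ### The information needed to separate two means -/

/-- The mean of the mixture with weights proportional to `1` and `x`. -/
def mix (a b x : ℝ) : ℝ := (a + x * b) / (1 + x)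

lemma mix_eq {a b x : ℝ} (hx : 0 ≤ x) : mix a b x = b + (a - b) / (1 + x) := by
  unfold mix; field_simp; ring

lemma mix_zero (a b : ℝ) : mix a b 0 = a := by simp [mix]

lemma mix_between {a b x : ℝ} (hx : 0 ≤ x) (hab : a < b) : a ≤ mix a b x ∧ mix a b x < b := by
  unfold mix
  constructor
  · rw [le_div_iff₀ (by linarith)]; nlinarith
  · rw [div_lt_iff₀ (by linarith)]; nlinarith

lemma mix_between' {a b x : ℝ} (hx : 0 ≤ x) (hab : b < a) : b < mix a b x ∧ mix a b x ≤ a := by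
  unfold mix
  constructor
  · rw [lt_div_iff₀ (by linarith)]; nlinarith
  · rw [div_le_iff₀ (by linarith)]; nlinarith

lemma mix_ne_right {a b x : ℝ} (hx : 0 ≤ x) (hab : a ≠ b) : mix a b x ≠ b := by
  rcases hab.lt_or_gt with h | h
  · exact (mix_between hx h).2.ne
  · exact (mix_between' hx h).1.ne'

lemma mix_mem {F : Family} {a b x : ℝ} (ha : a ∈ F.means) (hb : b ∈ F.means) (hx : 0 ≤ x) :
    mix a b x ∈ F.means := by
  rcases lt_trichotomy a b with h | rfl | h
  · exact F.means_ordConnected.out ha hb ⟨(mix_between hx h).1, (mix_between hx h).2.le⟩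
  · have : mix a a x = a := by unfold mix; field_simp
    rwa [this]
  · exact F.means_ordConnected.out hb ha ⟨(mix_between' hx h).1.le, (mix_between' hx h).2⟩

lemma mix_lt_mix {a b x x' : ℝ} (hx : 0 ≤ x) (hxx : x < x') (hab : a < b) :
    mix a b x < mix a b x' := by
  rw [mix_eq hx, mix_eq (hx.trans hxx.le)]
  have : (b - a) / (1 + x') < (b - a) / (1 + x) := by
    apply div_lt_div_of_pos_left <;> linarith
  have e : ∀ u, (a - b) / u = -((b - a) / u) := fun u => by rw [← neg_sub b a, neg_div]
  rw [e, e]; linarith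

lemma mix_lt_mix' {a b x x' : ℝ} (hx : 0 ≤ x) (hxx : x < x') (hab : b < a) :
    mix a b x' < mix a b x := by
  rw [mix_eq hx, mix_eq (hx.trans hxx.le)]
  have : (a - b) / (1 + x') < (a - b) / (1 + x) := by
    apply div_lt_div_of_pos_left <;> linarith
  linarith

lemma tendsto_mix {α : Type*} {l : Filter α} {f g u : α → ℝ} {a b x : ℝ}
    (hf : Tendsto f l (𝓝 a)) (hg : Tendsto g l (𝓝 b)) (hu : Tendsto u l (𝓝 x)) (hx : 0 ≤ x) :
    Tendsto (fun i => mix (f i) (g i) (u i)) l (𝓝 (mix a b x)) :=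
  (hf.add (hu.mul hg)).div (tendsto_const_nhds.add hu) (by linarith)

lemma tendsto_mix_atTop (a b : ℝ) : Tendsto (mix a b) atTop (𝓝 b) := by
  have h1 : Tendsto (fun x : ℝ => b + (a - b) / (1 + x)) atTop (𝓝 (b + 0)) :=
    tendsto_const_nhds.add ((tendsto_atTop_add_const_left _ 1 tendsto_id).const_div_atTop (a - b))
  rw [add_zero] at h1
  refine h1.congr' ?_
  filter_upwards [eventually_ge_atTop 0] with x hx
  rw [mix_eq hx]

/-- The information function `g` as a function of the two means. -/
def pairG (F : Family) (a b x : ℝ) : ℝ := F.dExp a (mix a b x) + x * F.dExp b (mix a b x)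

lemma g_eq_pairG {F : Family} {μ : Fin K → ℝ} {j k : Fin K} (hj : μ j ∈ F.means)
    (hk : μ k ∈ F.means) {x : ℝ} (hx : 0 ≤ x) : g F μ j k x = pairG F (μ k) (μ j) x := by
  have hm := mix_mem hk hj hx
  simp only [g, pairG]
  rw [← mix, Family.d_eq (F.means_subset_closedMeans hk) hm,
    Family.d_eq (F.means_subset_closedMeans hj) hm]

/-- The compensation identity. -/
lemma pairG_add {F : Family} {a b x : ℝ} (hx : 0 ≤ x) (m : ℝ) :
    pairG F a b x + (1 + x) * F.dExp (mix a b x) m = F.dExp a m + x * F.dExp b m := by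
  have hmix : (1 + x) * mix a b x = a + x * b := by unfold mix; field_simp
  have h := F.mul_natParam_sub_logPart (mix a b x)
  simp only [pairG, Family.dExp]
  rw [← h]
  linear_combination (F.natParam (mix a b x) - F.natParam m) * hmix

/-- By the compensation identity the mixture mean minimizes the cost of moving both means to a
common value; the excess is `1 + x` times a divergence. -/
lemma pairG_le {F : Family} {a b x m : ℝ} (ha : a ∈ F.means) (hb : b ∈ F.means) (hx : 0 ≤ x)
    (hm : m ∈ F.means) : pairG F a b x ≤ F.dExp a m + x * F.dExp b m := by
  rw [← pairG_add hx m]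
  have := Family.dExp_nonneg_of_mem (mix_mem ha hb hx) hm
  nlinarith

lemma pairG_zero (F : Family) (a b : ℝ) : pairG F a b 0 = 0 := by
  simp [pairG, mix_zero, Family.dExp_self]

lemma pairG_lt {F : Family} {a b x : ℝ} (ha : a ∈ F.means) (hb : b ∈ F.means) (hab : a ≠ b)
    (hx : 0 ≤ x) : pairG F a b x < F.dExp a b := by
  have h := pairG_add (F := F) (a := a) (b := b) hx b
  have := Family.dExp_pos_of_mem (mix_mem ha hb hx) hb (mix_ne_right hx hab)
  rw [Family.dExp_self, mul_zero, add_zero] at h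
  nlinarith

/-- `pairG` is a minimum of affine functions of `x` with slope `dExp b m`. Inserting the minimizer
for the larger `x'` into the problem for `x` saves `(x' - x) dExp b m > 0`. -/
lemma pairG_strictMonoOn {F : Family} {a b : ℝ} (ha : a ∈ F.means) (hb : b ∈ F.means)
    (hab : a ≠ b) : StrictMonoOn (pairG F a b) (Set.Ici 0) := by
  intro x hx x' hx' hxx
  have h1 := pairG_le ha hb hx (mix_mem ha hb hx')
  have h2 := Family.dExp_pos_of_mem hb (mix_mem ha hb hx') (mix_ne_right hx' hab).symm
  have h3 : pairG F a b x' = F.dExp a (mix a b x') + x' * F.dExp b (mix a b x') := rfl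
  nlinarith

lemma pairG_pos {F : Family} {a b x : ℝ} (ha : a ∈ F.means) (hb : b ∈ F.means) (hab : a ≠ b)
    (hx : 0 < x) : 0 < pairG F a b x := by
  rw [← pairG_zero F a b]
  exact pairG_strictMonoOn ha hb hab Set.self_mem_Ici hx.le hx

lemma tendsto_pairG {F : Family} {α : Type*} {l : Filter α} {f g u : α → ℝ} {a b x : ℝ}
    (hf : Tendsto f l (𝓝 a)) (hg : Tendsto g l (𝓝 b)) (hu : Tendsto u l (𝓝 x))
    (ha : a ∈ F.means) (hb : b ∈ F.means) (hx : 0 ≤ x) :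
    Tendsto (fun i => pairG F (f i) (g i) (u i)) l (𝓝 (pairG F a b x)) := by
  have hm := tendsto_mix hf hg hu hx
  have hmem := mix_mem ha hb hx
  exact (Family.tendsto_dExp hf hm hmem).add (hu.mul (Family.tendsto_dExp hg hm hmem))

/-- As `x` grows the mixture tends to `b`, so the first term of `pairG` alone exceeds any level
below `dExp a b`; conclude by continuity. -/
lemma exists_pairG_eq {F : Family} {a b y : ℝ} (ha : a ∈ F.means) (hb : b ∈ F.means)
    (hy0 : 0 ≤ y) (hy : y < F.dExp a b) : ∃ x, 0 ≤ x ∧ pairG F a b x = y := by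
  have h1 : Tendsto (fun x => F.dExp a (mix a b x)) atTop (𝓝 (F.dExp a b)) :=
    Family.tendsto_dExp tendsto_const_nhds (tendsto_mix_atTop a b) hb
  obtain ⟨x₁, hx₁, hx₁0⟩ := ((h1.eventually (lt_mem_nhds hy)).and (eventually_ge_atTop 0)).exists
  have hle : y ≤ pairG F a b x₁ := by
    have := mul_nonneg hx₁0 (Family.dExp_nonneg_of_mem hb (mix_mem ha hb hx₁0))
    unfold pairG; linarith
  have hcont : ContinuousOn (pairG F a b) (Set.Icc 0 x₁) := fun x hx =>
    (tendsto_pairG tendsto_const_nhds tendsto_const_nhds tendsto_id ha hb hx.1).mono_left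
      nhdsWithin_le_nhds
  obtain ⟨x, hx, hxy⟩ := intermediate_value_Icc hx₁0 hcont
    (show y ∈ Set.Icc _ _ from ⟨by rw [pairG_zero]; exact hy0, hle⟩)
  exact ⟨x, hx.1, hxy⟩

/-- The ratio of the two divergences to the mixture. -/
def divRatio (F : Family) (a b x : ℝ) : ℝ := F.dExp a (mix a b x) / F.dExp b (mix a b x)

lemma divRatio_zero (F : Family) (a b : ℝ) : divRatio F a b 0 = 0 := by
  simp [divRatio, mix_zero, Family.dExp_self]

lemma divRatio_nonneg {F : Family} {a b x : ℝ} (ha : a ∈ F.means) (hb : b ∈ F.means)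
    (hx : 0 ≤ x) : 0 ≤ divRatio F a b x :=
  div_nonneg (Family.dExp_nonneg_of_mem ha (mix_mem ha hb hx))
    (Family.dExp_nonneg_of_mem hb (mix_mem ha hb hx))

lemma tendsto_divRatio {F : Family} {α : Type*} {l : Filter α} {f g u : α → ℝ} {a b x : ℝ}
    (hf : Tendsto f l (𝓝 a)) (hg : Tendsto g l (𝓝 b)) (hu : Tendsto u l (𝓝 x))
    (ha : a ∈ F.means) (hb : b ∈ F.means) (hab : a ≠ b) (hx : 0 ≤ x) :
    Tendsto (fun i => divRatio F (f i) (g i) (u i)) l (𝓝 (divRatio F a b x)) := by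
  have hm := tendsto_mix hf hg hu hx
  have hmem := mix_mem ha hb hx
  exact (Family.tendsto_dExp hf hm hmem).div (Family.tendsto_dExp hg hm hmem)
    (Family.dExp_pos_of_mem hb hmem (mix_ne_right hx hab).symm).ne'

/-- The mixture moves from `a` towards `b`, so the numerator increases and the denominator
decreases. -/
lemma divRatio_strictMonoOn {F : Family} {a b : ℝ} (ha : a ∈ F.means) (hb : b ∈ F.means)
    (hab : a ≠ b) : StrictMonoOn (divRatio F a b) (Set.Ici 0) := by
  intro x hx x' hx' hxx
  have hm := mix_mem ha hb hx
  have hm' := mix_mem ha hb hx'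
  have hx : 0 ≤ x := hx
  have hx' : 0 ≤ x' := hx'
  have h1 : F.dExp a (mix a b x) < F.dExp a (mix a b x') := by
    apply Family.dExp_lt_right hm hm'
    rcases hab.lt_or_gt with h | h
    · exact Or.inl ⟨(mix_between hx h).1, mix_lt_mix hx hxx h⟩
    · exact Or.inr ⟨(mix_between' hx h).2, mix_lt_mix' hx hxx h⟩
  have h2 : F.dExp b (mix a b x') < F.dExp b (mix a b x) := by
    apply Family.dExp_lt_right hm' hm
    rcases hab.lt_or_gt with h | h
    · exact Or.inr ⟨(mix_between hx' h).2.le, mix_lt_mix hx hxx h⟩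
    · exact Or.inl ⟨(mix_between' hx' h).1.le, mix_lt_mix' hx hxx h⟩
  have h3 := Family.dExp_pos_of_mem hb hm' (mix_ne_right hx' hab).symm
  have h4 := Family.dExp_nonneg_of_mem ha hm
  unfold divRatio
  exact div_lt_div₀ h1 h2.le (h4.trans h1.le) h3

lemma exists_one_lt_divRatio {F : Family} {a b : ℝ} (ha : a ∈ F.means) (hb : b ∈ F.means)
    (hab : a ≠ b) : ∃ x, 0 ≤ x ∧ 1 < divRatio F a b x := by
  have h1 : Tendsto (fun x => F.dExp a (mix a b x)) atTop (𝓝 (F.dExp a b)) :=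
    Family.tendsto_dExp tendsto_const_nhds (tendsto_mix_atTop a b) hb
  have h2 : Tendsto (fun x => F.dExp b (mix a b x)) atTop (𝓝 (F.dExp b b)) :=
    Family.tendsto_dExp tendsto_const_nhds (tendsto_mix_atTop a b) hb
  rw [Family.dExp_self] at h2
  have hpos := Family.dExp_pos_of_mem ha hb hab
  obtain ⟨x, ⟨hx1, hx2⟩, hx0⟩ := ((h1.eventually (lt_mem_nhds (half_lt_self hpos))).and
    (h2.eventually (gt_mem_nhds (half_pos hpos)))).and (eventually_ge_atTop 0) |>.exists
  refine ⟨x, hx0, ?_⟩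
  have h3 := Family.dExp_pos_of_mem hb (mix_mem ha hb hx0) (mix_ne_right hx0 hab).symm
  unfold divRatio
  rw [lt_div_iff₀ h3]
  linarith

lemma eventually_ne_of_tendsto {α : Type*} {l : Filter α} {f g : α → ℝ} {a b : ℝ}
    (hf : Tendsto f l (𝓝 a)) (hg : Tendsto g l (𝓝 b)) (hab : a ≠ b) : ∀ᶠ i in l, f i ≠ g i := by
  filter_upwards [(hf.sub hg).eventually_ne (sub_ne_zero.2 hab)] with i hi
  exact sub_ne_zero.1 hi

/-! ### The inverse information function and the equilibrium -/

section Equilibrium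

variable {F : Family} {μ : Fin K → ℝ}

lemma xInv_self (F : Family) (μ : Fin K → ℝ) (k : Fin K) (y : ℝ) : xInv F μ k k y = 1 := if_pos rfl

/-- The level must stay below `dExp (μ k) (μ j)`, the supremum of `pairG`; only there is the value
chosen by `Function.invFunOn` an actual inverse. -/
lemma xInv_spec {j k : Fin K} (hj : μ j ∈ F.means) (hk : μ k ∈ F.means) (hne : μ j ≠ μ k)
    {y : ℝ} (hy0 : 0 ≤ y) (hy : y < F.dExp (μ k) (μ j)) :
    0 ≤ xInv F μ j k y ∧ pairG F (μ k) (μ j) (xInv F μ j k y) = y := by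
  have hjk : j ≠ k := fun e => hne (by rw [e])
  have hex : ∃ x ∈ Set.Ici (0 : ℝ), g F μ j k x = y := by
    obtain ⟨x, hx, hxy⟩ := exists_pairG_eq hk hj hy0 hy
    exact ⟨x, hx, by rw [g_eq_pairG hj hk hx, hxy]⟩
  rw [xInv, if_neg hjk]
  have h0 : Function.invFunOn (g F μ j k) (Set.Ici 0) y ∈ Set.Ici 0 := Function.invFunOn_mem hex
  exact ⟨h0, by rw [← g_eq_pairG hj hk h0]; exact Function.invFunOn_eq hex⟩

lemma xInv_pos {j k : Fin K} (hj : μ j ∈ F.means) (hk : μ k ∈ F.means) (hne : μ j ≠ μ k)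
    {y : ℝ} (hy0 : 0 < y) (hy : y < F.dExp (μ k) (μ j)) : 0 < xInv F μ j k y := by
  obtain ⟨h1, h2⟩ := xInv_spec hj hk hne hy0.le hy
  rcases h1.lt_or_eq with h | h
  · exact h
  · rw [← h, pairG_zero] at h2
    exact absurd h2 hy0.ne

lemma lt_xInv_iff {j k : Fin K} (hj : μ j ∈ F.means) (hk : μ k ∈ F.means) (hne : μ j ≠ μ k)
    {y : ℝ} (hy0 : 0 ≤ y) (hy : y < F.dExp (μ k) (μ j)) {x : ℝ} (hx : 0 ≤ x) :
    x < xInv F μ j k y ↔ pairG F (μ k) (μ j) x < y := by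
  obtain ⟨h1, h2⟩ := xInv_spec hj hk hne hy0 hy
  conv_rhs => rw [← h2]
  exact ((pairG_strictMonoOn hk hj hne.symm).lt_iff_lt hx h1).symm

lemma xInv_lt_iff {j k : Fin K} (hj : μ j ∈ F.means) (hk : μ k ∈ F.means) (hne : μ j ≠ μ k)
    {y : ℝ} (hy0 : 0 ≤ y) (hy : y < F.dExp (μ k) (μ j)) {x : ℝ} (hx : 0 ≤ x) :
    xInv F μ j k y < x ↔ y < pairG F (μ k) (μ j) x := by
  obtain ⟨h1, h2⟩ := xInv_spec hj hk hne hy0 hy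
  conv_rhs => rw [← h2]
  exact ((pairG_strictMonoOn hk hj hne.symm).lt_iff_lt h1 hx).symm

/-- Since `pairG` increases in `x`, comparing `x` with the inverse is comparing `pairG` at `x` with
the level. That strict comparison is stable under perturbation, because `pairG` is jointly
continuous. -/
lemma tendsto_xInv {α : Type*} {l : Filter α} {ν : α → Fin K → ℝ} {y : α → ℝ} {y₀ : ℝ}
    (hν : Tendsto ν l (𝓝 μ)) (hy : Tendsto y l (𝓝 y₀)) {j k : Fin K} (hj : μ j ∈ F.means)
    (hk : μ k ∈ F.means) (hne : μ j ≠ μ k) (hy0 : 0 < y₀) (hy1 : y₀ < F.dExp (μ k) (μ j)) :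
    Tendsto (fun i => xInv F (ν i) j k (y i)) l (𝓝 (xInv F μ j k y₀)) := by
  have hνj : Tendsto (fun i => ν i j) l (𝓝 (μ j)) := ((continuous_apply j).tendsto μ).comp hν
  have hνk : Tendsto (fun i => ν i k) l (𝓝 (μ k)) := ((continuous_apply k).tendsto μ).comp hν
  have e1 : ∀ᶠ i in l, ν i j ∈ F.means := hνj.eventually (F.isOpen_means.mem_nhds hj)
  have e2 : ∀ᶠ i in l, ν i k ∈ F.means := hνk.eventually (F.isOpen_means.mem_nhds hk)
  have e3 : ∀ᶠ i in l, ν i j ≠ ν i k := eventually_ne_of_tendsto hνj hνk hne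
  have e4 : ∀ᶠ i in l, 0 < y i := hy.eventually (lt_mem_nhds hy0)
  have e5 : ∀ᶠ i in l, y i < F.dExp (ν i k) (ν i j) :=
    hy.eventually_lt (Family.tendsto_dExp hνk hνj hj) hy1
  have hG : ∀ x, 0 ≤ x → Tendsto (fun i => pairG F (ν i k) (ν i j) x) l
      (𝓝 (pairG F (μ k) (μ j) x)) := fun x hx =>
    tendsto_pairG hνk hνj tendsto_const_nhds hk hj hx
  rw [tendsto_order]
  constructor
  · intro x hx
    rcases lt_or_ge x 0 with hx0 | hx0
    · filter_upwards [e1, e2, e3, e4, e5] with i h1 h2 h3 h4 h5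
      exact hx0.trans_le (xInv_spec h1 h2 h3 h4.le h5).1
    · rw [lt_xInv_iff hj hk hne hy0.le hy1 hx0] at hx
      filter_upwards [e1, e2, e3, e4, e5, (hG x hx0).eventually_lt hy hx] with i h1 h2 h3 h4 h5 h6
      exact (lt_xInv_iff h1 h2 h3 h4.le h5 hx0).2 h6
  · intro x hx
    have hx0 : 0 ≤ x := (xInv_spec hj hk hne hy0.le hy1).1.trans hx.le
    replace hx := (xInv_lt_iff hj hk hne hy0.le hy1 hx0).1 hx
    filter_upwards [e1, e2, e3, e4, e5, hy.eventually_lt (hG x hx0) hx] with i h1 h2 h3 h4 h5 h6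
    exact (xInv_lt_iff h1 h2 h3 h4.le h5 hx0).2 h6

lemma equilibrium_eq {k : Fin K} {S : Finset (Fin K)} (hk : μ k ∈ F.means)
    (hS : ∀ j ∈ S, μ j ∈ F.means ∧ μ j ≠ μ k) {y : ℝ} (hy0 : 0 ≤ y)
    (hy : ∀ j ∈ S, y < F.dExp (μ k) (μ j)) :
    equilibrium F μ k S y = ∑ j ∈ S, divRatio F (μ k) (μ j) (xInv F μ j k y) := by
  refine Finset.sum_congr rfl fun j hj => ?_
  have hx := (xInv_spec (hS j hj).1 hk (hS j hj).2 hy0 (hy j hj)).1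
  have hm := mix_mem hk (hS j hj).1 hx
  rw [← mix, Family.d_eq (F.means_subset_closedMeans hk) hm,
    Family.d_eq (F.means_subset_closedMeans (hS j hj).1) hm, divRatio]

lemma equilibrium_lt {k : Fin K} {S : Finset (Fin K)} (hk : μ k ∈ F.means)
    (hS : ∀ j ∈ S, μ j ∈ F.means ∧ μ j ≠ μ k) (hne : S.Nonempty) {y y' : ℝ} (hy0 : 0 ≤ y)
    (hyy : y < y') (hy : ∀ j ∈ S, y' < F.dExp (μ k) (μ j)) :
    equilibrium F μ k S y < equilibrium F μ k S y' := by
  have hy1 : ∀ j ∈ S, y < F.dExp (μ k) (μ j) := fun j hj => hyy.trans (hy j hj)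
  rw [equilibrium_eq hk hS hy0 hy1, equilibrium_eq hk hS (hy0.trans hyy.le) hy]
  refine Finset.sum_lt_sum_of_nonempty hne fun j hj => ?_
  obtain ⟨h1, h2⟩ := xInv_spec (hS j hj).1 hk (hS j hj).2 hy0 (hy1 j hj)
  obtain ⟨h3, h4⟩ := xInv_spec (hS j hj).1 hk (hS j hj).2 (hy0.trans hyy.le) (hy j hj)
  refine divRatio_strictMonoOn hk (hS j hj).1 (hS j hj).2.symm h1 h3 ?_
  rw [lt_xInv_iff (hS j hj).1 hk (hS j hj).2 (hy0.trans hyy.le) (hy j hj) h1, h2]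
  exact hyy

lemma tendsto_equilibrium {α : Type*} {l : Filter α} {ν : α → Fin K → ℝ} {y : α → ℝ} {y₀ : ℝ}
    (hν : Tendsto ν l (𝓝 μ)) (hy : Tendsto y l (𝓝 y₀)) {k : Fin K} {S : Finset (Fin K)}
    (hk : μ k ∈ F.means) (hS : ∀ j ∈ S, μ j ∈ F.means ∧ μ j ≠ μ k) (hy0 : 0 < y₀)
    (hy1 : ∀ j ∈ S, y₀ < F.dExp (μ k) (μ j)) :
    Tendsto (fun i => equilibrium F (ν i) k S (y i)) l (𝓝 (equilibrium F μ k S y₀)) := by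
  have hνj : ∀ j, Tendsto (fun i => ν i j) l (𝓝 (μ j)) := fun j =>
    ((continuous_apply j).tendsto μ).comp hν
  rw [equilibrium_eq hk hS hy0.le hy1]
  have h : Tendsto (fun i => ∑ j ∈ S, divRatio F (ν i k) (ν i j) (xInv F (ν i) j k (y i))) l
      (𝓝 (∑ j ∈ S, divRatio F (μ k) (μ j) (xInv F μ j k y₀))) :=
    tendsto_finsetSum _ fun j hj => tendsto_divRatio (hνj k) (hνj j)
      (tendsto_xInv hν hy (hS j hj).1 hk (hS j hj).2 hy0 (hy1 j hj)) hk (hS j hj).1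
      (hS j hj).2.symm (xInv_spec (hS j hj).1 hk (hS j hj).2 hy0.le (hy1 j hj)).1
  refine h.congr' ?_
  have e1 : ∀ᶠ i in l, ν i k ∈ F.means := (hνj k).eventually (F.isOpen_means.mem_nhds hk)
  have e2 : ∀ᶠ i in l, 0 < y i := hy.eventually (lt_mem_nhds hy0)
  have e3 : ∀ᶠ i in l, ∀ j ∈ S, (ν i j ∈ F.means ∧ ν i j ≠ ν i k) ∧ y i < F.dExp (ν i k) (ν i j) := by
    rw [eventually_all_finset]
    intro j hj
    filter_upwards [(hνj j).eventually (F.isOpen_means.mem_nhds (hS j hj).1),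
      eventually_ne_of_tendsto (hνj j) (hνj k) (hS j hj).2,
      hy.eventually_lt (Family.tendsto_dExp (hνj k) (hνj j) (hS j hj).1) (hy1 j hj)] with i h1 h2 h3
    exact ⟨⟨h1, h2⟩, h3⟩
  filter_upwards [e1, e2, e3] with i h1 h2 h3
  rw [equilibrium_eq h1 (fun j hj => (h3 j hj).1) h2.le fun j hj => (h3 j hj).2]

/-- Intermediate value theorem: at small levels every ratio is below `1 / |S|`, while for the slice
nearest in divergence some level in the common domain makes its ratio alone exceed `1`. -/
lemma exists_equilibrium_eq_one {k : Fin K} {S : Finset (Fin K)} (hk : μ k ∈ F.means)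
    (hS : ∀ j ∈ S, μ j ∈ F.means ∧ μ j ≠ μ k) (hne : S.Nonempty) :
    ∃ y, 0 < y ∧ (∀ j ∈ S, y < F.dExp (μ k) (μ j)) ∧ equilibrium F μ k S y = 1 := by
  -- Levels reached by this slice are below all the divergences `dExp (μ k) (μ j)`, so every inverse
  -- is defined there.
  obtain ⟨j₀, hj₀, hmin⟩ := Finset.exists_min_image S (fun j => F.dExp (μ k) (μ j)) hne
  obtain ⟨x₁, hx₁, hR⟩ := exists_one_lt_divRatio hk (hS j₀ hj₀).1 (hS j₀ hj₀).2.symm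
  set y₁ := pairG F (μ k) (μ j₀) x₁ with hy₁
  have hy₁lt : ∀ j ∈ S, y₁ < F.dExp (μ k) (μ j) := fun j hj =>
    (pairG_lt hk (hS j₀ hj₀).1 (hS j₀ hj₀).2.symm hx₁).trans_le (hmin j hj)
  have hx₁0 : 0 < x₁ := by
    rcases hx₁.lt_or_eq with h | h
    · exact h
    · rw [← h, divRatio_zero] at hR; linarith
  have hy₁0 : 0 < y₁ := pairG_pos hk (hS j₀ hj₀).1 (hS j₀ hj₀).2.symm hx₁0
  have hxy₁ : xInv F μ j₀ k y₁ = x₁ := by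
    obtain ⟨h1, h2⟩ := xInv_spec (hS j₀ hj₀).1 hk (hS j₀ hj₀).2 hy₁0.le (hy₁lt j₀ hj₀)
    exact (pairG_strictMonoOn hk (hS j₀ hj₀).1 (hS j₀ hj₀).2.symm).injOn h1 hx₁ h2
  have hE₁ : 1 < equilibrium F μ k S y₁ := by
    rw [equilibrium_eq hk hS hy₁0.le hy₁lt]
    refine lt_of_lt_of_le ?_ (Finset.single_le_sum
      (f := fun j => divRatio F (μ k) (μ j) (xInv F μ j k y₁)) (fun j hj => divRatio_nonneg hk
        (hS j hj).1 (xInv_spec (hS j hj).1 hk (hS j hj).2 hy₁0.le (hy₁lt j hj)).1) hj₀)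
    simp only [hxy₁]; exact hR
  have hsmall : ∀ᶠ x in 𝓝[>] (0 : ℝ), ∀ j ∈ S, divRatio F (μ k) (μ j) x < 1 / (S.card : ℝ) := by
    rw [eventually_all_finset]
    intro j hj
    have h := tendsto_divRatio (F := F) (a := μ k) (b := μ j) tendsto_const_nhds tendsto_const_nhds
      (tendsto_id (x := 𝓝 (0 : ℝ))) hk (hS j hj).1 (hS j hj).2.symm le_rfl
    rw [divRatio_zero] at h
    have hc : (0 : ℝ) < 1 / S.card := by
      have := hne.card_pos
      positivity
    exact (h.mono_left nhdsWithin_le_nhds).eventually (gt_mem_nhds hc)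
  obtain ⟨x₂, hx₂, hx₂0⟩ := (hsmall.and self_mem_nhdsWithin).exists
  have hx₂0 : 0 < x₂ := hx₂0
  obtain ⟨j₁, hj₁, hmin₁⟩ := Finset.exists_min_image S (fun j => pairG F (μ k) (μ j) x₂) hne
  set y₂ := min (pairG F (μ k) (μ j₁) x₂) y₁ with hy₂
  have hy₂0 : 0 < y₂ := lt_min (pairG_pos hk (hS j₁ hj₁).1 (hS j₁ hj₁).2.symm hx₂0) hy₁0
  have hy₂lt : ∀ j ∈ S, y₂ < F.dExp (μ k) (μ j) := fun j hj =>
    (min_le_right _ _).trans_lt (hy₁lt j hj)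
  have hE₂ : equilibrium F μ k S y₂ < 1 := by
    rw [equilibrium_eq hk hS hy₂0.le hy₂lt]
    have hcard : ∑ _j ∈ S, 1 / (S.card : ℝ) = 1 := by
      have := hne.card_pos
      rw [Finset.sum_const, nsmul_eq_mul]; field_simp
    rw [← hcard]
    refine Finset.sum_lt_sum_of_nonempty hne fun j hj => ?_
    refine lt_of_le_of_lt ?_ (hx₂ j hj)
    obtain ⟨h1, h2⟩ := xInv_spec (hS j hj).1 hk (hS j hj).2 hy₂0.le (hy₂lt j hj)
    refine (divRatio_strictMonoOn hk (hS j hj).1 (hS j hj).2.symm).monotoneOn h1 hx₂0.le ?_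
    by_contra hcon
    rw [not_le, lt_xInv_iff (hS j hj).1 hk (hS j hj).2 hy₂0.le (hy₂lt j hj) hx₂0.le] at hcon
    exact absurd ((min_le_left _ _).trans (hmin₁ j hj)) (not_le.2 hcon)
  have hcont : ContinuousOn (equilibrium F μ k S) (Set.Icc y₂ y₁) := fun y hy =>
    (tendsto_equilibrium (tendsto_const_nhds (x := μ)) tendsto_id hk hS (hy₂0.trans_le hy.1)
      fun j hj => hy.2.trans_lt (hy₁lt j hj)).mono_left nhdsWithin_le_nhds
  obtain ⟨y, hy, hy1⟩ := intermediate_value_Icc (min_le_right _ _) hcont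
    (show (1 : ℝ) ∈ Set.Icc _ _ from ⟨hE₂.le, hE₁.le⟩)
  exact ⟨y, hy₂0.trans_le hy.1, fun j hj => hy.2.trans_lt (hy₁lt j hj), hy1⟩

/-- The equilibrium function is strictly increasing, so the set in the infimum is a singleton. -/
lemma ySol_spec {k : Fin K} {S : Finset (Fin K)} (hk : μ k ∈ F.means)
    (hS : ∀ j ∈ S, μ j ∈ F.means ∧ μ j ≠ μ k) (hne : S.Nonempty) :
    0 < ySol F μ k S ∧ (∀ j ∈ S, ySol F μ k S < F.dExp (μ k) (μ j)) ∧
      equilibrium F μ k S (ySol F μ k S) = 1 := by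
  obtain ⟨y, hy0, hy1, hy2⟩ := exists_equilibrium_eq_one hk hS hne
  have hd : ∀ j ∈ S, F.d (μ k) (μ j) = F.dExp (μ k) (μ j) := fun j hj =>
    Family.d_eq (F.means_subset_closedMeans hk) (hS j hj).1
  have hset : {y | 0 < y ∧ (∀ j ∈ S, y < F.d (μ k) (μ j)) ∧ equilibrium F μ k S y = 1} = {y} := by
    ext y'
    simp only [Set.mem_ofPred_eq, Set.mem_singleton_iff]
    constructor
    · rintro ⟨h1, h2, h3⟩
      have h2' : ∀ j ∈ S, y' < F.dExp (μ k) (μ j) := fun j hj => by rw [← hd j hj]; exact h2 j hj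
      rcases lt_trichotomy y' y with h | h | h
      · have := equilibrium_lt hk hS hne h1.le h hy1
        linarith
      · exact h
      · have := equilibrium_lt hk hS hne hy0.le h h2'
        linarith
    · rintro rfl
      exact ⟨hy0, fun j hj => by rw [hd j hj]; exact hy1 j hj, hy2⟩
  rw [ySol, hset, csInf_singleton]
  exact ⟨hy0, hy1, hy2⟩

/-- A strictly increasing function crosses `1` at a point depending continuously on parameters: the
strict inequalities at levels on both sides persist nearby. -/
lemma tendsto_ySol {α : Type*} {l : Filter α} {ν : α → Fin K → ℝ} (hν : Tendsto ν l (𝓝 μ))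
    {k : Fin K} {S : Finset (Fin K)} (hk : μ k ∈ F.means)
    (hS : ∀ j ∈ S, μ j ∈ F.means ∧ μ j ≠ μ k) (hne : S.Nonempty) :
    Tendsto (fun i => ySol F (ν i) k S) l (𝓝 (ySol F μ k S)) := by
  have hνj : ∀ j, Tendsto (fun i => ν i j) l (𝓝 (μ j)) := fun j =>
    ((continuous_apply j).tendsto μ).comp hν
  obtain ⟨hY0, hY1, hY2⟩ := ySol_spec hk hS hne
  have e1 : ∀ᶠ i in l, ν i k ∈ F.means := (hνj k).eventually (F.isOpen_means.mem_nhds hk)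
  have e2 : ∀ᶠ i in l, ∀ j ∈ S, ν i j ∈ F.means ∧ ν i j ≠ ν i k := by
    rw [eventually_all_finset]
    intro j hj
    exact ((hνj j).eventually (F.isOpen_means.mem_nhds (hS j hj).1)).and
      (eventually_ne_of_tendsto (hνj j) (hνj k) (hS j hj).2)
  have e3 : ∀ c : ℝ, (∀ j ∈ S, c < F.dExp (μ k) (μ j)) →
      ∀ᶠ i in l, ∀ j ∈ S, c < F.dExp (ν i k) (ν i j) := by
    intro c hc
    rw [eventually_all_finset]
    exact fun j hj => (Family.tendsto_dExp (hνj k) (hνj j) (hS j hj).1).eventually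
      (lt_mem_nhds (hc j hj))
  rw [tendsto_order]
  constructor
  · intro c hc
    rcases le_or_gt c 0 with hc0 | hc0
    · filter_upwards [e1, e2] with i h1 h2
      exact hc0.trans_lt (ySol_spec h1 h2 hne).1
    · have hc1 : ∀ j ∈ S, c < F.dExp (μ k) (μ j) := fun j hj => hc.trans (hY1 j hj)
      have hlt := equilibrium_lt hk hS hne hc0.le hc hY1
      rw [hY2] at hlt
      filter_upwards [e1, e2, e3 c hc1, (tendsto_equilibrium hν tendsto_const_nhds hk hS hc0
        hc1).eventually (gt_mem_nhds hlt)] with i h1 h2 h3 h4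
      obtain ⟨g1, g2, g3⟩ := ySol_spec h1 h2 hne
      by_contra hcon
      rcases (not_lt.1 hcon).lt_or_eq with h | h
      · have := equilibrium_lt h1 h2 hne g1.le h h3
        linarith
      · rw [h] at g3; linarith
  · intro c hc
    -- The level `c` may lie outside the domain of the equilibrium function; a smaller one inside it
    -- serves as upper barrier.
    obtain ⟨c', hc'1, hc'2, hc'3⟩ : ∃ c', ySol F μ k S < c' ∧ c' ≤ c ∧
        ∀ j ∈ S, c' < F.dExp (μ k) (μ j) := by
      obtain ⟨j₀, hj₀, hmin⟩ := Finset.exists_min_image S (fun j => F.dExp (μ k) (μ j)) hne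
      obtain ⟨c', h1, h2⟩ := exists_between (lt_min hc (hY1 j₀ hj₀))
      exact ⟨c', h1, (h2.trans_le (min_le_left _ _)).le, fun j hj =>
        (h2.trans_le (min_le_right _ _)).trans_le (hmin j hj)⟩
    have hlt := equilibrium_lt hk hS hne hY0.le hc'1 hc'3
    rw [hY2] at hlt
    filter_upwards [e1, e2, (tendsto_equilibrium hν tendsto_const_nhds hk hS (hY0.trans hc'1)
      hc'3).eventually (lt_mem_nhds hlt)] with i h1 h2 h4
    obtain ⟨g1, g2, g3⟩ := ySol_spec h1 h2 hne
    refine lt_of_lt_of_le ?_ hc'2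
    by_contra hcon
    rcases (not_lt.1 hcon).lt_or_eq with h | h
    · have := equilibrium_lt h1 h2 hne (hY0.trans hc'1).le h g2
      linarith
    · rw [← h] at g3; linarith

variable {γ : ℝ}

lemma zVal_spec {k : Fin K} {S : Finset (Fin K)} (hk : μ k ∈ F.means) (hγ : γ ∈ F.means)
    (hkγ : μ k ≠ γ) (hS : ∀ j ∈ S, μ j ∈ F.means ∧ μ j ≠ μ k) :
    0 < zVal F γ μ k S ∧ zVal F γ μ k S ≤ F.dExp (μ k) γ ∧
      ∀ j ∈ S, zVal F γ μ k S < F.dExp (μ k) (μ j) := by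
  have hd := Family.d_eq (F.means_subset_closedMeans hk) hγ
  have hpos := Family.dExp_pos_of_mem hk hγ hkγ
  rw [zVal, hd]
  split_ifs with h
  · subst h; simp [hpos]
  · obtain ⟨h1, h2, _⟩ := ySol_spec hk hS (Finset.nonempty_iff_ne_empty.2 h)
    exact ⟨lt_min hpos h1, min_le_left _ _, fun j hj => (min_le_right _ _).trans_lt (h2 j hj)⟩

lemma tendsto_zVal {α : Type*} {l : Filter α} {ν : α → Fin K → ℝ} (hν : Tendsto ν l (𝓝 μ))
    {k : Fin K} {S : Finset (Fin K)} (hk : μ k ∈ F.means) (hγ : γ ∈ F.means)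
    (hS : ∀ j ∈ S, μ j ∈ F.means ∧ μ j ≠ μ k) :
    Tendsto (fun i => zVal F γ (ν i) k S) l (𝓝 (zVal F γ μ k S)) := by
  have hνk : Tendsto (fun i => ν i k) l (𝓝 (μ k)) := ((continuous_apply k).tendsto μ).comp hν
  have hd : Tendsto (fun i => F.d (ν i k) γ) l (𝓝 (F.d (μ k) γ)) := by
    rw [Family.d_eq (F.means_subset_closedMeans hk) hγ]
    refine (Family.tendsto_dExp hνk tendsto_const_nhds hγ).congr' ?_
    filter_upwards [hνk.eventually (F.isOpen_means.mem_nhds hk)] with i hi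
    rw [Family.d_eq (F.means_subset_closedMeans hi) hγ]
  by_cases h : S = ∅
  · simp only [zVal, if_pos h]; exact hd
  · simp only [zVal, if_neg h]
    exact hd.min (tendsto_ySol hν hk hS (Finset.nonempty_iff_ne_empty.2 h))

end Equilibrium

/-! ### Lower bounds of the information collected against the alternatives -/

section AltInf

variable {F : Family} {γ : ℝ} {ν : Fin K → ℝ}

lemma sInf_easiest_mem [NeZero K] (F : Family) (γ : ℝ) (ν : Fin K → ℝ) (c : Criterion) :
    sInf (easiest F γ ν c) ∈ easiest F γ ν c := by
  obtain ⟨a, ha, hmax⟩ := Set.exists_max_image (correct c γ ν)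
    (answerValue F γ ν c) (Set.toFinite _) (correct_nonempty c γ _)
  exact csInf_mem ⟨a, ha, hmax⟩

lemma Family.kl_self {a : ℝ} (ha : a ∈ F.means) : F.kl a a = 0 := by
  rw [Family.kl_eq (F.means_subset_closedMeans ha) ha, Family.dExp_self, ENNReal.ofReal_zero]

lemma le_altInf {c : Criterion} {v : Fin K → ℝ≥0∞} {a : Fin (K + 1)} {B : ℝ≥0∞}
    (h : ∀ l : Fin K → ℝ, (∀ k, l k ∈ F.means) → a ∉ correct c γ l →
      (∃ k, B ≤ v k * F.kl (ν k) (l k)) ∨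
      ∃ i j, i ≠ j ∧ B ≤ v i * F.kl (ν i) (l i) + v j * F.kl (ν j) (l j)) :
    B ≤ altInf F γ ν c v a := by
  classical
  refine le_iInf₂ fun l hl => ?_
  rcases h l hl.1 hl.2 with ⟨k, hk⟩ | ⟨i, j, hij, hB⟩
  · exact hk.trans (Finset.single_le_sum (f := fun k => v k * F.kl (ν k) (l k))
      (fun _ _ => zero_le) (Finset.mem_univ k))
  · rw [← Finset.sum_pair hij (f := fun k => v k * F.kl (ν k) (l k))] at hB
    exact hB.trans (Finset.sum_le_sum_of_subset (Finset.subset_univ _))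

lemma kl_le_of_ge (hγ : γ ∈ F.means) {a l : ℝ} (ha : a ∈ F.means) (hl : l ∈ F.means) (h1 : a < γ)
    (h2 : γ ≤ l) : F.kl a γ ≤ F.kl a l :=
  Family.kl_mono_right (F.means_subset_closedMeans ha) hγ hl (Or.inl ⟨h1.le, h2⟩)

lemma kl_le_of_lt (hγ : γ ∈ F.means) {a l : ℝ} (ha : a ∈ F.means) (hl : l ∈ F.means) (h1 : γ < a)
    (h2 : l < γ) : F.kl a γ ≤ F.kl a l :=
  Family.kl_mono_right (F.means_subset_closedMeans ha) hγ hl (Or.inr ⟨h1.le, h2.le⟩)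

/-- Two means can be exchanged only by moving them to a common value. -/
lemma exists_kl_le_of_swap {a b s r : ℝ} (ha : a ∈ F.means) (hb : b ∈ F.means) (hs : s ∈ F.means)
    (hr : r ∈ F.means) (hab : a < b) (hrs : s < r) :
    ∃ m ∈ F.means, F.kl b m ≤ F.kl b s ∧ F.kl a m ≤ F.kl a r := by
  have ha' := F.means_subset_closedMeans ha
  have hb' := F.means_subset_closedMeans hb
  rcases le_or_gt s a with h1 | h1
  · exact ⟨a, ha, Family.kl_mono_right hb' ha hs (Or.inr ⟨hab.le, h1⟩),
      by rw [Family.kl_self ha]; exact zero_le⟩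
  · rcases le_or_gt s b with h2 | h2
    · exact ⟨s, hs, le_rfl, Family.kl_mono_right ha' hs hr (Or.inl ⟨h1.le, hrs.le⟩)⟩
    · exact ⟨b, hb, by rw [Family.kl_self hb]; exact zero_le,
        Family.kl_mono_right ha' hb hr (Or.inl ⟨hab.le, (h2.trans hrs).le⟩)⟩

lemma le_altInf_zero {c : Criterion} {v : Fin K → ℝ≥0∞} {B : ℝ≥0∞} (hγ : γ ∈ F.means)
    (hν : ∀ k, ν k ∈ F.means) (h : ∀ k, γ < ν k ∧ B ≤ v k * F.kl (ν k) γ) :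
    B ≤ altInf F γ ν c v 0 := by
  refine le_altInf fun l hl ha => Or.inl ?_
  rw [zero_mem_correct_iff, not_not] at ha
  obtain ⟨k, hk⟩ := ha
  exact ⟨k, (h k).2.trans (mul_le_mul_right (kl_le_of_lt hγ (hν k) (hl k) (h k).1 hk) _)⟩

lemma le_altInf_anyAvailable {v : Fin K → ℝ≥0∞} (hγ : γ ∈ F.means) {k : Fin K}
    (hν : ν k ∈ F.means) (h : ν k < γ) :
    v k * F.kl (ν k) γ ≤ altInf F γ ν .anyAvailable v k.succ := by
  refine le_altInf fun l hl ha => Or.inl ⟨k, ?_⟩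
  rw [succ_mem_correct_anyAvailable, not_lt] at ha
  exact mul_le_mul_right (kl_le_of_ge hγ hν (hl k) h ha) _

/-- Slice `k` stops being the packing slice only if it becomes unavailable or if an available slice
exceeds it. The latter slice was either unavailable and crossed `γ`, or was less loaded and passed
`k` through a common value `m`. -/
lemma le_altInf_packing {v : Fin K → ℝ≥0∞} {B : ℝ≥0∞} (hγ : γ ∈ F.means)
    (hν : ∀ k, ν k ∈ F.means) {k : Fin K} (hk : ν k < γ) (hB : B ≤ v k * F.kl (ν k) γ)
    (h : ∀ j, j ≠ k → γ < ν j ∧ B ≤ v j * F.kl (ν j) γ ∨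
      ν j < ν k ∧ ∀ m ∈ F.means, B ≤ v k * F.kl (ν k) m + v j * F.kl (ν j) m) :
    B ≤ altInf F γ ν .packing v k.succ := by
  refine le_altInf fun l hl ha => ?_
  rw [succ_mem_correct_packing] at ha
  by_cases hlk : γ ≤ l k
  · exact Or.inl ⟨k, hB.trans (mul_le_mul_right (kl_le_of_ge hγ (hν k) (hl k) hk hlk) _)⟩
  · have : ∃ j, l j < γ ∧ l k < l j := by
      by_contra hcon
      push Not at hcon
      exact ha ⟨not_le.1 hlk, hcon⟩
    obtain ⟨j, hj, hkj⟩ := this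
    have hjk : j ≠ k := fun e => by rw [e] at hkj; exact lt_irrefl _ hkj
    rcases h j hjk with ⟨h1, h2⟩ | ⟨h1, h2⟩
    · exact Or.inl ⟨j, h2.trans (mul_le_mul_right (kl_le_of_lt hγ (hν j) (hl j) h1 hj) _)⟩
    · obtain ⟨m, hm, hm1, hm2⟩ := exists_kl_le_of_swap (hν j) (hν k) (hl k) (hl j) h1 hkj
      exact Or.inr ⟨k, j, hjk.symm, (h2 m hm).trans
        (add_le_add (mul_le_mul_right hm1 _) (mul_le_mul_right hm2 _))⟩

lemma le_altInf_leastLoaded {v : Fin K → ℝ≥0∞} {B : ℝ≥0∞} (hγ : γ ∈ F.means)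
    (hν : ∀ k, ν k ∈ F.means) {k : Fin K} (hk : ν k < γ) (hB : B ≤ v k * F.kl (ν k) γ)
    (h : ∀ j, j ≠ k →
      ν k < ν j ∧ ∀ m ∈ F.means, B ≤ v k * F.kl (ν k) m + v j * F.kl (ν j) m) :
    B ≤ altInf F γ ν .leastLoaded v k.succ := by
  refine le_altInf fun l hl ha => ?_
  rw [succ_mem_correct_leastLoaded] at ha
  by_cases hlk : γ ≤ l k
  · exact Or.inl ⟨k, hB.trans (mul_le_mul_right (kl_le_of_ge hγ (hν k) (hl k) hk hlk) _)⟩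
  · have : ∃ j, l j < l k := by
      by_contra hcon
      push Not at hcon
      exact ha ⟨not_le.1 hlk, hcon⟩
    obtain ⟨j, hj⟩ := this
    have hjk : j ≠ k := fun e => by rw [e] at hj; exact lt_irrefl _ hj
    obtain ⟨h1, h2⟩ := h j hjk
    obtain ⟨m, hm, hm1, hm2⟩ := exists_kl_le_of_swap (hν k) (hν j) (hl j) (hl k) h1 hj
    exact Or.inr ⟨k, j, hjk.symm, (h2 m hm).trans
      (add_le_add (mul_le_mul_right hm2 _) (mul_le_mul_right hm1 _))⟩

/-- The value of an available slice is its divergence to `γ`: measuring only this slice attains it,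
and the alternative moving this slice to `γ` shows that nothing better is possible. Below `γ` that
divergence decreases with the load. -/
lemma isLeastLoaded_of_mem_easiest (hγ : γ ∈ F.means) (hν : ∀ k, ν k ∈ F.means) {k : Fin K}
    (h : k.succ ∈ easiest F γ ν .anyAvailable) : IsLeastLoaded ν k := by
  classical
  obtain ⟨hc, hmax⟩ := h
  rw [succ_mem_correct_anyAvailable] at hc
  intro j
  rcases le_or_gt γ (ν j) with hj | hj
  · linarith
  have h1 : F.kl (ν j) γ ≤ answerValue F γ ν .anyAvailable j.succ := by
    have hle := le_altInf_anyAvailable (v := fun i => ENNReal.ofReal ((Pi.single j (1 : ℝ) : Fin K → ℝ) i))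
      hγ (hν j) hj
    simp only [Pi.single_eq_same, ENNReal.ofReal_one, one_mul] at hle
    exact hle.trans (le_iSup₂_of_le (Pi.single j (1 : ℝ)) (single_mem_stdSimplex ℝ j) le_rfl)
  have h2 : answerValue F γ ν .anyAvailable k.succ ≤ F.kl (ν k) γ := by
    refine iSup₂_le fun w hw => ?_
    refine iInf₂_le_of_le (Function.update ν k γ) ⟨fun i => ?_, ?_⟩ ?_
    · by_cases hi : i = k
      · subst hi; simpa using hγ
      · simpa [hi] using hν i
    · rw [succ_mem_correct_anyAvailable]; simp
    · rw [Finset.sum_eq_single k (fun i _ hi => by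
        rw [Function.update_of_ne hi, Family.kl_self (hν i), mul_zero]) (by simp)]
      rw [Function.update_self]
      calc ENNReal.ofReal (w k) * F.kl (ν k) γ ≤ 1 * F.kl (ν k) γ := by
            refine mul_le_mul_left ?_ _
            rw [ENNReal.ofReal_le_one]
            rw [← hw.2]
            exact Finset.single_le_sum (fun i _ => hw.1 i) (Finset.mem_univ k)
        _ = _ := one_mul _
  have h3 := h1.trans ((hmax _ (succ_mem_correct_anyAvailable.2 hj)).trans h2)
  rw [Family.kl_eq (F.means_subset_closedMeans (hν j)) hγ,
    Family.kl_eq (F.means_subset_closedMeans (hν k)) hγ,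
    ENNReal.ofReal_le_ofReal_iff (Family.dExp_nonneg_of_mem (hν k) hγ)] at h3
  by_contra hcon
  exact absurd h3 (not_le.2 (Family.dExp_lt_left (hν j) (hν k) hγ
    (Or.inl ⟨not_le.1 hcon, hc.le⟩)))

lemma ofReal_le_mul_kl (hγ : γ ∈ F.means) {a : ℝ} (ha : a ∈ F.means) {N v : ℝ≥0∞} {ω β : ℝ}
    (hω : 0 ≤ ω) (hv : N * ENNReal.ofReal ω ≤ v) (hβ : β ≤ ω * F.dExp a γ) :
    N * ENNReal.ofReal β ≤ v * F.kl a γ := by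
  rw [Family.kl_eq (F.means_subset_closedMeans ha) hγ]
  calc N * ENNReal.ofReal β ≤ N * ENNReal.ofReal (ω * F.dExp a γ) :=
        mul_le_mul_right (ENNReal.ofReal_le_ofReal hβ) _
    _ = N * ENNReal.ofReal ω * ENNReal.ofReal (F.dExp a γ) := by
        rw [ENNReal.ofReal_mul hω, mul_assoc]
    _ ≤ _ := mul_le_mul_left hv _

/-- With weights `ω` and `ω'`, merging two means costs at least `ω pairG` at the ratio `ω' / ω`; `N`
is a common scale, later the number of rounds divided by the characteristic time. -/
lemma ofReal_le_mul_kl_add {a b : ℝ} (ha : a ∈ F.means) (hb : b ∈ F.means) {N v v' : ℝ≥0∞}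
    {ω ω' β : ℝ} (hω : 0 < ω) (hω' : 0 ≤ ω') (hv : N * ENNReal.ofReal ω ≤ v)
    (hv' : N * ENNReal.ofReal ω' ≤ v') (hβ : β ≤ ω * pairG F a b (ω' / ω)) {m : ℝ}
    (hm : m ∈ F.means) : N * ENNReal.ofReal β ≤ v * F.kl a m + v' * F.kl b m := by
  have h1 : β ≤ ω * F.dExp a m + ω' * F.dExp b m := by
    refine hβ.trans ((mul_le_mul_of_nonneg_left (pairG_le ha hb (x := ω' / ω) (by positivity) hm)
      hω.le).trans (le_of_eq ?_))
    field_simp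
  have h2 := Family.dExp_nonneg_of_mem ha hm
  have h3 := Family.dExp_nonneg_of_mem hb hm
  calc N * ENNReal.ofReal β ≤ N * ENNReal.ofReal (ω * F.dExp a m + ω' * F.dExp b m) :=
        mul_le_mul_right (ENNReal.ofReal_le_ofReal h1) _
    _ = N * ENNReal.ofReal (ω * F.dExp a m) + N * ENNReal.ofReal (ω' * F.dExp b m) := by
        rw [ENNReal.ofReal_add (by positivity) (by positivity), mul_add]
    _ ≤ _ := add_le_add (ofReal_le_mul_kl hm ha hω.le hv le_rfl)
        (ofReal_le_mul_kl hm hb hω' hv' le_rfl)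

end AltInf

/-! ### Continuity of the optimal proportions -/

/-- The properties of the unnormalized optimal proportions `ω` near `μ` that tracking needs. -/
structure IsWeight [NeZero K] (F : Family) (γ : ℝ) (c : Criterion) (μ : Fin K → ℝ)
    (ω : (Fin K → ℝ) → Fin K → ℝ) : Prop where
  charTime_eq : ∀ᶠ ν in 𝓝 μ, charTime F γ ν c = ∑ k, ω ν k
  wStar_eq : ∀ᶠ ν in 𝓝 μ, ∀ k, wStar F γ ν c k = ω ν k / charTime F γ ν c
  tendsto : ∀ k, Tendsto (fun ν => ω ν k) (𝓝 μ) (𝓝 (ω μ k))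
  nonneg : ∀ k, 0 ≤ ω μ k
  exists_pos : ∃ k, 0 < ω μ k
  le_altInf : ∀ β < 1, ∀ᶠ ν in 𝓝 μ, ∀ (N : ℝ≥0∞) (v : Fin K → ℝ≥0∞),
    (∀ k, N * ENNReal.ofReal (ω μ k) ≤ v k) →
      N * ENNReal.ofReal β ≤ altInf F γ ν c v (sInf (easiest F γ ν c))

section Weights

variable {F : Family} {γ : ℝ} {μ : Fin K → ℝ}

lemma tendsto_coord (μ : Fin K → ℝ) (k : Fin K) :
    Tendsto (fun ν : Fin K → ℝ => ν k) (𝓝 μ) (𝓝 (μ k)) := (continuous_apply k).tendsto μ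

lemma eventually_mem_means (hμ : ∀ k, μ k ∈ F.means) : ∀ᶠ ν in 𝓝 μ, ∀ k, ν k ∈ F.means :=
  eventually_all.2 fun k => (tendsto_coord μ k).eventually (F.isOpen_means.mem_nhds (hμ k))

lemma tendsto_d (hμ : ∀ k, μ k ∈ F.means) (hγ : γ ∈ F.means) (k : Fin K) :
    Tendsto (fun ν : Fin K → ℝ => F.d (ν k) γ) (𝓝 μ) (𝓝 (F.d (μ k) γ)) := by
  rw [Family.d_eq (F.means_subset_closedMeans (hμ k)) hγ]
  refine (Family.tendsto_dExp (tendsto_coord μ k) tendsto_const_nhds hγ).congr' ?_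
  filter_upwards [eventually_mem_means hμ] with ν hν
  rw [Family.d_eq (F.means_subset_closedMeans (hν k)) hγ]

lemma d_pos (hμ : ∀ k, μ k ∈ F.means) (hγ : γ ∈ F.means) {k : Fin K} (h : μ k ≠ γ) :
    0 < F.d (μ k) γ := by
  rw [Family.d_eq (F.means_subset_closedMeans (hμ k)) hγ]
  exact Family.dExp_pos_of_mem (hμ k) hγ h

lemma eventually_lt_coord_mul_dExp (hγ : γ ∈ F.means) {β : ℝ} {k : Fin K} {ω : ℝ}
    (h : β < ω * F.dExp (μ k) γ) : ∀ᶠ ν : Fin K → ℝ in 𝓝 μ, β < ω * F.dExp (ν k) γ :=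
  (tendsto_const_nhds.mul (Family.tendsto_dExp (tendsto_coord μ k) tendsto_const_nhds hγ)).eventually
    (lt_mem_nhds h)

lemma eventually_lt_mul_pairG (hμ : ∀ k, μ k ∈ F.means) {β : ℝ} {j k : Fin K} {ω x : ℝ}
    (hx : 0 ≤ x) (h : β < ω * pairG F (μ k) (μ j) x) :
    ∀ᶠ ν : Fin K → ℝ in 𝓝 μ, β < ω * pairG F (ν k) (ν j) x :=
  (tendsto_const_nhds.mul (tendsto_pairG (tendsto_coord μ k) (tendsto_coord μ j) tendsto_const_nhds
    (hμ k) (hμ j) hx)).eventually (lt_mem_nhds h)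

lemma eq_of_isLeastLoaded {k j : Fin K} (h : ∀ j, j ≠ k → μ k < μ j) (hj : IsLeastLoaded μ j) :
    j = k := by
  by_contra hne
  exact absurd (hj k) (not_le.2 (h j hne))

lemma eq_of_isPacking {k j : Fin K} (hk : μ k < γ) (h : ∀ j, j ≠ k → μ j < γ → μ j < μ k)
    (hj : IsPacking γ μ j) : j = k := by
  by_contra hne
  exact absurd (hj.2 k hk) (not_le.2 (h j hne hj.1))

variable [NeZero K]

lemma lt_of_not_available {c : Criterion} (hid : Identifiable c γ μ) (h : ¬ ∃ k, μ k < γ) :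
    ∀ k, γ < μ k := by
  push Not at h
  intro k
  refine lt_of_le_of_ne (h k) fun e => hid.1 (le_antisymm ?_ (le_ciInf h))
  rw [e]
  exact ciInf_le (Set.finite_range μ).bddBelow k

/-- The weight `1 / d(μ_k, γ)` gives information exactly `1` against moving slice `k` below `γ`. At
nearby instances the information is still above any `β < 1`, by continuity. -/
lemma isWeight_of_not_available {c : Criterion} (hμ : ∀ k, μ k ∈ F.means) (hγ : γ ∈ F.means)
    (hlt : ∀ k, γ < μ k) : IsWeight F γ c μ fun ν k => (F.d (ν k) γ)⁻¹ := by
  have hev : ∀ᶠ ν in 𝓝 μ, ∀ k, γ < ν k :=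
    eventually_all.2 fun k => (tendsto_coord μ k).eventually (lt_mem_nhds (hlt k))
  have hpos : ∀ k, 0 < F.d (μ k) γ := fun k => d_pos hμ hγ (hlt k).ne'
  refine ⟨?_, ?_, fun k => (tendsto_d hμ hγ k).inv₀ (hpos k).ne', fun k => (inv_pos.2 (hpos k)).le,
    ⟨0, inv_pos.2 (hpos 0)⟩, fun β hβ => ?_⟩
  · filter_upwards [hev] with ν hν
    rw [charTime.eq_def, if_neg (by push Not; exact fun k => (hν k).le)]
  · filter_upwards [hev] with ν hν k
    rw [wStar.eq_def, if_neg (by push Not; exact fun k => (hν k).le)]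
  · have hβ' : ∀ᶠ ν : Fin K → ℝ in 𝓝 μ, ∀ k, β < (F.d (μ k) γ)⁻¹ * F.dExp (ν k) γ := by
      refine eventually_all.2 fun k => eventually_lt_coord_mul_dExp hγ ?_
      rw [← Family.d_eq (F.means_subset_closedMeans (hμ k)) hγ, inv_mul_cancel₀ (hpos k).ne']
      exact hβ
    filter_upwards [hev, hβ', eventually_mem_means hμ] with ν h1 h2 h3 N v hv
    have hz : sInf (easiest F γ ν c) = 0 := by
      have := (sInf_easiest_mem F γ ν c).1
      rwa [correct_eq_zero (by push Not; exact fun k => (h1 k).le), Set.mem_singleton_iff] at this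
    rw [hz]
    exact le_altInf_zero hγ h3 fun k => ⟨h1 k,
      ofReal_le_mul_kl hγ (h3 k) (inv_pos.2 (hpos k)).le (hv k) (h2 k).le⟩

lemma lt_of_existsUnique_isLeastLoaded (h : ∃! k, IsLeastLoaded μ k) :
    ∀ j, j ≠ kLow μ → μ (kLow μ) < μ j := by
  intro j hj
  refine lt_of_le_of_ne (kLow_spec μ j) fun e => hj ?_
  refine h.unique (fun i => ?_) (kLow_spec μ)
  rw [← e]; exact kLow_spec μ i

lemma eventually_kLow_lt (h : ∃! k, IsLeastLoaded μ k) :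
    ∀ᶠ ν in 𝓝 μ, ∀ j, j ≠ kLow μ → ν (kLow μ) < ν j :=
  eventually_all.2 fun j => eventually_imp_distrib_left.2 fun hj =>
    (tendsto_coord μ _).eventually_lt (tendsto_coord μ j)
      (lt_of_existsUnique_isLeastLoaded h j hj)

/-- Uniqueness of the least loaded slice makes it locally constant, and by
`isLeastLoaded_of_mem_easiest` it is the candidate; only its divergence to `γ` varies. -/
lemma isWeight_anyAvailable (hμ : ∀ k, μ k ∈ F.means) (hγ : γ ∈ F.means) (hav : ∃ k, μ k < γ)
    (hun : ∃! k, IsLeastLoaded μ k) :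
    IsWeight F γ .anyAvailable μ fun ν k => if k = kLow μ then (F.d (ν k) γ)⁻¹ else 0 := by
  have hlow : μ (kLow μ) < γ := by
    obtain ⟨k, hk⟩ := hav
    exact (kLow_spec μ k).trans_lt hk
  have hpos : 0 < F.d (μ (kLow μ)) γ := d_pos hμ hγ hlow.ne
  have h1 : ∀ᶠ ν in 𝓝 μ, ν (kLow μ) < γ := (tendsto_coord μ _).eventually (gt_mem_nhds hlow)
  have h2 := eventually_kLow_lt hun
  have h3 : ∀ᶠ ν in 𝓝 μ, 0 < F.d (ν (kLow μ)) γ :=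
    (tendsto_d hμ hγ _).eventually (lt_mem_nhds hpos)
  have hct : ∀ᶠ ν in 𝓝 μ, charTime F γ ν .anyAvailable = (F.d (ν (kLow μ)) γ)⁻¹ := by
    filter_upwards [h1, h2] with ν g1 g2
    rw [charTime, if_pos ⟨_, g1⟩, eq_of_isLeastLoaded g2 (kLow_spec ν)]
  refine ⟨?_, ?_, fun k => ?_, fun k => ?_, ⟨kLow μ, ?_⟩, fun β hβ => ?_⟩
  · filter_upwards [hct] with ν g
    rw [g, Finset.sum_ite_eq' Finset.univ (kLow μ) (fun k => (F.d (ν k) γ)⁻¹)]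
    simp
  · filter_upwards [h1, h2, h3, hct] with ν g1 g2 g3 g4 k
    rw [wStar, if_pos ⟨_, g1⟩, g4]
    simp only [eq_of_isLeastLoaded g2 (kLow_spec ν)]
    split_ifs with hk
    · rw [hk, div_self (inv_pos.2 g3).ne']
    · rw [zero_div]
  · split_ifs with hk
    · rw [hk]; exact (tendsto_d hμ hγ _).inv₀ hpos.ne'
    · exact tendsto_const_nhds
  · split_ifs with hk
    · rw [hk]; exact (inv_pos.2 hpos).le
    · exact le_rfl
  · rw [if_pos rfl]; exact inv_pos.2 hpos
  · have hβ' : ∀ᶠ ν : Fin K → ℝ in 𝓝 μ,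
        β < (F.d (μ (kLow μ)) γ)⁻¹ * F.dExp (ν (kLow μ)) γ := by
      refine eventually_lt_coord_mul_dExp hγ ?_
      rw [← Family.d_eq (F.means_subset_closedMeans (hμ _)) hγ, inv_mul_cancel₀ hpos.ne']
      exact hβ
    filter_upwards [h1, h2, hβ', eventually_mem_means hμ] with ν g1 g2 g3 g4 N v hv
    have hmem := sInf_easiest_mem F γ ν .anyAvailable
    obtain ⟨k, hk⟩ : ∃ k : Fin K, sInf (easiest F γ ν .anyAvailable) = k.succ := by
      refine Fin.eq_succ_of_ne_zero fun e => ?_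
      have := hmem.1
      rw [e, zero_mem_correct_iff] at this
      exact this ⟨_, g1⟩
    rw [hk] at hmem ⊢
    have hkl := eq_of_isLeastLoaded g2 (isLeastLoaded_of_mem_easiest hγ g4 hmem)
    have hv' := hv (kLow μ)
    rw [if_pos rfl] at hv'
    rw [hkl]
    exact (ofReal_le_mul_kl hγ (g4 _) (inv_pos.2 hpos).le hv' g3.le).trans
      (le_altInf_anyAvailable hγ (g4 _) g1)

/-- Near `μ` the least loaded slice and the set of its competitors are constant, so the weights are
explicit continuous functions. They give information at least `1` against leaving `γ` behind,
because `z ≤ d(μ_k, γ)`, and exactly `1` against each competitor, because `pairG` at `x_{j,k}(z)` is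
`z`. -/
lemma isWeight_leastLoaded (hμ : ∀ k, μ k ∈ F.means) (hγ : γ ∈ F.means) (hav : ∃ k, μ k < γ)
    (hun : ∃! k, IsLeastLoaded μ k) :
    IsWeight F γ .leastLoaded μ fun ν k =>
      xInv F ν k (kLow μ) (zVal F γ ν (kLow μ) (Finset.univ.erase (kLow μ))) /
        zVal F γ ν (kLow μ) (Finset.univ.erase (kLow μ)) := by
  classical
  set k₀ := kLow μ with hk₀
  set S := Finset.univ.erase k₀ with hS
  have hlow : μ k₀ < γ := by
    obtain ⟨k, hk⟩ := hav
    exact (kLow_spec μ k).trans_lt hk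
  have hlt := lt_of_existsUnique_isLeastLoaded hun
  have hSμ : ∀ j ∈ S, μ j ∈ F.means ∧ μ j ≠ μ k₀ := fun j hj =>
    ⟨hμ j, (hlt j (Finset.ne_of_mem_erase hj)).ne'⟩
  obtain ⟨hz0, hzγ, hzS⟩ := zVal_spec (hμ k₀) hγ hlow.ne hSμ
  have hz := tendsto_zVal (γ := γ) (tendsto_id (x := 𝓝 μ)) (hμ k₀) hγ hSμ
  simp only [id] at hz
  set z := zVal F γ μ k₀ S with hzdef
  have h1 : ∀ᶠ ν in 𝓝 μ, ν k₀ < γ := (tendsto_coord μ _).eventually (gt_mem_nhds hlow)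
  have h2 : ∀ᶠ ν in 𝓝 μ, ∀ j, j ≠ k₀ → ν k₀ < ν j := eventually_kLow_lt hun
  have hzl : ∀ᶠ ν in 𝓝 μ, kLow ν = k₀ ∧ zLow F γ ν = zVal F γ ν k₀ S := by
    filter_upwards [h2] with ν g2
    have e := eq_of_isLeastLoaded g2 (kLow_spec ν)
    refine ⟨e, ?_⟩
    rw [zLow, e]
    congr 1
    ext j
    simp only [Finset.mem_filter, Finset.mem_univ, true_and, hS, Finset.mem_erase, and_true]
    constructor
    · intro h hj; rw [hj] at h; exact lt_irrefl _ h
    · exact g2 j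
  have hct : ∀ᶠ ν in 𝓝 μ, charTime F γ ν .leastLoaded =
      ∑ k, xInv F ν k k₀ (zVal F γ ν k₀ S) / zVal F γ ν k₀ S := by
    filter_upwards [h1, hzl] with ν g1 g2
    rw [charTime, if_pos ⟨_, g1⟩]
    simp only [g2.1, g2.2]
    rw [← Finset.sum_div, inv_mul_eq_div]
  have hxpos : ∀ k, 0 < xInv F μ k k₀ z := by
    intro k
    by_cases hk : k = k₀
    · rw [hk, xInv_self]; exact one_pos
    · exact xInv_pos (hμ k) (hμ k₀) (hlt k hk).ne' hz0 (hzS k (by simp [hS, hk]))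
  refine ⟨hct, ?_, fun k => ?_, fun k => ?_, ⟨k₀, ?_⟩, fun β hβ => ?_⟩
  · filter_upwards [h1, hzl] with ν g1 g2 k
    rw [wStar, if_pos ⟨_, g1⟩]
    simp only [g2.1, g2.2]
    rw [div_div]
  · refine Tendsto.div ?_ hz hz0.ne'
    by_cases hk : k = k₀
    · simp only [hk, xInv_self]; exact tendsto_const_nhds
    · exact tendsto_xInv tendsto_id hz (hμ k) (hμ k₀) (hlt k hk).ne' hz0 (hzS k (by simp [hS, hk]))
  · exact (div_pos (hxpos k) hz0).le
  · exact div_pos (hxpos _) hz0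
  · have hω₀ : xInv F μ k₀ k₀ z / z = z⁻¹ := by rw [xInv_self, one_div]
    have e1 : ∀ᶠ ν : Fin K → ℝ in 𝓝 μ, β < z⁻¹ * F.dExp (ν k₀) γ := by
      refine eventually_lt_coord_mul_dExp hγ (hβ.trans_le ?_)
      rw [inv_mul_eq_div, one_le_div hz0]
      exact hzγ
    have e2 : ∀ᶠ ν : Fin K → ℝ in 𝓝 μ, ∀ j, j ≠ k₀ →
        β < z⁻¹ * pairG F (ν k₀) (ν j) (xInv F μ j k₀ z / z / z⁻¹) := by
      refine eventually_all.2 fun j => eventually_imp_distrib_left.2 fun hj => ?_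
      have hx := hxpos j
      refine eventually_lt_mul_pairG hμ (by positivity) (hβ.trans_le (le_of_eq ?_))
      have : xInv F μ j k₀ z / z / z⁻¹ = xInv F μ j k₀ z := by field_simp
      rw [this, (xInv_spec (hμ j) (hμ k₀) (hlt j hj).ne' hz0.le (hzS j (by simp [hS, hj]))).2,
        inv_mul_cancel₀ hz0.ne']
    filter_upwards [h1, h2, e1, e2, eventually_mem_means hμ] with ν g1 g2 g3 g4 g5 N v hv
    have hcand : sInf (easiest F γ ν .leastLoaded) = k₀.succ := by
      have hmem := (sInf_easiest_mem F γ ν .leastLoaded).1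
      obtain ⟨k, hk⟩ : ∃ k : Fin K, sInf (easiest F γ ν .leastLoaded) = k.succ := by
        refine Fin.eq_succ_of_ne_zero fun e => ?_
        rw [e, zero_mem_correct_iff] at hmem
        exact hmem ⟨_, g1⟩
      rw [hk, succ_mem_correct_leastLoaded] at hmem
      rw [hk, eq_of_isLeastLoaded g2 hmem.2]
    rw [hcand]
    have hv₀ := hv k₀
    rw [hω₀] at hv₀
    refine le_altInf_leastLoaded hγ g5 g1
      (ofReal_le_mul_kl hγ (g5 k₀) (inv_pos.2 hz0).le hv₀ g3.le) fun j hj => ⟨g2 j hj, fun m hm => ?_⟩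
    exact ofReal_le_mul_kl_add (g5 k₀) (g5 j) (inv_pos.2 hz0) (div_pos (hxpos j) hz0).le hv₀ (hv j)
      (g4 j hj).le hm

/-- As no load equals `γ` and the packing slice is unique, the available set and the packing slice
are locally constant. Hence the conditions in the weights may be tested at `μ`, and the two kinds of
slices are treated as in the other cases. -/
lemma isWeight_packing (hμ : ∀ k, μ k ∈ F.means) (hγ : γ ∈ F.means) (hav : ∃ k, μ k < γ)
    (hne : ∀ k, μ k ≠ γ) (hun : ∃! k, IsPacking γ μ k) :
    IsWeight F γ .packing μ fun ν k =>
      (if μ k < γ then xInv F ν k (kPack γ μ) (zVal F γ ν (kPack γ μ) {j | μ j < μ (kPack γ μ)}) /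
        zVal F γ ν (kPack γ μ) {j | μ j < μ (kPack γ μ)} else 0) +
      (if γ < μ k then (F.d (ν k) γ)⁻¹ else 0) := by
  classical
  have hp := kPack_spec hav
  set k₀ := kPack γ μ with hk₀
  set S : Finset (Fin K) := {j | μ j < μ k₀} with hS
  have hlow : μ k₀ < γ := hp.1
  have hlt : ∀ j, j ≠ k₀ → μ j < γ → μ j < μ k₀ := by
    intro j hj hjγ
    refine lt_of_le_of_ne (hp.2 j hjγ) fun e => hj (hun.unique ⟨hjγ, fun i hi => ?_⟩ hp)
    rw [e]; exact hp.2 i hi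
  have hgt : ∀ j, ¬ μ j < γ → γ < μ j := fun j hj => lt_of_le_of_ne (not_lt.1 hj) (hne j).symm
  have hSμ : ∀ j ∈ S, μ j ∈ F.means ∧ μ j ≠ μ k₀ := fun j hj =>
    ⟨hμ j, (show μ j < μ k₀ by simpa [hS] using hj).ne⟩
  have hSmem : ∀ j, j ≠ k₀ → μ j < γ → j ∈ S := fun j hj hjγ => by
    simpa [hS] using hlt j hj hjγ
  obtain ⟨hz0, hzγ, hzS⟩ := zVal_spec (hμ k₀) hγ hlow.ne hSμ
  have hz := tendsto_zVal (γ := γ) (tendsto_id (x := 𝓝 μ)) (hμ k₀) hγ hSμ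
  simp only [id] at hz
  set z := zVal F γ μ k₀ S with hzdef
  have h1 : ∀ᶠ ν in 𝓝 μ, ∀ k, (ν k < γ ↔ μ k < γ) ∧ (γ < ν k ↔ γ < μ k) := by
    refine eventually_all.2 fun k => ?_
    by_cases hk : μ k < γ
    · filter_upwards [(tendsto_coord μ k).eventually (gt_mem_nhds hk)] with ν g
      exact ⟨iff_of_true g hk, iff_of_false (not_lt.2 g.le) (not_lt.2 hk.le)⟩
    · filter_upwards [(tendsto_coord μ k).eventually (lt_mem_nhds (hgt k hk))] with ν g
      exact ⟨iff_of_false (not_lt.2 g.le) hk, iff_of_true g (hgt k hk)⟩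
  have h2 : ∀ᶠ ν in 𝓝 μ, ∀ j, j ≠ k₀ → μ j < γ → ν j < ν k₀ :=
    eventually_all.2 fun j => eventually_imp_distrib_left.2 fun hj =>
      eventually_imp_distrib_left.2 fun hjγ =>
        (tendsto_coord μ j).eventually_lt (tendsto_coord μ k₀) (hlt j hj hjγ)
  have hzl : ∀ᶠ ν in 𝓝 μ, kPack γ ν = k₀ ∧ zPack F γ ν = zVal F γ ν k₀ S := by
    filter_upwards [h1, h2] with ν g1 g2
    have hk₀ν : ν k₀ < γ := (g1 k₀).1.2 hlow
    have e : kPack γ ν = k₀ := eq_of_isPacking hk₀ν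
      (fun j hj hjγ => g2 j hj ((g1 j).1.1 hjγ)) (kPack_spec ⟨k₀, hk₀ν⟩)
    refine ⟨e, ?_⟩
    rw [zPack, e]
    congr 1
    ext j
    simp only [hS, Finset.mem_filter, Finset.mem_univ, true_and]
    constructor
    · intro h
      have hj : j ≠ k₀ := fun e => by rw [e] at h; exact lt_irrefl _ h
      exact hlt j hj ((g1 j).1.1 (h.trans hk₀ν))
    · intro h
      have hj : j ≠ k₀ := fun e => by rw [e] at h; exact lt_irrefl _ h
      exact g2 j hj (h.trans hlow)
  have hdpos : ∀ k, 0 < F.d (μ k) γ := fun k => d_pos hμ hγ (hne k)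
  have hxpos : ∀ k, μ k < γ → 0 < xInv F μ k k₀ z := by
    intro k hkγ
    by_cases hk : k = k₀
    · rw [hk, xInv_self]; exact one_pos
    · exact xInv_pos (hμ k) (hμ k₀) (hlt k hk hkγ).ne hz0 (hzS k (hSmem k hk hkγ))
  refine ⟨?_, ?_, fun k => ?_, fun k => ?_, ⟨k₀, ?_⟩, fun β hβ => ?_⟩
  · filter_upwards [h1, hzl] with ν g1 g2
    rw [charTime, if_pos ⟨k₀, (g1 k₀).1.2 hlow⟩]
    simp only [g2.1, g2.2, (g1 _).1, (g1 _).2]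
    rw [Finset.sum_add_distrib, add_comm, ← Finset.sum_filter, ← Finset.sum_filter,
      ← Finset.sum_div, inv_mul_eq_div]
  · filter_upwards [h1, hzl] with ν g1 g2 k
    rw [wStar, if_pos ⟨k₀, (g1 k₀).1.2 hlow⟩]
    simp only [g2.1, g2.2, (g1 _).1, (g1 _).2]
    rw [inv_mul_eq_div]
  · refine Tendsto.add ?_ ?_
    · split_ifs with hkγ
      · refine Tendsto.div ?_ hz hz0.ne'
        by_cases hk : k = k₀
        · simp only [hk, xInv_self]; exact tendsto_const_nhds
        · exact tendsto_xInv tendsto_id hz (hμ k) (hμ k₀) (hlt k hk hkγ).ne hz0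
            (hzS k (hSmem k hk hkγ))
      · exact tendsto_const_nhds
    · split_ifs with hkγ
      · exact (tendsto_d hμ hγ k).inv₀ (hdpos k).ne'
      · exact tendsto_const_nhds
  · refine add_nonneg ?_ ?_
    · split_ifs with hkγ
      · exact (div_pos (hxpos k hkγ) hz0).le
      · exact le_rfl
    · split_ifs
      · exact (inv_pos.2 (hdpos k)).le
      · exact le_rfl
  · rw [if_pos hlow, if_neg (not_lt.2 hlow.le), add_zero]
    exact div_pos (hxpos _ hlow) hz0
  · have e1 : ∀ᶠ ν : Fin K → ℝ in 𝓝 μ, β < z⁻¹ * F.dExp (ν k₀) γ := by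
      refine eventually_lt_coord_mul_dExp hγ (hβ.trans_le ?_)
      rw [inv_mul_eq_div, one_le_div hz0]
      exact hzγ
    have e2 : ∀ᶠ ν : Fin K → ℝ in 𝓝 μ, ∀ j, j ≠ k₀ → μ j < γ →
        β < z⁻¹ * pairG F (ν k₀) (ν j) (xInv F μ j k₀ z / z / z⁻¹) := by
      refine eventually_all.2 fun j => eventually_imp_distrib_left.2 fun hj =>
        eventually_imp_distrib_left.2 fun hjγ => ?_
      have hx := hxpos j hjγ
      refine eventually_lt_mul_pairG hμ (by positivity) (hβ.trans_le (le_of_eq ?_))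
      have : xInv F μ j k₀ z / z / z⁻¹ = xInv F μ j k₀ z := by field_simp
      rw [this, (xInv_spec (hμ j) (hμ k₀) (hlt j hj hjγ).ne hz0.le (hzS j (hSmem j hj hjγ))).2,
        inv_mul_cancel₀ hz0.ne']
    have e3 : ∀ᶠ ν : Fin K → ℝ in 𝓝 μ, ∀ k, β < (F.d (μ k) γ)⁻¹ * F.dExp (ν k) γ := by
      refine eventually_all.2 fun k => eventually_lt_coord_mul_dExp hγ ?_
      rw [← Family.d_eq (F.means_subset_closedMeans (hμ k)) hγ, inv_mul_cancel₀ (hdpos k).ne']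
      exact hβ
    filter_upwards [h1, h2, e1, e2, e3, eventually_mem_means hμ] with ν g1 g2 g3 g4 g5 g6 N v hv
    have hk₀ν : ν k₀ < γ := (g1 k₀).1.2 hlow
    have hcand : sInf (easiest F γ ν .packing) = k₀.succ := by
      have hmem := (sInf_easiest_mem F γ ν .packing).1
      obtain ⟨k, hk⟩ : ∃ k : Fin K, sInf (easiest F γ ν .packing) = k.succ := by
        refine Fin.eq_succ_of_ne_zero fun e => ?_
        rw [e, zero_mem_correct_iff] at hmem
        exact hmem ⟨_, hk₀ν⟩
      rw [hk, succ_mem_correct_packing] at hmem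
      rw [hk, eq_of_isPacking hk₀ν (fun j hj hjγ => g2 j hj ((g1 j).1.1 hjγ)) hmem]
    rw [hcand]
    have hv₀ := hv k₀
    rw [if_pos hlow, if_neg (not_lt.2 hlow.le), add_zero, xInv_self, one_div] at hv₀
    refine le_altInf_packing hγ g6 hk₀ν
      (ofReal_le_mul_kl hγ (g6 k₀) (inv_pos.2 hz0).le hv₀ g3.le) fun j hj => ?_
    have hvj := hv j
    by_cases hjγ : μ j < γ
    · right
      rw [if_pos hjγ, if_neg (not_lt.2 hjγ.le), add_zero] at hvj
      exact ⟨g2 j hj hjγ, fun m hm => ofReal_le_mul_kl_add (g6 k₀) (g6 j) (inv_pos.2 hz0)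
        (div_pos (hxpos j hjγ) hz0).le hv₀ hvj (g4 j hj hjγ).le hm⟩
    · left
      rw [if_neg hjγ, if_pos (hgt j hjγ), zero_add] at hvj
      exact ⟨(g1 j).2.2 (hgt j hjγ), ofReal_le_mul_kl hγ (g6 j) (inv_pos.2 (hdpos j)).le hvj
        (g5 j).le⟩

/-- The unnormalized optimal proportions are continuous at the identifiable instances. -/
lemma exists_isWeight {c : Criterion} (hμ : ∀ k, μ k ∈ F.means) (hγ : γ ∈ F.means)
    (hid : Identifiable c γ μ)
    (hun : c = .anyAvailable → (∃ k, μ k < γ) → ∃! k, IsLeastLoaded μ k) :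
    ∃ ω, IsWeight F γ c μ ω := by
  by_cases hav : ∃ k, μ k < γ
  · cases c
    · exact ⟨_, isWeight_anyAvailable hμ hγ hav (hun rfl hav)⟩
    · obtain ⟨h1, h2⟩ := hid.2 hav
      exact ⟨_, isWeight_packing hμ hγ hav h1 h2⟩
    · exact ⟨_, isWeight_leastLoaded hμ hγ hav (hid.2 hav)⟩
  · exact ⟨_, isWeight_of_not_available hμ hγ (lt_of_not_available hid hav)⟩

/-- Near an identifiable instance, measuring all slices equally often is informative. -/
lemma exists_le_altInf {c : Criterion} (hμ : ∀ k, μ k ∈ F.means) (hγ : γ ∈ F.means)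
    (hid : Identifiable c γ μ) :
    ∃ β : ℝ, 0 < β ∧ ∀ᶠ ν in 𝓝 μ, ∀ (N : ℝ≥0∞) (v : Fin K → ℝ≥0∞), (∀ k, N ≤ v k) →
      N * ENNReal.ofReal β ≤ altInf F γ ν c v (sInf (easiest F γ ν c)) := by
  -- Here several slices may be least loaded and the candidate may jump between them. At each nearby
  -- instance it is still least loaded, so its divergence to `γ` is at least that of the slice `kLow
  -- μ`.
  by_cases hcase : c = .anyAvailable ∧ ∃ k, μ k < γ
  · obtain ⟨rfl, hav⟩ := hcase
    have hlow : μ (kLow μ) < γ := by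
      obtain ⟨k, hk⟩ := hav
      exact (kLow_spec μ k).trans_lt hk
    have hpos := Family.dExp_pos_of_mem (hμ (kLow μ)) hγ hlow.ne
    refine ⟨F.dExp (μ (kLow μ)) γ / 2, by linarith, ?_⟩
    filter_upwards [eventually_mem_means hμ, (tendsto_coord μ _).eventually (gt_mem_nhds hlow),
      (Family.tendsto_dExp (tendsto_coord μ (kLow μ)) tendsto_const_nhds hγ).eventually
        (lt_mem_nhds (half_lt_self hpos))] with ν g1 g2 g3 N v hv
    have hmem := sInf_easiest_mem F γ ν .anyAvailable
    obtain ⟨k, hk⟩ : ∃ k : Fin K, sInf (easiest F γ ν .anyAvailable) = k.succ := by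
      refine Fin.eq_succ_of_ne_zero fun e => ?_
      have := hmem.1
      rw [e, zero_mem_correct_iff] at this
      exact this ⟨_, g2⟩
    rw [hk] at hmem ⊢
    have hle := isLeastLoaded_of_mem_easiest hγ g1 hmem (kLow μ)
    have hd : F.dExp (ν (kLow μ)) γ ≤ F.dExp (ν k) γ := by
      rcases hle.lt_or_eq with h | h
      · exact (Family.dExp_lt_left (g1 k) (g1 _) hγ (Or.inl ⟨h, g2.le⟩)).le
      · rw [h]
    refine le_trans ?_ (le_altInf_anyAvailable hγ (g1 k) (hle.trans_lt g2))
    refine ofReal_le_mul_kl hγ (g1 k) zero_le_one (by simpa using hv k) ?_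
    linarith
  · obtain ⟨ω, hω⟩ := exists_isWeight hμ hγ hid fun h1 h2 => absurd ⟨h1, h2⟩ hcase
    -- Dividing by `M` makes all optimal weights at most `1`, so equal measurements dominate them.
    set M : ℝ := 1 + ∑ k, ω μ k with hM
    have hM0 : 0 < M := by
      have := Finset.sum_nonneg fun k (_ : k ∈ Finset.univ) => hω.nonneg k
      linarith
    have hωM : ∀ k, M⁻¹ * ω μ k ≤ 1 := by
      intro k
      rw [inv_mul_eq_div, div_le_one hM0]
      have := Finset.single_le_sum (fun k (_ : k ∈ Finset.univ) => hω.nonneg k) (Finset.mem_univ k)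
      linarith
    refine ⟨M⁻¹ * (1 / 2), by positivity, ?_⟩
    filter_upwards [hω.le_altInf (1 / 2) (by norm_num)] with ν hν N v hv
    refine le_trans (le_of_eq ?_) (hν (N * ENNReal.ofReal M⁻¹) v fun k => ?_)
    · rw [mul_assoc, ENNReal.ofReal_mul (by positivity)]
    · rw [mul_assoc, ← ENNReal.ofReal_mul (by positivity)]
      refine le_trans ?_ (hv k)
      calc N * ENNReal.ofReal (M⁻¹ * ω μ k) ≤ N * 1 :=
            mul_le_mul_right (ENNReal.ofReal_le_one.2 (hωM k)) _
        _ = N := mul_one N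

end Weights

/-! ### Forced exploration and tracking -/

lemma count_cons (j : Fin K) (v : ℕ) (h : History K) (k : Fin K) :
    count ((j, v) :: h) k = count h k + if j = k then 1 else 0 := by
  by_cases hk : j = k
  · subst hk; simp [count_cons_self]
  · simp [hk, count_cons_of_ne hk]

lemma Algorithm.count_hist_succ (A : Algorithm K) (x : Outcomes K) (t : ℕ) (k : Fin K) :
    count (A.hist x (t + 1)) k =
      count (A.hist x t) k + if A.sample (A.hist x t) = k then 1 else 0 :=
  count_cons _ _ _ _

lemma Algorithm.count_hist_mono (A : Algorithm K) (x : Outcomes K) (k : Fin K) :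
    Monotone fun t => count (A.hist x t) k :=
  monotone_nat_of_le_succ fun t => by rw [A.count_hist_succ]; lia

lemma Algorithm.roundNo_hist (A : Algorithm K) (x : Outcomes K) (t : ℕ) :
    roundNo (A.hist x t) = t + 1 := by rw [roundNo, A.length_hist]

/-- Forced exploration: after `t` rounds all slices were measured about `√t` times. -/
lemma le_sq_count_add [NeZero K] {F : Family} {c : Criterion} {γ : ℝ} {A : Algorithm K}
    (hA : IsTrackingRule F c γ A.sample) (x : Outcomes K) (T : ℕ) (k : Fin K) :
    T ≤ (count (A.hist x T) k + K) ^ 2 := by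
  set m := count (A.hist x T) k with hm
  have hK : 1 ≤ K := Nat.one_le_iff_ne_zero.2 (NeZero.ne K)
  -- Once `t ≥ m²`, slice `k` itself triggers forced exploration. The chosen slice then has at most
  -- `m` measurements and raises the sum of the counts truncated at `m + 1`, whose capacity is `K (m
  -- + 1)`.
  have key : ∀ t, t ≤ T → t ≤ m ^ 2 + ∑ j, min (count (A.hist x t) j) (m + 1) := by
    intro t
    induction t with
    | zero => simp
    | succ t ih =>
      intro htT
      by_cases ht : t + 1 ≤ m ^ 2
      · lia
      have hkm : count (A.hist x t) k ≤ m := A.count_hist_mono x k (by lia)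
      have hforce : ∃ i, (count (A.hist x t) i : ℝ) < √(roundNo (A.hist x t) : ℝ) := by
        refine ⟨k, Real.lt_sqrt_of_sq_lt ?_⟩
        rw [A.roundNo_hist]
        have : count (A.hist x t) k ^ 2 < t + 1 :=
          lt_of_le_of_lt (Nat.pow_le_pow_left hkm 2) (not_le.1 ht)
        exact_mod_cast this
      have hle := ((hA _).1 hforce k).trans hkm
      have hlt : ∑ j, min (count (A.hist x t) j) (m + 1) <
          ∑ j, min (count (A.hist x (t + 1)) j) (m + 1) := by
        refine Finset.sum_lt_sum (fun j _ => min_le_min_right _ (A.count_hist_mono x j (Nat.le_succ t)))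
          ⟨A.sample (A.hist x t), Finset.mem_univ _, ?_⟩
        rw [A.count_hist_succ, if_pos rfl]
        lia
      have := ih (by lia)
      lia
  have h1 := key T le_rfl
  have h2 : ∑ j, min (count (A.hist x T) j) (m + 1) ≤ K * (m + 1) := by
    refine (Finset.sum_le_card_nsmul _ _ (m + 1) fun j _ => min_le_right _ _).trans ?_
    simp
  nlinarith

lemma sqrt_sub_le_count [NeZero K] {F : Family} {c : Criterion} {γ : ℝ} {A : Algorithm K}
    (hA : IsTrackingRule F c γ A.sample) (x : Outcomes K) {s t : ℕ} (hst : s ≤ t) (k : Fin K) :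
    Nat.sqrt s - K ≤ count (A.hist x t) k := by
  have h := hst.trans (le_sq_count_add hA x t k)
  have h2 : Nat.sqrt s ≤ count (A.hist x t) k + K := by
    rw [← Nat.sqrt_eq' (count (A.hist x t) k + K)]
    exact Nat.sqrt_le_sqrt h
  lia

/-- While the tracked proportions are at most `w + η`, the counts follow them from above. -/
lemma count_hist_le [NeZero K] {F : Family} {c : Criterion} {γ : ℝ} {A : Algorithm K}
    (hA : IsTrackingRule F c γ A.sample) (x : Outcomes K) {t₀ t : ℕ} (ht : t₀ ≤ t) {w : Fin K → ℝ}
    (hw : ∀ k, 0 ≤ w k) {η : ℝ} (hη : 0 ≤ η)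
    (h : ∀ s, t₀ ≤ s → s < t → ∑ k, wStar F γ (muHat (A.hist x s)) c k = 1 ∧
      ∀ k, wStar F γ (muHat (A.hist x s)) c k ≤ w k + η) (k : Fin K) :
    (count (A.hist x t) k : ℝ) ≤ t₀ + √t + t * (w k + η) + 1 := by
  have hK : (0 : ℝ) < K := by exact_mod_cast Nat.pos_of_ne_zero (NeZero.ne K)
  induction t, ht using Nat.le_induction with
  | base =>
    have h1 := count_lt_roundNo (A.hist x t₀) k
    rw [A.roundNo_hist] at h1
    have h2 : (count (A.hist x t₀) k : ℝ) ≤ t₀ := by exact_mod_cast (by lia)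
    have := mul_nonneg (Nat.cast_nonneg (α := ℝ) t₀) (add_nonneg (hw k) hη)
    have := Real.sqrt_nonneg (t₀ : ℝ)
    linarith
  | succ t ht ih =>
    have ih' := ih fun s hs hst => h s hs (by lia)
    have hwη := add_nonneg (hw k) hη
    have hsqrt : √(t : ℝ) ≤ √((t + 1 : ℕ) : ℝ) := Real.sqrt_le_sqrt (by push_cast; linarith)
    have hmul : (t : ℝ) * (w k + η) ≤ ((t + 1 : ℕ) : ℝ) * (w k + η) :=
      mul_le_mul_of_nonneg_right (by push_cast; linarith) hwη
    rw [A.count_hist_succ]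
    split_ifs with hk
    swap
    · rw [add_zero]; linarith
    obtain ⟨hforce, htrack⟩ := hA (A.hist x t)
    rw [A.roundNo_hist] at hforce htrack
    rw [hk] at hforce htrack
    have ht0 : (0 : ℝ) ≤ t₀ := Nat.cast_nonneg _
    push_cast
    push_cast at hforce htrack hsqrt hmul
    by_cases hf : ∃ i, (count (A.hist x t) i : ℝ) < √((t : ℝ) + 1)
    · obtain ⟨i, hi⟩ := hf
      have h1 : (count (A.hist x t) k : ℝ) ≤ count (A.hist x t) i := by
        exact_mod_cast hforce ⟨i, hi⟩ i
      have h2 : (0 : ℝ) ≤ ((t : ℝ) + 1) * (w k + η) := by positivity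
      linarith
    · obtain ⟨hsum, hle⟩ := h t ht (Nat.lt_succ_self t)
      -- The proportions sum to `1`, so the deficits sum to `(t + 1) - t = 1`. The largest one is
      -- positive: the tracked slice is below its target before it is measured.
      have h1 := Finset.sum_le_sum fun i (_ : i ∈ Finset.univ) => htrack hf i
      rw [Finset.sum_sub_distrib, ← Finset.mul_sum, hsum, ← Nat.cast_sum, sum_count,
        A.length_hist, Finset.sum_const, Finset.card_univ, Fintype.card_fin, nsmul_eq_mul] at h1
      have h2 : (count (A.hist x t) k : ℝ) <
          ((t : ℝ) + 1) * wStar F γ (muHat (A.hist x t)) c k := by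
        by_contra hcon
        nlinarith
      have h3 : ((t : ℝ) + 1) * wStar F γ (muHat (A.hist x t)) c k ≤ (t + 1) * (w k + η) :=
        mul_le_mul_of_nonneg_left (hle k) (by positivity)
      have := Real.sqrt_nonneg ((t : ℝ) + 1)
      linarith

/-- The counts add up to `t` and the limits `w` to `1`; upper bounds for all other slices therefore
bound slice `k` from below. -/
lemma le_count_hist [NeZero K] {F : Family} {c : Criterion} {γ : ℝ} {A : Algorithm K}
    (hA : IsTrackingRule F c γ A.sample) (x : Outcomes K) {t₀ t : ℕ} (ht : t₀ ≤ t) {w : Fin K → ℝ}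
    (hw : ∀ k, 0 ≤ w k) (hw1 : ∑ k, w k = 1) {η : ℝ} (hη : 0 ≤ η)
    (h : ∀ s, t₀ ≤ s → s < t → ∑ k, wStar F γ (muHat (A.hist x s)) c k = 1 ∧
      ∀ k, wStar F γ (muHat (A.hist x s)) c k ≤ w k + η) (k : Fin K) :
    t * w k - K * (t₀ + √t + t * η + 1) ≤ count (A.hist x t) k := by
  classical
  have hsum := sum_count (A.hist x t)
  rw [A.length_hist, ← Finset.add_sum_erase _ _ (Finset.mem_univ k)] at hsum
  have hsum' : (count (A.hist x t) k : ℝ) + ∑ j ∈ Finset.univ.erase k, (count (A.hist x t) j : ℝ)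
      = t := by exact_mod_cast hsum
  rw [← Finset.add_sum_erase _ _ (Finset.mem_univ k)] at hw1
  have h1 := Finset.sum_le_sum fun j (_ : j ∈ Finset.univ.erase k) =>
    count_hist_le hA x ht hw hη h j
  have h2 : ∑ j ∈ Finset.univ.erase k, ((t₀ : ℝ) + √t + t * (w j + η) + 1) =
      t * ∑ j ∈ Finset.univ.erase k, w j + (K - 1 : ℕ) * (t₀ + √t + t * η + 1) := by
    have : ∀ j, (t₀ : ℝ) + √t + t * (w j + η) + 1 = t * w j + (t₀ + √t + t * η + 1) :=
      fun j => by ring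
    simp only [this]
    rw [Finset.sum_add_distrib, ← Finset.mul_sum, Finset.sum_const, nsmul_eq_mul,
      Finset.card_erase_of_mem (Finset.mem_univ k), Finset.card_univ, Fintype.card_fin]
  have h3 : ((K - 1 : ℕ) : ℝ) * (t₀ + √t + t * η + 1) ≤ K * (t₀ + √t + t * η + 1) := by
    refine mul_le_mul_of_nonneg_right ?_ (by positivity)
    exact_mod_cast Nat.sub_le K 1
  have h4 : ∑ j ∈ Finset.univ.erase k, w j = 1 - w k := by linarith
  rw [h4] at h2
  linarith

/-! ### Concentration of the sample means -/

/-- Change of measure to the mean `z`: on the event the likelihood ratio is at most `exp (-N d(z,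
μ_k))`, for all times at once. -/
lemma prob_exists_deviation_le {F : Family} {μ : Fin K → ℝ} (hμ : ∀ k, μ k ∈ F.means)
    (A : Algorithm K) (k : Fin K) {z : ℝ} (hz : z ∈ F.means) (N : ℕ) :
    prob F μ {x | ∃ t, A.hist x t ∈ {h : History K | N ≤ count h k ∧
      (μ k ≤ z ∧ z ≤ muHat h k ∨ z ≤ μ k ∧ muHat h k ≤ z)}} ≤
      ENNReal.ofReal (Real.exp (-(F.dExp z (μ k) * N))) := by
  refine (prob_exists_hist_mem_le F μ A _ {k}
    (fun _ l => ENNReal.ofReal (Real.exp (-(F.dExp z (μ k) * N))) * seqLik F z l)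
    (fun _ _ => (isSubLik_seqLik F z).const_mul _) ?_).trans (le_of_eq (by simp))
  rintro h ⟨hN, hdev⟩
  rw [Finset.prod_singleton, Finset.prod_singleton]
  have hd := Family.dExp_nonneg_of_mem hz (hμ k)
  have hlen : (0 : ℝ) ≤ (obs k h).length := by positivity
  refine (seqLik_le_of_tilt (hμ k) hz ?_).trans (mul_le_mul_left (ENNReal.ofReal_le_ofReal
    (Real.exp_le_exp.2 (neg_le_neg ?_))) _)
  · rw [← length_mul_listMean, ← muHat_eq_listMean]
    rcases hdev with ⟨h1, h2⟩ | ⟨h1, h2⟩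
    · exact Or.inl ⟨h1, mul_le_mul_of_nonneg_left h2 hlen⟩
    · exact Or.inr ⟨h1, mul_le_mul_of_nonneg_left h2 hlen⟩
  · rw [length_obs, mul_comm]
    refine mul_le_mul_of_nonneg_right ?_ hd
    exact_mod_cast hN

/-- The sample means leave a neighbourhood of the true means with exponentially small
probability. -/
lemma exists_prob_muHat_notMem_le [NeZero K] {F : Family} {μ : Fin K → ℝ}
    (hμ : ∀ k, μ k ∈ F.means) {U : Set (Fin K → ℝ)} (hU : U ∈ 𝓝 μ) :
    ∃ r : ℝ, 0 < r ∧ ∀ (A : Algorithm K) (N : ℕ),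
      prob F μ {x | ∃ t, A.hist x t ∈ {h : History K | (∀ k, N ≤ count h k) ∧ muHat h ∉ U}} ≤
        ENNReal.ofReal (2 * K * Real.exp (-(r * N))) := by
  obtain ⟨ε, hε, hball⟩ := Metric.mem_nhds_iff.1 hU
  have hz : ∀ k, ∃ zl zu, zl ∈ F.means ∧ zu ∈ F.means ∧ zl < μ k ∧ μ k < zu ∧
      μ k - ε < zl ∧ zu < μ k + ε := by
    intro k
    obtain ⟨e, he, hsub⟩ := Metric.isOpen_iff.1 F.isOpen_means (μ k) (hμ k)
    have hm : 0 < min e ε := lt_min he hε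
    refine ⟨μ k - min e ε / 2, μ k + min e ε / 2, hsub ?_, hsub ?_, by linarith, by linarith, ?_, ?_⟩
    · rw [Metric.mem_ball, Real.dist_eq, sub_sub_cancel_left, abs_neg, abs_of_pos (by linarith)]
      linarith [min_le_left e ε]
    · rw [Metric.mem_ball, Real.dist_eq, add_sub_cancel_left, abs_of_pos (by linarith)]
      linarith [min_le_left e ε]
    · linarith [min_le_right e ε]
    · linarith [min_le_right e ε]
  choose zl zu hzl hzu hl hu hlε huε using hz
  obtain ⟨k₀, hk₀⟩ := Finite.exists_min fun k => min (F.dExp (zl k) (μ k)) (F.dExp (zu k) (μ k))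
  set r := min (F.dExp (zl k₀) (μ k₀)) (F.dExp (zu k₀) (μ k₀)) with hr
  refine ⟨r, lt_min (Family.dExp_pos_of_mem (hzl _) (hμ _) (hl _).ne)
    (Family.dExp_pos_of_mem (hzu _) (hμ _) (hu _).ne'), fun A N => ?_⟩
  have hrl : ∀ k, r ≤ F.dExp (zl k) (μ k) := fun k => (hk₀ k).trans (min_le_left _ _)
  have hru : ∀ k, r ≤ F.dExp (zu k) (μ k) := fun k => (hk₀ k).trans (min_le_right _ _)
  have hsub : {x | ∃ t, A.hist x t ∈ {h : History K | (∀ k, N ≤ count h k) ∧ muHat h ∉ U}} ⊆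
      ⋃ k, ({x | ∃ t, A.hist x t ∈ {h : History K | N ≤ count h k ∧
        (μ k ≤ zl k ∧ zl k ≤ muHat h k ∨ zl k ≤ μ k ∧ muHat h k ≤ zl k)}} ∪
        {x | ∃ t, A.hist x t ∈ {h : History K | N ≤ count h k ∧
        (μ k ≤ zu k ∧ zu k ≤ muHat h k ∨ zu k ≤ μ k ∧ muHat h k ≤ zu k)}}) := by
    rintro x ⟨t, hN, hUt⟩
    have : ∃ k, ε ≤ |muHat (A.hist x t) k - μ k| := by
      by_contra hcon
      push Not at hcon
      refine hUt (hball ?_)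
      rw [Metric.mem_ball, dist_pi_lt_iff hε]
      exact fun k => by rw [Real.dist_eq]; exact hcon k
    obtain ⟨k, hk⟩ := this
    refine Set.mem_iUnion.2 ⟨k, ?_⟩
    rcases le_abs.1 hk with h | h
    · exact Or.inr ⟨t, hN k, Or.inl ⟨(hu k).le, by linarith [huε k]⟩⟩
    · exact Or.inl ⟨t, hN k, Or.inr ⟨(hl k).le, by linarith [hlε k]⟩⟩
  refine (measure_mono hsub).trans ((measure_iUnion_fintype_le _ _).trans ?_)
  have hterm : ∀ k, prob F μ ({x | ∃ t, A.hist x t ∈ {h : History K | N ≤ count h k ∧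
        (μ k ≤ zl k ∧ zl k ≤ muHat h k ∨ zl k ≤ μ k ∧ muHat h k ≤ zl k)}} ∪
        {x | ∃ t, A.hist x t ∈ {h : History K | N ≤ count h k ∧
        (μ k ≤ zu k ∧ zu k ≤ muHat h k ∨ zu k ≤ μ k ∧ muHat h k ≤ zu k)}}) ≤
      ENNReal.ofReal (2 * Real.exp (-(r * N))) := by
    intro k
    refine (measure_union_le _ _).trans ((add_le_add (prob_exists_deviation_le hμ A k (hzl k) N)
      (prob_exists_deviation_le hμ A k (hzu k) N)).trans ?_)
    rw [← ENNReal.ofReal_add (Real.exp_nonneg _) (Real.exp_nonneg _)]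
    refine ENNReal.ofReal_le_ofReal ?_
    have hN : (0 : ℝ) ≤ N := by positivity
    have e1 : Real.exp (-(F.dExp (zl k) (μ k) * N)) ≤ Real.exp (-(r * N)) :=
      Real.exp_le_exp.2 (neg_le_neg (mul_le_mul_of_nonneg_right (hrl k) hN))
    have e2 : Real.exp (-(F.dExp (zu k) (μ k) * N)) ≤ Real.exp (-(r * N)) :=
      Real.exp_le_exp.2 (neg_le_neg (mul_le_mul_of_nonneg_right (hru k) hN))
    linarith
  refine (Finset.sum_le_sum fun k _ => hterm k).trans (le_of_eq ?_)
  rw [Finset.sum_const, Finset.card_univ, Fintype.card_fin, nsmul_eq_mul, ← ENNReal.ofReal_natCast,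
    ← ENNReal.ofReal_mul (by positivity)]
  congr 1
  ring

/-! ### Termination -/

lemma eventually_threshold_lt {C δ β : ℝ} (hC : 0 < C) (hδ : 0 < δ) (hβ : 0 < β) (m : ℕ) :
    ∀ᶠ t : ℕ in atTop, threshold C δ (t + 1) < ((Nat.sqrt t - m : ℕ) : ℝ) * β := by
  have hs : Tendsto (fun t : ℕ => √((t : ℝ) + 1)) atTop atTop :=
    Real.tendsto_sqrt_atTop.comp (tendsto_atTop_add_const_right _ 1 tendsto_natCast_atTop_atTop)
  have h1 : ∀ᶠ s : ℝ in atTop, Real.log s ≤ β / 8 * s := by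
    filter_upwards [Real.isLittleO_log_id_atTop.bound (show 0 < β / 8 by positivity),
      eventually_ge_atTop 0] with s hs h0
    rw [Real.norm_eq_abs, Real.norm_eq_abs, id, abs_of_nonneg h0] at hs
    exact (le_abs_self _).trans hs
  filter_upwards [hs.eventually h1, hs.eventually (eventually_gt_atTop
    (2 / β * (Real.log (C / δ) + β * (m + 2))))] with t g1 g2
  have ht0 : (0 : ℝ) < t + 1 := by positivity
  have hthr : threshold C δ (t + 1) = Real.log (C / δ) + 4 * Real.log (√((t : ℝ) + 1)) := by
    rw [threshold, mul_div_right_comm, Real.log_mul (by positivity) (by positivity), Real.log_pow,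
      Real.log_sqrt ht0.le]
    push_cast; ring
  have hsq : √((t : ℝ) + 1) ≤ Nat.sqrt t + 2 := by
    rw [Real.sqrt_le_left (by positivity)]
    have : t < (Nat.sqrt t + 1) * (Nat.sqrt t + 1) := Nat.lt_succ_sqrt t
    have h3 : (t : ℝ) + 1 ≤ (Nat.sqrt t + 1) * (Nat.sqrt t + 1) := by exact_mod_cast this
    nlinarith [Nat.cast_nonneg (α := ℝ) (Nat.sqrt t)]
  have hsub : (Nat.sqrt t : ℝ) - m ≤ ((Nat.sqrt t - m : ℕ) : ℝ) := by
    rw [sub_le_iff_le_add]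
    exact_mod_cast (by lia : Nat.sqrt t ≤ Nat.sqrt t - m + m)
  rw [hthr]
  have h2 : Real.log (C / δ) + β * (m + 2) < β / 2 * √((t : ℝ) + 1) := by
    have := mul_lt_mul_of_pos_left g2 (show 0 < β / 2 by positivity)
    have e : β / 2 * (2 / β * (Real.log (C / δ) + β * (m + 2))) =
        Real.log (C / δ) + β * (m + 2) := by field_simp
    rw [e] at this
    exact this
  nlinarith

/-- Track-and-Stop terminates almost surely. -/
lemma ae_tau_ne_top [NeZero K] {F : Family} {c : Criterion} {γ C δ : ℝ} {μ : Fin K → ℝ}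
    (hμ : ∀ k, μ k ∈ F.means) (hγ : γ ∈ F.means) (hid : Identifiable c γ μ) (hC : 1 ≤ C)
    (hδ : δ ∈ Set.Ioo (0 : ℝ) 1) {ρ : History K → Fin K} (hρ : IsTrackingRule F c γ ρ) :
    ∀ᵐ x ∂prob F μ, (trackAndStop F c γ C δ ρ).tau x ≠ ⊤ := by
  set A := trackAndStop F c γ C δ ρ with hA
  have hAρ : IsTrackingRule F c γ A.sample := hρ
  obtain ⟨β, hβ, hev⟩ := exists_le_altInf hμ hγ hid
  obtain ⟨r, hr, hprob⟩ := exists_prob_muHat_notMem_le hμ hev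
  rw [ae_iff]
  simp only [ne_eq, not_not]
  -- If the algorithm has not stopped at a large time `t`, the sample means at that time lie outside
  -- the neighbourhood where the information exceeds the threshold.
  have hbound : ∀ᶠ t : ℕ in atTop, prob F μ {x | A.tau x = ⊤} ≤
      ENNReal.ofReal (2 * K * Real.exp (-(r * (Nat.sqrt t - K : ℕ)))) := by
    filter_upwards [eventually_threshold_lt (C := C) (δ := δ) (by linarith) hδ.1 hβ K] with t ht
    refine le_trans (measure_mono ?_) (hprob A (Nat.sqrt t - K))
    intro x hx
    have hx : A.tau x = ⊤ := hx
    have hnh : A.hist x t ∈ {h | ¬ A.halts h} :=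
      A.lt_tau_subset t (show (t : ℕ∞) < A.tau x by rw [hx]; exact ENat.natCast_lt_top t)
    refine ⟨t, fun k => sqrt_sub_le_count hAρ x le_rfl k, fun hU => hnh ?_⟩
    have hQ := hU ((Nat.sqrt t - K : ℕ) : ℝ≥0∞) (fun k => (count (A.hist x t) k : ℝ≥0∞))
      fun k => by exact_mod_cast sqrt_sub_le_count hAρ x le_rfl k
    refine lt_of_lt_of_le ?_ hQ
    rw [A.roundNo_hist, ← ENNReal.ofReal_natCast, ← ENNReal.ofReal_mul (by positivity)]
    exact (ENNReal.ofReal_lt_ofReal_iff ((threshold_pos hC hδ (Nat.succ_pos t)).trans ht)).2 ht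
  have hlim : Tendsto (fun t : ℕ => ENNReal.ofReal (2 * K * Real.exp (-(r * (Nat.sqrt t - K : ℕ)))))
      atTop (𝓝 0) := by
    have h1 : Tendsto (fun t : ℕ => Nat.sqrt t - K) atTop atTop := by
      refine tendsto_atTop.2 fun b => ?_
      filter_upwards [eventually_ge_atTop ((b + K) ^ 2)] with t ht
      have := Nat.le_sqrt'.2 ht
      lia
    have h2 : Tendsto (fun t : ℕ => 2 * K * Real.exp (-(r * (Nat.sqrt t - K : ℕ)))) atTop
        (𝓝 (2 * K * 0)) :=
      (Real.tendsto_exp_neg_atTop_nhds_zero.comp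
        ((tendsto_natCast_atTop_atTop.comp h1).const_mul_atTop hr)).const_mul _
    rw [mul_zero] at h2
    have := (ENNReal.continuous_ofReal.tendsto 0).comp h2
    rwa [ENNReal.ofReal_zero] at this
  exact le_antisymm (ge_of_tendsto hlim hbound) zero_le

/-! ### The expected measurement cost -/

/-- The fourth-order term of the exponential series already gives a bound of order `t^(-2)`. -/
lemma tsum_ofReal_exp_sqrt_ne_top {r a : ℝ} (hr : 0 < r) (ha : 0 ≤ a) {p : ℕ} (hp : 0 < p) (m : ℕ) :
    ∑' t : ℕ, ENNReal.ofReal (a * Real.exp (-(r * (Nat.sqrt (t / p) - m : ℕ)))) ≠ ⊤ := by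
  set D : ℝ := a * (Real.exp (r * (m + 1)) * (24 * p ^ 2 / r ^ 4)) with hD
  have hle : ∀ t : ℕ, a * Real.exp (-(r * (Nat.sqrt (t / p) - m : ℕ))) ≤
      D * (1 / ((t : ℝ) + 1) ^ 2) := by
    intro t
    set N := Nat.sqrt (t / p) - m with hN
    set M : ℝ := N + m + 1 with hM
    have hM0 : 0 < M := by positivity
    have hp0 : (0 : ℝ) < p := by exact_mod_cast hp
    have h1 : (t : ℝ) + 1 ≤ p * M ^ 2 := by
      have e1 : t / p < (Nat.sqrt (t / p) + 1) * (Nat.sqrt (t / p) + 1) := Nat.lt_succ_sqrt _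
      have e2 : Nat.sqrt (t / p) + 1 ≤ N + m + 1 := by lia
      have e3 : t / p + 1 ≤ (N + m + 1) * (N + m + 1) := by nlinarith
      have e4 : t + 1 ≤ p * (t / p + 1) := Nat.lt_mul_div_succ t hp
      have e5 : t + 1 ≤ p * ((N + m + 1) * (N + m + 1)) := e4.trans (Nat.mul_le_mul_left p e3)
      rw [hM, sq]
      exact_mod_cast e5
    have h2 : (r * M) ^ 4 / 24 ≤ Real.exp (r * M) := by
      have := Real.pow_div_factorial_le_exp (r * M) (by positivity) 4
      simpa [Nat.factorial] using this
    have h3 : Real.exp (-(r * N)) = Real.exp (r * (m + 1)) / Real.exp (r * M) := by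
      rw [← Real.exp_sub]; congr 1; rw [hM]; ring
    have h4 : Real.exp (-(r * N)) ≤ Real.exp (r * (m + 1)) * (24 * p ^ 2 / r ^ 4) *
        (1 / ((t : ℝ) + 1) ^ 2) := by
      rw [h3, mul_assoc, div_eq_mul_inv]
      refine mul_le_mul_of_nonneg_left ?_ (Real.exp_nonneg _)
      calc (Real.exp (r * M))⁻¹ ≤ ((r * M) ^ 4 / 24)⁻¹ := by gcongr
        _ = 24 / r ^ 4 * (1 / (M ^ 2) ^ 2) := by field_simp
        _ ≤ 24 / r ^ 4 * (1 / (((t : ℝ) + 1) / p) ^ 2) := by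
            gcongr
            rw [div_le_iff₀ hp0]; linarith
        _ = _ := by field_simp
    rw [hD, mul_assoc]
    exact mul_le_mul_of_nonneg_left h4 ha
  have hsum : Summable fun t : ℕ => D * (1 / ((t : ℝ) + 1) ^ 2) := by
    have := (summable_nat_add_iff 1).2 (Real.summable_one_div_nat_pow.2 (by norm_num : 1 < 2))
    refine Summable.mul_left D ?_
    simpa using this
  refine ne_top_of_le_ne_top hsum.tsum_ofReal_ne_top
    (ENNReal.tsum_le_tsum fun t => ENNReal.ofReal_le_ofReal (hle t))

lemma Algorithm.tau_le_tsum (A : Algorithm K) (x : Outcomes K) :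
    (A.tau x : ℝ≥0∞) ≤ ∑' t : ℕ, {x | A.hist x t ∈ {h | ¬ A.halts h}}.indicator 1 x := by
  have h1 : ∀ t : ℕ, (t : ℕ∞) < A.tau x →
      ({x | A.hist x t ∈ {h | ¬ A.halts h}}.indicator 1 x : ℝ≥0∞) = 1 := fun t ht =>
    Set.indicator_of_mem (A.lt_tau_subset t ht) _
  rcases eq_or_ne (A.tau x) ⊤ with h | h
  · have h2 : ∀ t : ℕ, ({x | A.hist x t ∈ {h | ¬ A.halts h}}.indicator 1 x : ℝ≥0∞) = 1 :=
      fun t => h1 t (by rw [h]; exact ENat.natCast_lt_top t)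
    simp only [h2]
    rw [ENNReal.tsum_const_eq_top_of_ne_zero one_ne_zero]
    exact le_top
  · obtain ⟨n, hn⟩ := ENat.ne_top_iff_exists.1 h
    rw [← hn] at h1 ⊢
    refine le_trans (le_of_eq ?_) (ENNReal.sum_le_tsum (Finset.range n))
    rw [Finset.sum_congr rfl fun t ht => h1 t (by exact_mod_cast Finset.mem_range.1 ht)]
    simp

lemma expectedCost_le_tsum (F : Family) (μ : Fin K → ℝ) (A : Algorithm K) :
    A.expectedCost F μ ≤ ∑' t : ℕ, prob F μ {x | A.hist x t ∈ {h | ¬ A.halts h}} := by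
  refine (lintegral_mono fun x => A.tau_le_tsum x).trans (le_of_eq ?_)
  rw [lintegral_tsum fun t => (measurable_one.indicator (measurableSet_hist_mem A t _)).aemeasurable]
  refine tsum_congr fun t => ?_
  rw [lintegral_indicator_one (measurableSet_hist_mem A t _)]

lemma eventually_add_log_le {a b η : ℝ} (hη : 0 < η) :
    ∀ᶠ t : ℕ in atTop, a + b * √(t : ℝ) + 2 * Real.log ((t : ℝ) + 1) ≤ η * t := by
  have hs : Tendsto (fun t : ℕ => √((t : ℝ) + 1)) atTop atTop :=
    Real.tendsto_sqrt_atTop.comp (tendsto_atTop_add_const_right _ 1 tendsto_natCast_atTop_atTop)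
  filter_upwards [hs.eventually (eventually_ge_atTop ((|a| + |b| + 4 + η) / η + 1))] with t ht
  set s := √((t : ℝ) + 1) with hsdef
  have ht0 : (0 : ℝ) < t + 1 := by positivity
  have hs2 : s ^ 2 = t + 1 := Real.sq_sqrt ht0.le
  have hs1 : 1 ≤ s := by
    have : 0 ≤ (|a| + |b| + 4 + η) / η := by positivity
    linarith
  have hlog : Real.log ((t : ℝ) + 1) ≤ 2 * s := by
    rw [← hs2, Real.log_pow]
    have := Real.log_le_sub_one_of_pos (show 0 < s by linarith)
    push_cast; linarith
  have hsq : √(t : ℝ) ≤ s := Real.sqrt_le_sqrt (by linarith)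
  have h1 : a ≤ |a| * s := (le_abs_self a).trans (by nlinarith [abs_nonneg a])
  have h2 : b * √(t : ℝ) ≤ |b| * s :=
    mul_le_mul (le_abs_self b) hsq (Real.sqrt_nonneg _) (abs_nonneg b)
  have h3 : |a| + |b| + 4 + η ≤ η * s := by
    have := mul_le_mul_of_nonneg_left ht hη.le
    have e : η * ((|a| + |b| + 4 + η) / η + 1) = |a| + |b| + 4 + η + η := by field_simp
    rw [e] at this
    linarith
  have h4 : (|a| + |b| + 4 + η) * s ≤ η * s * s := mul_le_mul_of_nonneg_right h3 (by linarith)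
  have h5 : η * t = η * s * s - η := by
    have : (t : ℝ) = s ^ 2 - 1 := by linarith
    rw [this]; ring
  nlinarith

/-- After `3/2 T log(1/δ)` rounds Track-and-Stop has stopped, up to a summable probability. -/
lemma exists_prob_not_halts_le [NeZero K] {F : Family} {c : Criterion} {γ C : ℝ} {μ : Fin K → ℝ}
    (hμ : ∀ k, μ k ∈ F.means) (hγ : γ ∈ F.means) (hid : Identifiable c γ μ)
    (hun : ∃! k, IsLeastLoaded μ k) (hC : 1 ≤ C) {ρ : History K → Fin K}
    (hρ : IsTrackingRule F c γ ρ) :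
    0 < charTime F γ μ c ∧ ∃ (t₂ : ℕ) (b : ℕ → ℝ≥0∞), ∑' t, b t ≠ ⊤ ∧
      ∀ δ ∈ Set.Ioo (0 : ℝ) 1, ∀ t : ℕ, t₂ ≤ t →
        3 / 2 * charTime F γ μ c * Real.log (1 / δ) < t →
        prob F μ {x | (trackAndStop F c γ C δ ρ).hist x t ∈
          {h | ¬ (trackAndStop F c γ C δ ρ).halts h}} ≤ b t := by
  obtain ⟨ω, hω⟩ := exists_isWeight hμ hγ hid fun _ _ => hun
  set T := charTime F γ μ c with hT
  have hTsum : T = ∑ k, ω μ k := hω.charTime_eq.self_of_nhds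
  have hT0 : 0 < T := by
    obtain ⟨k, hk⟩ := hω.exists_pos
    rw [hTsum]
    exact Finset.sum_pos' (fun k _ => hω.nonneg k) ⟨k, Finset.mem_univ k, hk⟩
  refine ⟨hT0, ?_⟩
  set w : Fin K → ℝ := fun k => ω μ k / T with hw
  have hw0 : ∀ k, 0 ≤ w k := fun k => div_nonneg (hω.nonneg k) hT0.le
  have hw1 : ∑ k, w k = 1 := by rw [← Finset.sum_div, ← hTsum, div_self hT0.ne']
  have hK : (0 : ℝ) < K := by exact_mod_cast Nat.pos_of_ne_zero (NeZero.ne K)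
  have hct : Tendsto (fun ν => charTime F γ ν c) (𝓝 μ) (𝓝 T) := by
    rw [hTsum]
    refine (tendsto_finsetSum Finset.univ fun k _ => hω.tendsto k).congr' ?_
    filter_upwards [hω.charTime_eq] with ν hν
    exact hν.symm
  obtain ⟨wm, hwm0, hwm⟩ : ∃ wm : ℝ, 0 < wm ∧ ∀ k, 0 < w k → wm ≤ w k := by
    obtain ⟨k, hk, hmin⟩ := Finset.exists_min_image (Finset.univ.filter fun k => 0 < w k) w (by
      obtain ⟨k, hk⟩ := hω.exists_pos
      exact ⟨k, by simpa using div_pos hk hT0⟩)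
    exact ⟨w k, by simpa using hk, fun j hj => hmin j (by simpa using hj)⟩
  -- Tracking loses at most `3 K η t = wm t / 6`, hence at most a sixth of every positive target.
  set η : ℝ := wm / (18 * K) with hη
  have hη0 : 0 < η := by positivity
  have hU : ∀ᶠ ν in 𝓝 μ, (∑ k, wStar F γ ν c k = 1 ∧ ∀ k, wStar F γ ν c k ≤ w k + η) ∧
      ∀ (N : ℝ≥0∞) (v : Fin K → ℝ≥0∞), (∀ k, N * ENNReal.ofReal (ω μ k) ≤ v k) →
      N * ENNReal.ofReal (9 / 10) ≤ altInf F γ ν c v (sInf (easiest F γ ν c)) := by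
    have e1 : ∀ᶠ ν in 𝓝 μ, ∀ k, ω ν k / charTime F γ ν c < w k + η :=
      eventually_all.2 fun k => ((hω.tendsto k).div hct hT0.ne').eventually
        (gt_mem_nhds (by linarith))
    filter_upwards [hω.charTime_eq, hω.wStar_eq, hct.eventually (lt_mem_nhds hT0), e1,
      hω.le_altInf (9 / 10) (by norm_num)] with ν g1 g2 g3 g4 g5
    refine ⟨⟨?_, fun k => by rw [g2 k]; exact (g4 k).le⟩, g5⟩
    simp only [g2]
    rw [← Finset.sum_div, ← g1, div_self g3.ne']
  obtain ⟨r, hr, hprob⟩ := exists_prob_muHat_notMem_le hμ hU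
  -- The sample means are required to be good only from round `t / p` on; the uncontrolled initial
  -- phase is at most `η t`, while the exploration by then is still of order `√t`.
  obtain ⟨p, hp⟩ := exists_nat_ge (max 1 (1 / η))
  have hp1 : (1 : ℝ) ≤ p := (le_max_left _ _).trans hp
  have hp0 : 0 < p := by exact_mod_cast lt_of_lt_of_le one_pos hp1
  have hp' : 1 / (p : ℝ) ≤ η := by
    rw [div_le_iff₀ (by linarith)]
    have := (le_max_right (1 : ℝ) (1 / η)).trans hp
    rw [div_le_iff₀ hη0] at this
    linarith
  have hev1 := eventually_add_log_le (a := Real.log C) (b := 0) (show 0 < 1 / (12 * T) by positivity)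
  have hev2 := eventually_add_log_le (a := 1) (b := 1) hη0
  obtain ⟨t₂, ht₂⟩ := eventually_atTop.1 (hev1.and hev2)
  refine ⟨t₂, fun t => ENNReal.ofReal (2 * K * Real.exp (-(r * (Nat.sqrt (t / p) - K : ℕ)))),
    tsum_ofReal_exp_sqrt_ne_top hr (by positivity) hp0 K, fun δ hδ t ht htδ => ?_⟩
  set A := trackAndStop F c γ C δ ρ with hA
  have hAρ : IsTrackingRule F c γ A.sample := hρ
  obtain ⟨hlog, hlin⟩ := ht₂ t ht
  refine le_trans (measure_mono ?_) (hprob A (Nat.sqrt (t / p) - K))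
  intro x hx
  by_contra hgood
  have hgood' : ∀ s, t / p ≤ s → muHat (A.hist x s) ∈ {ν | (∑ k, wStar F γ ν c k = 1 ∧
      ∀ k, wStar F γ ν c k ≤ w k + η) ∧
      ∀ (N : ℝ≥0∞) (v : Fin K → ℝ≥0∞), (∀ k, N * ENNReal.ofReal (ω μ k) ≤ v k) →
      N * ENNReal.ofReal (9 / 10) ≤ altInf F γ ν c v (sInf (easiest F γ ν c))} := by
    intro s hs
    by_contra hcon
    exact hgood ⟨s, fun k => sqrt_sub_le_count hAρ x hs k, hcon⟩
  have htp : t / p ≤ t := Nat.div_le_self t p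
  have hcount : ∀ k, 5 / 6 * t * w k ≤ count (A.hist x t) k := by
    intro k
    rcases (hw0 k).lt_or_eq with hk | hk
    · have h1 := le_count_hist hAρ x htp hw0 hw1 hη0.le (fun s hs _ => (hgood' s hs).1) k
      have h2 : ((t / p : ℕ) : ℝ) ≤ η * t := by
        refine Nat.cast_div_le.trans ?_
        rw [div_eq_mul_one_div, mul_comm]
        exact mul_le_mul_of_nonneg_right hp' (by positivity)
      have h3 : (0 : ℝ) ≤ Real.log ((t : ℝ) + 1) :=
        Real.log_nonneg (by linarith [Nat.cast_nonneg (α := ℝ) t])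
      have h4 : (K : ℝ) * ((t / p : ℕ) + √(t : ℝ) + t * η + 1) ≤ K * (3 * η * t) := by
        refine mul_le_mul_of_nonneg_left ?_ hK.le
        linarith
      have h5 : (K : ℝ) * (3 * η * t) = wm / 6 * t := by rw [hη]; field_simp; ring
      have h6 : wm / 6 * t ≤ w k / 6 * t := by
        have := hwm k hk
        gcongr
      linarith
    · rw [← hk]; simp
  have hQ := (hgood' t htp).2 (ENNReal.ofReal (5 / 6 * t / T))
    (fun k => (count (A.hist x t) k : ℝ≥0∞)) fun k => by
      rw [← ENNReal.ofReal_mul (by positivity), ← ENNReal.ofReal_natCast]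
      refine ENNReal.ofReal_le_ofReal (le_trans (le_of_eq ?_) (hcount k))
      rw [hw]; field_simp
  refine hx (lt_of_lt_of_le ?_ hQ)
  rw [A.roundNo_hist, ← ENNReal.ofReal_mul (by positivity)]
  have hpos := threshold_pos hC hδ (Nat.succ_pos t)
  -- The information rate is `5/6 · 9/10 = 2/3 + 1/12`. The part `2/3` pays for `log (1 / δ)` as
  -- soon as `t > 3/2 T log (1 / δ)`; the rest pays for the terms of order `log t`.
  have hthr : threshold C δ (t + 1) < 5 / 6 * t / T * (9 / 10) := by
    have e1 : threshold C δ (t + 1) = Real.log (1 / δ) + Real.log C + 2 * Real.log ((t : ℝ) + 1) := by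
      have hδ0 := hδ.1
      rw [threshold, mul_div_right_comm, Real.log_mul (by positivity) (by positivity), Real.log_pow,
        Real.log_div (by positivity) hδ0.ne', one_div, Real.log_inv]
      push_cast; ring
    have e2 : Real.log (1 / δ) < 2 / 3 * t / T := by
      rw [lt_div_iff₀ hT0]
      linarith
    have e3 : 5 / 6 * t / T * (9 / 10) = 2 / 3 * t / T + 1 / (12 * T) * t := by
      field_simp; ring
    rw [e1, e3]
    linarith
  exact (ENNReal.ofReal_lt_ofReal_iff (hpos.trans hthr)).2 hthr

/-- The divergence is `(1 - 2 δ) log ((1 - δ) / δ)`, where `1 - 2 δ ≥ 4/5` and `log (1 - δ) ≥ -1`.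
-/
lemma d_bernoulli_ge {δ : ℝ} (hδ0 : 0 < δ) (hδ : δ < 1 / 10) :
    4 / 5 * (Real.log (1 / δ) - 1) ≤ Family.bernoulli.d δ (1 - δ) := by
  rw [Family.d_eq (F := .bernoulli) (show δ ∈ Set.Icc (0 : ℝ) 1 from ⟨hδ0.le, by linarith⟩)
    (show 1 - δ ∈ Set.Ioo (0 : ℝ) 1 from ⟨by linarith, by linarith⟩)]
  simp only [Family.dExp, Family.conj, Family.natParam, Family.logPart, sub_sub_cancel]
  rw [one_div, Real.log_inv]
  have h1 : -1 ≤ Real.log (1 - δ) := by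
    have := Real.one_sub_inv_le_log_of_pos (show 0 < 1 - δ by linarith)
    have h2 : (1 - δ)⁻¹ ≤ 2 := by
      rw [inv_le_comm₀ (by linarith) (by norm_num)]; linarith
    linarith
  have h2 : Real.log δ ≤ -1 := by
    have := Real.log_le_log hδ0 hδ.le
    have h3 : Real.log (1 / 10) ≤ -1 := by
      rw [Real.log_le_iff_le_exp (by norm_num)]
      have h4 := Real.exp_one_lt_d9
      rw [Real.exp_neg, ← one_div]
      exact one_div_le_one_div_of_le (Real.exp_pos 1) (by linarith)
    linarith
  nlinarith

/-- The asymptotic bound of the expected measurement cost. -/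
lemma limsup_expectedCost_le [NeZero K] {F : Family} {c : Criterion} {γ C : ℝ} {μ : Fin K → ℝ}
    (hμ : ∀ k, μ k ∈ F.means) (hγ : γ ∈ F.means) (hid : Identifiable c γ μ)
    (hun : ∃! k, IsLeastLoaded μ k) (hC : 1 ≤ C) {ρ : History K → Fin K}
    (hρ : IsTrackingRule F c γ ρ) :
    limsup (fun δ : ℝ => (trackAndStop F c γ C δ ρ).expectedCost F μ /
      ENNReal.ofReal (Family.bernoulli.d δ (1 - δ))) (𝓝[>] (0 : ℝ)) ≤
      ENNReal.ofReal (2 * charTime F γ μ c) := by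
  obtain ⟨hT0, t₂, b, hb, hbound⟩ := exists_prob_not_halts_le hμ hγ hid hun hC hρ
  set T := charTime F γ μ c with hT
  set B := (∑' t, b t).toReal with hB
  have hlog : Tendsto (fun δ : ℝ => Real.log (1 / δ)) (𝓝[>] 0) atTop := by
    simp only [one_div, Real.log_inv]
    exact tendsto_neg_atBot_atTop.comp Real.tendsto_log_nhdsGT_zero
  have hδ1 : ∀ᶠ δ : ℝ in 𝓝[>] 0, δ < 1 / 10 :=
    nhdsWithin_le_nhds (gt_mem_nhds (by norm_num))
  refine limsup_le_of_le (by isBoundedDefault) ?_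
  -- The target contains `2 · 4/5 = 8/5` times `T log (1 / δ)` against the `3/2` that is spent. The
  -- surplus `T log (1 / δ) / 10` must cover all terms independent of `δ`.
  filter_upwards [hδ1, self_mem_nhdsWithin, hlog.eventually (eventually_ge_atTop
    ((t₂ + 1 + B + 8 / 5 * T) / (T / 10)))] with δ h1 h2 h3
  have hδ0 : 0 < δ := h2
  have hδ : δ ∈ Set.Ioo (0 : ℝ) 1 := ⟨hδ0, by linarith⟩
  set A := trackAndStop F c γ C δ ρ with hA
  set Lδ := Real.log (1 / δ) with hL
  have hB0 : 0 ≤ B := ENNReal.toReal_nonneg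
  have hL0 : 0 ≤ Lδ := le_trans (by positivity) h3
  rw [div_le_iff₀ (by positivity)] at h3
  refine ENNReal.div_le_of_le_mul ?_
  set M := max t₂ (⌊3 / 2 * T * Lδ⌋₊ + 1) with hM
  have hMle : (M : ℝ) ≤ t₂ + (3 / 2 * T * Lδ + 1) := by
    have hf := Nat.floor_le (show 0 ≤ 3 / 2 * T * Lδ by positivity)
    have : M ≤ t₂ + (⌊3 / 2 * T * Lδ⌋₊ + 1) := by lia
    have h : (M : ℝ) ≤ t₂ + (⌊3 / 2 * T * Lδ⌋₊ + 1) := by exact_mod_cast this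
    linarith
  have hterm : ∀ t, prob F μ {x | A.hist x t ∈ {h | ¬ A.halts h}} ≤
      (if t < M then 1 else 0) + b t := by
    intro t
    split_ifs with ht
    · exact le_trans (by
        have := isProbabilityMeasure_prob F μ
        exact prob_le_one) le_self_add
    · rw [zero_add]
      refine hbound δ hδ t ((le_max_left _ _).trans (not_lt.1 ht)) ?_
      refine (Nat.lt_floor_add_one _).trans_le ?_
      exact_mod_cast (le_max_right _ _).trans (not_lt.1 ht)
  refine (expectedCost_le_tsum F μ A).trans ((ENNReal.tsum_le_tsum hterm).trans ?_)
  rw [ENNReal.tsum_add]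
  have hfirst : ∑' t : ℕ, (if t < M then (1 : ℝ≥0∞) else 0) = ENNReal.ofReal M := by
    rw [tsum_eq_sum (s := Finset.range M) (fun t ht => if_neg (by simpa using ht)),
      Finset.sum_congr rfl fun t ht => if_pos (Finset.mem_range.1 ht)]
    simp
  rw [hfirst, ← ENNReal.ofReal_toReal hb, ← hB, ← ENNReal.ofReal_add (by positivity) hB0,
    ← ENNReal.ofReal_mul (by positivity)]
  refine ENNReal.ofReal_le_ofReal ?_
  have hd := d_bernoulli_ge hδ0 h1
  calc (M : ℝ) + B ≤ 2 * T * (4 / 5 * (Lδ - 1)) := by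
        linarith
    _ ≤ _ := by gcongr

end SliceTaS

end

/-! ### The theorem -/

theorem theorem1 {K : ℕ} [NeZero K] (F : SliceTaS.Family) (c : SliceTaS.Criterion)
    (γ : ℝ) (hγ : γ ∈ F.means)
    (C : ℝ) (hC1 : 1 ≤ C)
    (hC : Real.exp 1 * ∑' t : ℕ, (Real.exp 1 / K) ^ K *
        (Real.log (C * ((t : ℝ) + 1) ^ 2) * Real.log ((t : ℝ) + 1)) ^ K / ((t : ℝ) + 1) ^ 2 ≤ C)
    (ρ : SliceTaS.History K → Fin K) (hρ : SliceTaS.IsTrackingRule F c γ ρ) :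
    (∀ δ ∈ Set.Ioo (0 : ℝ) 1,
      (SliceTaS.trackAndStop F c γ C δ ρ).IsDeltaPC F c γ δ
        {μ | (∀ k, μ k ∈ F.means) ∧ SliceTaS.Identifiable c γ μ} ∧
      ∀ μ : Fin K → ℝ, (∀ k, μ k ∈ F.means) →
        SliceTaS.prob F μ ((SliceTaS.trackAndStop F c γ C δ ρ).errorEvent c γ μ)
          ≤ ENNReal.ofReal δ) ∧
    ∀ μ : Fin K → ℝ, (∀ k, μ k ∈ F.means) → SliceTaS.Identifiable c γ μ →
      (∃! k, SliceTaS.IsLeastLoaded μ k) →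
      Filter.limsup
        (fun δ : ℝ => (SliceTaS.trackAndStop F c γ C δ ρ).expectedCost F μ /
          ENNReal.ofReal (SliceTaS.Family.bernoulli.d δ (1 - δ)))
        (𝓝[>] (0 : ℝ))
        ≤ ENNReal.ofReal (2 * SliceTaS.charTime F γ μ c) := by
  refine ⟨fun δ hδ => ⟨fun μ hμ => ⟨SliceTaS.ae_tau_ne_top hμ.1 hγ hμ.2 hC1 hδ hρ,
    SliceTaS.prob_errorEvent_trackAndStop_le hC1 hC hδ ρ hμ.1⟩, fun μ hμ =>
    SliceTaS.prob_errorEvent_trackAndStop_le hC1 hC hδ ρ hμ⟩, fun μ hμ hid hun =>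
    SliceTaS.limsup_expectedCost_le hμ hγ hid hun hC1 hρ⟩
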